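/- Conventions. For a finite-dimensional nilpotent real Lie algebra $\mathfrak g$ let $G$ be the connected, simply connected Lie group with Lie algebra $\mathfrak g$, so that $\exp\colon\mathfrak g\to G$ is a diffeomorphism. If $\mathfrak g$ carries an inner product, $dX$ is the associated Lebesgue measure, $i\mathfrak g^*$ carries the dual norm, and $\|\phi\|_{W^{K,1}}=\sum_{|\alpha|\le K}\|D^\alpha\phi\|_{L^1}$ with partial derivatives taken in an orthonormal basis of $\mathfrak g$. For $l\in i\mathfrak g^*$ let $\mathcal O_l=\mathrm{Ad}^*(G)l$. Choose a polarizing subalgebra $\mathfrak m$ for $l$, i.e. a subalgebra that is a maximal isotropic subspace for $(X,Y)\mapsto l([X,Y])$, and put $M=\exp\mathfrak m$, $\chi_l(\exp Y)=e^{2\pi l(Y)}$ for $Y\in\mathfrak m$. Then $\sigma_l=\mathrm{Ind}_M^G\chi_l$ acts by $(\sigma_l(x)f)(g)=f(gx)$ on the space $\mathcal H_l$ of measurable $f\colon G\to\mathbb C$ with $f(mg)=\chi_l(m)f(g)$ for all $m\in M$, $g\in G$, and $\int_{M\backslash G}|f|^2\,d\dot g<\infty$, with $\langle u,v\rangle=\int_{M\backslash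 G}u\bar v\,d\dot g$, where $d\dot g$ is a right $G$-invariant measure on $M\backslash G$, namely Lebesgue measure $dt$ in the coordinates $t\mapsto M\exp(t_1X_1)\cdots\exp(t_kX_k)$ given by any weak Malcev basis $X_1,\dots,X_k$ of $\mathfrak g$ modulo $\mathfrak m$. Write $\langle x\rangle=(1+x^2)^{1/2}$, let $B_r(\eta)$ be the closed ball of radius $r$ around $\eta$, and let $d(A,B)=\inf\{\|a-b\|:a\in A,\,b\in B\}$. Fix a finite-dimensional nilpotent real Lie algebra $\mathfrak n$ with an inner product. Write $\mathfrak g\prec\mathfrak n$ if $\mathfrak g$, with its inner product, arises from $\mathfrak n$, up to isometric isomorphism, by finitely many (possibly no) steps of the following two kinds: (1) pass from $\mathfrak h$ to $\mathfrak h/\mathbb RZ$ with $0\neq Z$ in the centre of $\mathfrak h$, with the quotient inner product; (2) if the centre of $\mathfrak h$ is a line $\mathbb RZ$, $[X,Y]=Z\ne0$, and the centralizer $\mathfrak h_0$ of $Y$ satisfies $\mathfrak h=\mathbb RX\oplus\mathfrak h_0$, pass from $\mathfrak h$ to $\mathfrak h_0$ with the restricted inner product. Theorem. For all $n,N\in\mathbb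 N$ with $N>n$ there is a constant $C_{n,N}>0$ (depending only on $\mathfrak n$, $n$, $N$) such that for every $\mathfrak g\prec\mathfrak n$ with $\dim\mathfrak g=n$ and every $0<\varepsilon<1$ there is a neighbourhood $U\subset\mathfrak g$ of $0$ such that for all $\phi\in C_c^\infty(U)$, all $l,\eta\in i\mathfrak g^*$, every choice of $\mathfrak m$ and of the Malcev basis as above, and all $u,v\in\mathcal H_l$, $$\left|\int_{\mathfrak g}\langle\sigma_l(\exp X)u,v\rangle\,\phi(X)\,e^{-2\pi\eta(X)}\,dX\right|\le C_{n,N}\,\|u\|\,\|v\|\,\|\phi\|_{W^{N+n,1}}\,\big\langle d\big(B_{\varepsilon\|\eta\|}(\eta),\mathcal O_l\big)\big\rangle^{-N}.$$ Moreover, with the same $C_{n,N}$ and $U$, the same estimate holds for all $u,v$ in the Hilbert sum $\mathcal H_l^{\oplus m}$ with the representation $\sigma_l^{\oplus m}$, for every multiplicity $m\in\mathbb N\cup\{\infty\}$. -/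

import Mathlib

open MeasureTheory Topology
open scoped ContDiff

universe u

/-- A real Lie algebra together with an inner product (no compatibility is required), in one class so
that both structures share their vector space structure. The norm, the topology, and (for the Borel
sigma-algebra) the Lebesgue measure `volume` are those of the inner product. -/
class MetricLieAlgebra (𝔤 : Type u) extends
  NormedAddCommGroup 𝔤, InnerProductSpace ℝ 𝔤, LieRing 𝔤, LieAlgebra ℝ 𝔤

namespace NilpotentOrbit

/-- `Inherits 𝔫 𝔤` means `𝔤 ≺ 𝔫`: up to isometric isomorphism, `𝔤` with its inner product arises from
`𝔫` by finitely many steps, each of which is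

* the passage to the quotient by the line spanned by a central element, with the quotient inner
  product (the one of the orthogonal complement of the line), or
* the passage to the subalgebra of codimension one of Kirillov's lemma, with the restricted inner
  product: the centre is a line `ℝ Z`, `⁅X, Y⁆ = Z`, the centralizer of `Y` is a complement
  of `ℝ X`, and the subalgebra is this centralizer. -/
inductive Inherits (𝔫 : Type u) [MetricLieAlgebra 𝔫] :
    (𝔤 : Type u) → [MetricLieAlgebra 𝔤] → Prop
  | refl (𝔤 : Type u) [MetricLieAlgebra 𝔤] (e : 𝔫 ≃ₗ⁅ℝ⁆ 𝔤) (he : ∀ x, ‖e x‖ = ‖x‖) :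
      Inherits 𝔫 𝔤
  | quotient (𝔤 𝔥 : Type u) [MetricLieAlgebra 𝔤] [MetricLieAlgebra 𝔥] (h : Inherits 𝔫 𝔤)
      (Z : 𝔤) (hZ : Z ∈ LieAlgebra.center ℝ 𝔤) (hZ0 : Z ≠ 0)
      (p : 𝔤 →ₗ⁅ℝ⁆ 𝔥) (hp : Function.Surjective p)
      (hker : ∀ x, p x = 0 ↔ x ∈ Submodule.span ℝ {Z})
      (hnorm : ∀ x ∈ (Submodule.span ℝ {Z})ᗮ, ‖p x‖ = ‖x‖) :
      Inherits 𝔫 𝔥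
  | subalgebra (𝔤 𝔥 : Type u) [MetricLieAlgebra 𝔤] [MetricLieAlgebra 𝔥] (h : Inherits 𝔫 𝔤)
      (X Y Z : 𝔤) (hZ0 : Z ≠ 0)
      (hZ : (LieAlgebra.center ℝ 𝔤).toSubmodule = Submodule.span ℝ {Z})
      (hXY : ⁅X, Y⁆ = Z)
      (hcompl : IsCompl (Submodule.span ℝ {X}) (LinearMap.ker (LieAlgebra.ad ℝ 𝔤 Y : Module.End ℝ 𝔤)))
      (j : 𝔥 →ₗ⁅ℝ⁆ 𝔤) (hnorm : ∀ x, ‖j x‖ = ‖x‖)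
      (hrange : ∀ y, y ∈ Set.range j ↔ ⁅y, Y⁆ = 0) :
      Inherits 𝔫 𝔥

noncomputable section

variable {𝔤 : Type u} [MetricLieAlgebra 𝔤]

/-! ### The group -/

/-- The right-nested bracket `[a₁, [a₂, [… , aₖ]]]` of a word. -/
def nestedBracket : List 𝔤 → 𝔤
  | [] => 0
  | [a] => a
  | a :: b :: w => ⁅a, nestedBracket (b :: w)⁆

/-- The word `X^{r₁} Y^{s₁} ⋯ X^{rₘ} Y^{sₘ}`. -/
def bchWord (X Y : 𝔤) {m : ℕ} (r s : Fin m → ℕ) : List 𝔤 :=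
  (List.ofFn fun i => List.replicate (r i) X ++ List.replicate (s i) Y).flatten

/-- The Baker-Campbell-Hausdorff product `X * Y = log (exp X exp Y)`, by Dynkin's formula
`∑ₘ (-1)^{m-1}/m ∑_{rᵢ + sᵢ > 0} [X^{r₁} Y^{s₁} ⋯ X^{rₘ} Y^{sₘ}] / (∑ᵢ (rᵢ + sᵢ) ∏ᵢ rᵢ! sᵢ!)`.

In a nilpotent Lie algebra of dimension `c` all brackets of more than `c` elements vanish (if
`c > 0`), so that `m`, `rᵢ`, `sᵢ` may be restricted to numbers `≤ c`. With this product the set `𝔤` is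
the connected, simply connected Lie group `G` with Lie algebra `𝔤`, and the exponential map
`𝔤 → G` is the identity map of the set `𝔤`. -/
def bch (X Y : 𝔤) : 𝔤 :=
  ∑ m ∈ Finset.Icc 1 (Module.finrank ℝ 𝔤), ((-1 : ℝ) ^ (m - 1) / m) •
    ∑ q : Fin m → Fin (Module.finrank ℝ 𝔤 + 1) × Fin (Module.finrank ℝ 𝔤 + 1),
      if ∀ i, 0 < ((q i).1 : ℕ) + ((q i).2 : ℕ) then
        (1 / ((∑ i, (((q i).1 : ℕ) + ((q i).2 : ℕ)) : ℕ) *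
            ∏ i, ((((q i).1 : ℕ).factorial : ℝ) * (((q i).2 : ℕ).factorial : ℝ)))) •
          nestedBracket (bchWord X Y (fun i => ((q i).1 : ℕ)) (fun i => ((q i).2 : ℕ)))
      else 0

/-- `Ad (exp X) = exp (ad X)`, a finite sum since `(ad X) ^ k = 0` for `k ≥ dim 𝔤` if `𝔤` is
nilpotent. -/
def Ad (X : 𝔤) : 𝔤 →ₗ[ℝ] 𝔤 :=
  ∑ k ∈ Finset.range (Module.finrank ℝ 𝔤 + 1),
    ((k.factorial : ℝ)⁻¹) • ((LieAlgebra.ad ℝ 𝔤 X : Module.End ℝ 𝔤) ^ k)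

/-! ### Coadjoint orbits

An element of `i𝔤*` is written as `i l` with a real linear functional `l`, and identified with `l`;
the norm of `l` is the dual norm. -/

/-- The coadjoint orbit `{Ad* (exp X) l : X ∈ 𝔤}`, where `Ad* (g) l = l ∘ Ad (g⁻¹)`. -/
def coadjointOrbit (l : StrongDual ℝ 𝔤) : Set (StrongDual ℝ 𝔤) :=
  {l' | ∃ X : 𝔤, ∀ Y : 𝔤, l' Y = l (Ad (-X) Y)}

/-- The subspace `W` is isotropic for the form `(X, Y) ↦ l [X, Y]`. -/
def IsIsotropic (l : StrongDual ℝ 𝔤) (W : Submodule ℝ 𝔤) : Prop :=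
  ∀ X ∈ W, ∀ Y ∈ W, l ⁅X, Y⁆ = 0

/-- The subalgebra `𝔪` is polarizing for `l`: it is a maximal isotropic subspace. -/
def IsPolarizing (l : StrongDual ℝ 𝔤) (𝔪 : LieSubalgebra ℝ 𝔤) : Prop :=
  Maximal (IsIsotropic l) 𝔪.toSubmodule

/-! ### The homogeneous space `M \ G`, `M = exp 𝔪`, and the induced representation -/

/-- `X₁, …, Xₖ` is a weak Malcev basis of `𝔤` modulo the subalgebra `𝔪`: it is a basis modulo `𝔪` and
every `𝔪 + ℝ X₁ + ⋯ + ℝ Xⱼ` is a subalgebra. -/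
def IsMalcevBasisMod (𝔪 : LieSubalgebra ℝ 𝔤) {k : ℕ} (X : Fin k → 𝔤) : Prop :=
  Module.finrank ℝ 𝔪 + k = Module.finrank ℝ 𝔤 ∧
  𝔪.toSubmodule ⊔ Submodule.span ℝ (Set.range X) = ⊤ ∧
  ∀ j ≤ k, ∃ 𝔥 : LieSubalgebra ℝ 𝔤,
    𝔥.toSubmodule = 𝔪.toSubmodule ⊔ Submodule.span ℝ (X '' {i | (i : ℕ) < j})

/-- The group element `exp (t₁ X₁) ⋯ exp (tₖ Xₖ)`. For a weak Malcev basis `X` modulo `𝔪` the map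
`t ↦ M exp (t₁ X₁) ⋯ exp (tₖ Xₖ)` is a homeomorphism of `ℝᵏ` onto `M \ G` that carries the Lebesgue
measure to a right invariant measure of `M \ G` (which is unique up to a factor). Integrals over
`M \ G` are therefore written below as integrals over `t ∈ ℝᵏ`. -/
def cosetRep {k : ℕ} (X : Fin k → 𝔤) (t : Fin k → ℝ) : 𝔤 :=
  (List.ofFn fun j => t j • X j).foldl bch 0

/-- The space `ℋ_l` of the representation of `G` induced from the character
`χ_l (exp Y) = exp (2 π i l (Y))` of `M`: measurable functions `f` on `G` with
`f (m g) = χ_l (m) f (g)` and `∫_{M \ G} |f|² < ∞`. -/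
def inducedSpace [MeasurableSpace 𝔤] (l : StrongDual ℝ 𝔤) (𝔪 : LieSubalgebra ℝ 𝔤) {k : ℕ}
    (X : Fin k → 𝔤) : Set (𝔤 → ℂ) :=
  {f | Measurable f ∧
    (∀ m ∈ 𝔪, ∀ g : 𝔤, f (bch m g) = Complex.exp (2 * Real.pi * Complex.I * (l m : ℂ)) * f g) ∧
    Integrable (fun t : Fin k → ℝ => ‖f (cosetRep X t)‖ ^ 2)}

/-- The induced representation `(σ_l (x) f) (g) = f (g x)`. -/
def inducedRep (x : 𝔤) (f : 𝔤 → ℂ) : 𝔤 → ℂ := fun g => f (bch g x)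

/-- The inner product `⟨u, v⟩ = ∫_{M \ G} u v̄` of `ℋ_l`. -/
def innerInd {k : ℕ} (X : Fin k → 𝔤) (u v : 𝔤 → ℂ) : ℂ :=
  ∫ t : Fin k → ℝ, u (cosetRep X t) * starRingEnd ℂ (v (cosetRep X t))

/-- The norm of `ℋ_l`. -/
def normInd {k : ℕ} (X : Fin k → 𝔤) (u : 𝔤 → ℂ) : ℝ :=
  Real.sqrt (∫ t : Fin k → ℝ, ‖u (cosetRep X t)‖ ^ 2)

/-- The Hilbert sum of copies of `ℋ_l`, indexed by `ι`. -/
def inducedSpaceSum [MeasurableSpace 𝔤] (ι : Type) (l : StrongDual ℝ 𝔤) (𝔪 : LieSubalgebra ℝ 𝔤)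
    {k : ℕ} (X : Fin k → 𝔤) : Set (ι → 𝔤 → ℂ) :=
  {u | (∀ i, u i ∈ inducedSpace l 𝔪 X) ∧ Summable fun i => normInd X (u i) ^ 2}

/-- The inner product of the Hilbert sum. -/
def innerIndSum {ι : Type} {k : ℕ} (X : Fin k → 𝔤) (u v : ι → 𝔤 → ℂ) : ℂ :=
  ∑' i, innerInd X (u i) (v i)

/-- The norm of the Hilbert sum. -/
def normIndSum {ι : Type} {k : ℕ} (X : Fin k → 𝔤) (u : ι → 𝔤 → ℂ) : ℝ :=
  Real.sqrt (∑' i, normInd X (u i) ^ 2)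

/-! ### Sobolev norms, the Fourier integral and distances -/

/-- The partial derivative `D^α φ` of a function in the coordinates of a basis `b`. -/
def multiDeriv {n : ℕ} (b : Fin n → 𝔤) (α : Fin n → ℕ) (φ : 𝔤 → ℂ) : 𝔤 → ℂ :=
  (List.ofFn fun i => List.replicate (α i) (b i)).flatten.foldr
    (fun v f => fun x => fderiv ℝ f x v) φ

/-- The Sobolev norm `‖φ‖_{W^{K,1}} = ∑_{|α| ≤ K} ‖D^α φ‖_{L¹}`. -/
def sobolevNorm [FiniteDimensional ℝ 𝔤] [MeasurableSpace 𝔤] [BorelSpace 𝔤] {n : ℕ}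
    (b : Fin n → 𝔤) (K : ℕ) (φ : 𝔤 → ℂ) : ℝ :=
  ∑ j ∈ Finset.range (K + 1), ∑ α ∈ (Finset.univ : Finset (Fin n)).piAntidiag j,
    ∫ x, ‖multiDeriv b α φ x‖

/-- `∫_𝔤 m (X) φ (X) e^{-2 π i η (X)} dX`. -/
def fourierInt [FiniteDimensional ℝ 𝔤] [MeasurableSpace 𝔤] [BorelSpace 𝔤]
    (m φ : 𝔤 → ℂ) (η : StrongDual ℝ 𝔤) : ℂ :=
  ∫ X : 𝔤, m X * φ X * Complex.exp (-(2 * Real.pi * Complex.I * (η X : ℂ)))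

/-- The distance `inf {d (a, b) : a ∈ A, b ∈ B}` of two sets. -/
def setDist {E : Type*} [PseudoMetricSpace E] (A B : Set E) : ℝ :=
  sInf {r | ∃ a ∈ A, ∃ b ∈ B, r = dist a b}

/-- `⟨x⟩ = (1 + x²)^{1/2}`. -/
def japaneseBracket (x : ℝ) : ℝ := Real.sqrt (1 + x ^ 2)

end

end NilpotentOrbit

set_option linter.unusedSectionVars false

/-! Identify the group with the Lie algebra by exp, and for `u` in the induced space put T(φ)(g) = ∫
u(gx) φ(x) e^{-2πiη(x)} dx (`transFourier`). The Fourier integral of the matrix coefficient is the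
pairing of T(φ) with `v` over M\G. Let Y satisfy Ad(g)Y ∈ 𝔪. Replacing x by exp(sY)x does not change
the integral, because Lebesgue measure is Haar measure, whereas u(g exp(sY)x) = e^{2πi s l(Ad(g)Y)}
u(gx). Differentiation at s = 0 gives 2πi (l(Ad(g)Y) - η(Y)) T(φ) = -T(φ'), where φ' is the
derivative of φ along the vector field V generated by the left translations exp(sY), plus the error
term -2πi η(V - Y) φ (`transFourier_twistedDeriv`).

The factor on the left can be made large. By Pukanszky's condition every functional that agrees with
l∘Ad(g) on Ad(g⁻¹)𝔪 lies on the orbit of l (`orbitProperty`, `mem_coadjointOrbit`). The least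
correction that turns η into such a functional has the norm of (l∘Ad(g) - η) restricted to Ad(g⁻¹)𝔪.
So if the distance D of the ball from the orbit is positive, some unit vector Y makes the factor at
least H = D + ε‖η‖ (`exists_unit_vector`). Since V - Y vanishes at 0, on functions with small
support the error term costs only a small multiple of ‖η‖ ≤ H/ε and can be absorbed. Each round
therefore trades one derivative of φ for a factor 1/H, and N rounds give the decay
(`le_sobL1_of_twistedDeriv`).

The vector Y depends on g, so the iteration cannot be run on the coefficient itself. It is run on ∫
|T(φ)| |v| over M\G (`absPairing`), which dominates the Fourier integral, is sublinear in φ, and is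
controlled by Cauchy-Schwarz and the invariance of the measure on M\G (`lintegral_cosetRep_bch`).
Finally, one spare derivative is traded for a factor 3r on functions supported in the ball of radius
r (`sobL1_le_succ`). Shrinking r absorbs every constant that depends on 𝔤, N and ε, and the constant
1 suffices.

The group itself is given only by Dynkin's truncated series, so its laws have to be derived. The
series is the logarithm of a product of exponentials in an associative algebra (`rexp_dynkin`). The
adjoint representation loses the centre, so the laws are read off instead from smooth curves acting
on their Lie algebra extended by d/dt (`curveRep`, `curve_ext`). The same representation gives the
product rule for logarithmic derivatives (`dexp_bch`), and with it the invariance of Lebesgue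
measure. -/

namespace NilpotentOrbit

noncomputable section

/-! ### The exponential of a nilpotent element of a real algebra -/

section NilpotentExponential

open Polynomial

/-- The truncated exponential series. -/
def expPoly (d : ℕ) : ℝ[X] := ∑ k ∈ Finset.range (d + 1), C ((k.factorial : ℝ)⁻¹) * X ^ k

/-- The truncation of `(exp X - 1) / X`. -/
def dexpPoly (d : ℕ) : ℝ[X] := ∑ k ∈ Finset.range d, C (((k + 1).factorial : ℝ)⁻¹) * X ^ k

/-- The truncation of `log (1 + X) / X`. -/
def logPoly (d : ℕ) : ℝ[X] := ∑ k ∈ Finset.range d, C ((-1 : ℝ) ^ k / (k + 1)) * X ^ k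

lemma expPoly_sub_one (d : ℕ) : expPoly d - 1 = X * dexpPoly d := by
  rw [expPoly, Finset.sum_range_succ', dexpPoly, Finset.mul_sum]
  simp only [Nat.factorial_zero, Nat.cast_one, inv_one, map_one, pow_zero, mul_one,
    add_sub_cancel_right]
  refine Finset.sum_congr rfl fun k _ => ?_
  ring

lemma derivative_expPoly (d : ℕ) :
    derivative (expPoly d) = expPoly d - C ((d.factorial : ℝ)⁻¹) * X ^ d := by
  rw [expPoly, Finset.sum_range_succ, add_sub_cancel_right, ← Finset.sum_range_succ,
    Finset.sum_range_succ', derivative_add, derivative_sum]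
  simp only [pow_zero, mul_one, derivative_C, add_zero]
  refine Finset.sum_congr rfl fun k _ => ?_
  rw [derivative_C_mul_X_pow, Nat.factorial_succ, Nat.add_sub_cancel]
  congr 2
  push_cast
  have : (k.factorial : ℝ) ≠ 0 := by positivity
  field_simp

lemma derivative_X_mul_logPoly (d : ℕ) :
    (1 + X) * derivative (X * logPoly d) = 1 - (-X) ^ d := by
  have : derivative (X * logPoly d) = ∑ k ∈ Finset.range d, (-X : ℝ[X]) ^ k := by
    rw [logPoly, Finset.mul_sum, derivative_sum]
    refine Finset.sum_congr rfl fun k _ => ?_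
    rw [show X * (C ((-1 : ℝ) ^ k / (k + 1)) * X ^ k) = C ((-1 : ℝ) ^ k / (k + 1)) * X ^ (k + 1) by
      ring, derivative_C_mul_X_pow, Nat.add_sub_cancel, neg_pow (X : ℝ[X]) k]
    have : ((k : ℝ) + 1) ≠ 0 := by positivity
    push_cast
    rw [div_mul_cancel₀ _ this]
    rw [map_pow, map_neg, map_one]
  rw [this]
  have := mul_neg_geom_sum (-X : ℝ[X]) d
  rwa [sub_neg_eq_add] at this

/-- `(exp X - 1) / X · (log W / (W - 1)) = 1` for `W = exp X`, up to order `d`. -/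
lemma X_pow_dvd_dexpPoly_mul (d : ℕ) :
    X ^ d ∣ dexpPoly d * (logPoly d).comp (expPoly d - 1) - 1 := by
  set h := dexpPoly d * (logPoly d).comp (expPoly d - 1) - 1 with hh
  have hp : X * h = (X * logPoly d).comp (expPoly d - 1) - X := by
    rw [mul_comp, X_comp, hh]
    nth_rewrite 2 [expPoly_sub_one]
    ring
  -- `X * h` is the truncation of log(exp X) - X. Both truncation errors in its derivative are
  -- divisible by `X ^ d`, and in characteristic zero the coefficients of `h` can be recovered from
  -- that derivative.
  have hder : X ^ d ∣ derivative (X * h) := by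
    rw [hp, derivative_sub, derivative_comp, derivative_X, derivative_sub, derivative_one, sub_zero,
      derivative_expPoly]
    have h1 : expPoly d * (derivative (X * logPoly d)).comp (expPoly d - 1) =
        1 - (-(expPoly d - 1)) ^ d := by
      have := congrArg (fun p => p.comp (expPoly d - 1)) (derivative_X_mul_logPoly d)
      simpa using this
    rw [sub_mul, h1, expPoly_sub_one]
    refine ⟨-(-dexpPoly d) ^ d - C ((d.factorial : ℝ)⁻¹) * (derivative (X * logPoly d)).comp
      (X * dexpPoly d), ?_⟩
    rw [show -(X * dexpPoly d) = X * (-dexpPoly d) by ring, mul_pow]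
    ring
  rw [X_pow_dvd_iff] at hder ⊢
  intro k hk
  have := hder k hk
  rw [coeff_derivative, coeff_X_mul] at this
  have h2 : (k : ℝ) + 1 ≠ 0 := by positivity
  exact (mul_eq_zero.1 this).resolve_right h2

variable {A : Type*} [Ring A] [Algebra ℝ A]

/-- The exponential of a nilpotent element. -/
def rexp (z : A) : A := ∑ k ∈ Finset.range (nilpotencyClass z), (k.factorial : ℝ)⁻¹ • z ^ k

lemma rexp_eq_sum {z : A} {N : ℕ} (h : z ^ N = 0) :
    rexp z = ∑ k ∈ Finset.range N, (k.factorial : ℝ)⁻¹ • z ^ k := by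
  refine Finset.sum_subset (Finset.range_mono (csInf_le' h)) fun k _ hk => ?_
  rw [pow_eq_zero_of_le (not_lt.1 (Finset.mem_range.not.1 hk)) (pow_nilpotencyClass ⟨N, h⟩),
    smul_zero]

lemma rexp_add {x y : A} (h : Commute x y) (hx : IsNilpotent x) (hy : IsNilpotent y) :
    rexp (x + y) = rexp x * rexp y := by
  -- Restricting scalars to ℚ identifies `rexp` with `IsNilpotent.exp`, which supplies the
  -- functional equation.
  let _ : Module ℚ A := Module.compHom A (algebraMap ℚ ℝ)
  have key : ∀ z : A, rexp z = IsNilpotent.exp z := fun z => by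
    refine Finset.sum_congr rfl fun k _ => ?_
    change _ = (algebraMap ℚ ℝ ((k.factorial : ℚ)⁻¹)) • z ^ k
    simp
  simp only [key]
  exact IsNilpotent.exp_add_of_commute h hx hy

@[simp] lemma rexp_zero : rexp (0 : A) = 1 := by
  rw [rexp_eq_sum (N := 1) (by simp)]; simp

lemma rexp_mul_rexp_neg {x : A} (hx : IsNilpotent x) : rexp x * rexp (-x) = 1 := by
  rw [← rexp_add (Commute.neg_right rfl) hx hx.neg, add_neg_cancel, rexp_zero]

lemma rexp_neg_mul_rexp {x : A} (hx : IsNilpotent x) : rexp (-x) * rexp x = 1 := by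
  rw [← rexp_add (Commute.neg_left rfl) hx.neg hx, neg_add_cancel, rexp_zero]

lemma map_rexp {B : Type*} [Ring B] [Algebra ℝ B] (f : A →ₐ[ℝ] B) {x : A} (hx : IsNilpotent x) :
    f (rexp x) = rexp (f x) := by
  obtain ⟨N, hN⟩ := hx
  rw [rexp_eq_sum hN, rexp_eq_sum (N := N) (by rw [← map_pow, hN, map_zero])]
  simp

lemma rexp_eq_one_add {z : A} {d : ℕ} (h : z ^ (d + 1) = 0) : rexp z = aeval z (expPoly d) := by
  rw [rexp_eq_sum h, expPoly]
  simp [Algebra.smul_def]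

/-- A nilpotent element is the logarithm of its exponential. -/
lemma rexp_injective {x y : A} (hx : IsNilpotent x) (hy : IsNilpotent y) (h : rexp x = rexp y) :
    x = y := by
  obtain ⟨M, hM⟩ := hx
  obtain ⟨N, hN⟩ := hy
  set d := M + N
  have key : ∀ z : A, z ^ d = 0 → z = aeval (rexp z - 1) (X * logPoly d) := by
    intro z hz
    have hz' : z ^ (d + 1) = 0 := by rw [pow_succ, hz, zero_mul]
    obtain ⟨q, hq⟩ := X_pow_dvd_dexpPoly_mul d
    have h1 : (X * logPoly d).comp (expPoly d - 1) = X + X ^ (d + 1) * q := by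
      rw [mul_comp, X_comp]
      nth_rewrite 1 [expPoly_sub_one]
      linear_combination X * hq
    have h2 := congrArg (aeval z) h1
    rw [aeval_comp, map_sub, ← rexp_eq_one_add hz', map_add, map_mul (aeval z), map_pow, aeval_X, hz',
      zero_mul, add_zero, map_one] at h2
    exact h2.symm
  rw [key x (pow_eq_zero_of_le (by omega) hM), key y (pow_eq_zero_of_le (by omega) hN), h]

/-- The commutator with `z`. -/
def comm (z : A) : Module.End ℝ A := LinearMap.mulLeft ℝ z - LinearMap.mulRight ℝ z

lemma comm_apply (z v : A) : comm z v = z * v - v * z := rfl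

/-- Conjugation by an exponential is the exponential of the commutator. -/
lemma rexp_comm {z : A} (hz : IsNilpotent z) (v : A) :
    IsNilpotent (comm z) ∧ rexp (comm z) v = rexp z * v * rexp (-z) := by
  -- Left and right multiplications commute, so the exponential of the commutator factors into left
  -- multiplication by exp z and right multiplication by exp(-z).
  have h1 : comm z = LinearMap.mulLeft ℝ z + -LinearMap.mulRight ℝ z := sub_eq_add_neg _ _
  have hl : IsNilpotent (LinearMap.mulLeft ℝ z) := (LinearMap.isNilpotent_mulLeft_iff ℝ z).2 hz
  have hr : IsNilpotent (-LinearMap.mulRight ℝ z) :=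
    ((LinearMap.isNilpotent_mulRight_iff ℝ z).2 hz).neg
  have hc : Commute (LinearMap.mulLeft ℝ z) (-LinearMap.mulRight ℝ z) :=
    Commute.neg_right (R := Module.End ℝ A) (LinearMap.commute_mulLeft_right z z)
  refine ⟨h1 ▸ hc.isNilpotent_add hl hr, ?_⟩
  rw [h1, rexp_add hc hl hr, Module.End.mul_apply]
  obtain ⟨M, hM⟩ := hz
  have hM' : (-z) ^ M = 0 := by rw [neg_pow, hM, mul_zero]
  have e1 : (LinearMap.mulLeft ℝ z) ^ M = 0 := by
    rw [LinearMap.pow_mulLeft, hM]; ext; simp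
  have e2 : -LinearMap.mulRight ℝ z = LinearMap.mulRight ℝ (-z) := by
    ext; simp
  have e3 : (LinearMap.mulRight ℝ (-z)) ^ M = 0 := by
    rw [LinearMap.pow_mulRight, hM']; ext; simp
  rw [rexp_eq_sum hM, rexp_eq_sum hM', e2, rexp_eq_sum e1, rexp_eq_sum e3]
  simp only [LinearMap.pow_mulLeft, LinearMap.pow_mulRight, LinearMap.sum_apply,
    LinearMap.smul_apply, LinearMap.mulLeft_apply, LinearMap.mulRight_apply, Finset.sum_mul,
    Finset.mul_sum, mul_assoc, smul_mul_assoc, mul_smul_comm, Finset.smul_sum]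
  rw [Finset.sum_comm]
  exact Finset.sum_congr rfl fun _ _ => Finset.sum_congr rfl fun _ _ => smul_comm _ _ _

lemma rexp_conj {z v : A} (hz : IsNilpotent z) (hv : IsNilpotent v) :
    rexp z * rexp v * rexp (-z) = rexp (rexp z * v * rexp (-z)) := by
  have h : ∀ k : ℕ, (rexp z * v * rexp (-z)) ^ k = rexp z * v ^ k * rexp (-z) := by
    intro k
    induction k with
    | zero => simp [rexp_mul_rexp_neg hz]
    | succ k ih =>
      rw [pow_succ, ih, pow_succ]
      calc _ = rexp z * v ^ k * (rexp (-z) * rexp z) * v * rexp (-z) := by noncomm_ring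
        _ = _ := by rw [rexp_neg_mul_rexp hz]; noncomm_ring
  obtain ⟨N, hN⟩ := hv
  rw [rexp_eq_sum hN, rexp_eq_sum (z := rexp z * v * rexp (-z)) (N := N) (by rw [h, hN]; simp)]
  simp only [h]
  simp only [Finset.sum_mul, Finset.mul_sum, smul_mul_assoc, mul_smul_comm]

end NilpotentExponential

/-! ### Dynkin's series -/

section Dynkin

variable {L : Type*} [LieRing L]

/-- The right-nested bracket of a word in a Lie ring. -/
def nest : List L → L
  | [] => 0
  | [a] => a
  | a :: b :: w => ⁅a, nest (b :: w)⁆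

lemma nest_cons (a : L) {w : List L} (hw : w ≠ []) : nest (a :: w) = ⁅a, nest w⁆ := by
  cases w with
  | nil => exact absurd rfl hw
  | cons b w => rfl

/-- The word `x^{r₁} y^{s₁} ⋯ x^{rₘ} y^{sₘ}`. -/
def dynkinWord {α : Type*} (x y : α) {m : ℕ} (r s : Fin m → ℕ) : List α :=
  (List.ofFn fun i => List.replicate (r i) x ++ List.replicate (s i) y).flatten

lemma map_dynkinWord {α β : Type*} (φ : α → β) (x y : α) {m : ℕ} (r s : Fin m → ℕ) :
    (dynkinWord x y r s).map φ = dynkinWord (φ x) (φ y) r s := by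
  simp [dynkinWord, List.map_flatten, List.map_ofFn, Function.comp_def]

lemma mem_dynkinWord {α : Type*} {x y : α} {m : ℕ} {r s : Fin m → ℕ} {z : α}
    (h : z ∈ dynkinWord x y r s) : z = x ∨ z = y := by
  simp only [dynkinWord, List.mem_flatten, List.mem_ofFn] at h
  obtain ⟨w, ⟨i, rfl⟩, hz⟩ := h
  rcases List.mem_append.1 hz with h | h
  · exact Or.inl (List.eq_of_mem_replicate h)
  · exact Or.inr (List.eq_of_mem_replicate h)

lemma length_dynkinWord {α : Type*} (x y : α) {m : ℕ} (r s : Fin m → ℕ) :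
    (dynkinWord x y r s).length = ∑ i, (r i + s i) := by
  simp [dynkinWord, List.length_flatten, List.map_ofFn, Function.comp_def, List.sum_ofFn]

variable [LieAlgebra ℝ L]

/-- Dynkin's series for `log (exp x exp y)`, truncated at the order `d` in every parameter. -/
def dynkin (d : ℕ) (x y : L) : L :=
  ∑ m ∈ Finset.Icc 1 d, ((-1 : ℝ) ^ (m - 1) / m) •
    ∑ q : Fin m → Fin (d + 1) × Fin (d + 1),
      if ∀ i, 0 < ((q i).1 : ℕ) + ((q i).2 : ℕ) then
        (1 / ((∑ i, (((q i).1 : ℕ) + ((q i).2 : ℕ)) : ℕ) *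
            ∏ i, ((((q i).1 : ℕ).factorial : ℝ) * (((q i).2 : ℕ).factorial : ℝ)))) •
          nest (dynkinWord x y (fun i => ((q i).1 : ℕ)) (fun i => ((q i).2 : ℕ)))
      else 0

variable {L' : Type*} [LieRing L'] [LieAlgebra ℝ L']

lemma map_nest (φ : L →ₗ⁅ℝ⁆ L') (w : List L) : φ (nest w) = nest (w.map φ) := by
  induction w with
  | nil => simp [nest]
  | cons a w ih =>
    by_cases hw : w = []
    · subst hw; rfl
    · rw [nest_cons a hw, LieHom.map_lie, ih, List.map_cons, nest_cons _ (by simpa using hw)]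

/-- Naturality is what carries an identity for the series in an associative algebra over to a Lie
algebra through its representations. -/
lemma map_dynkin (φ : L →ₗ⁅ℝ⁆ L') (d : ℕ) (x y : L) :
    φ (dynkin d x y) = dynkin d (φ x) (φ y) := by
  simp only [dynkin, map_sum, map_smul, apply_ite φ, map_zero, map_nest, map_dynkinWord]

end Dynkin

/-! ### Conjugation and the derivative of the exponential on a nilpotent submodule. -/

section NilpotentSubmodule

open Polynomial

attribute [local instance] LieRing.ofAssociativeRing

variable {A : Type*} [Ring A] [Algebra ℝ A] {S : Submodule ℝ A} {d : ℕ}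

lemma rexp_apply_eq_sum {V : Type*} [AddCommGroup V] [Module ℝ V] {T : Module.End ℝ V}
    (hT : IsNilpotent T) {v : V} {M : ℕ} (h : (T ^ M) v = 0) :
    rexp T v = ∑ k ∈ Finset.range M, (k.factorial : ℝ)⁻¹ • (T ^ k) v := by
  obtain ⟨N, hN⟩ := hT
  have h0 : T ^ (M + N) = 0 := pow_eq_zero_of_le (by omega) hN
  rw [rexp_eq_sum h0, LinearMap.sum_apply]
  refine (Finset.sum_subset (Finset.range_mono (by omega)) fun k _ hk => ?_).symm
  obtain ⟨j, rfl⟩ := Nat.exists_eq_add_of_le (not_lt.1 (Finset.mem_range.not.1 hk))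
  rw [LinearMap.smul_apply, add_comm, pow_add, Module.End.mul_apply, h, map_zero, smul_zero]

lemma pow_eq_bot_of_le (hnil : S ^ (d + 1) = ⊥) {k : ℕ} (hk : d + 1 ≤ k) : S ^ k = ⊥ := by
  obtain ⟨j, rfl⟩ := Nat.exists_eq_add_of_le hk
  rw [pow_add, hnil, Submodule.bot_mul]

lemma isNilpotent_of_mem (hnil : S ^ (d + 1) = ⊥) {z : A} (hz : z ∈ S) : IsNilpotent z :=
  ⟨d + 1, by simpa [hnil] using Submodule.pow_mem_pow S hz (d + 1)⟩

lemma pow_succ_le_self (hS : S * S ≤ S) (k : ℕ) : S ^ (k + 1) ≤ S := by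
  induction k with
  | zero => simp
  | succ k ih => rw [pow_succ]; exact (mul_le_mul' ih le_rfl).trans hS

lemma comm_mem_pow {z v : A} {k : ℕ} (hz : z ∈ S) (hv : v ∈ S ^ k) : comm z v ∈ S ^ (k + 1) := by
  rw [comm_apply]
  refine Submodule.sub_mem _ ?_ ?_
  · rw [pow_succ']; exact Submodule.mul_mem_mul hz hv
  · rw [pow_succ]; exact Submodule.mul_mem_mul hv hz

lemma comm_pow_mem_pow {z v : A} {k : ℕ} (hz : z ∈ S) (hv : v ∈ S ^ k) (j : ℕ) :
    (comm z ^ j) v ∈ S ^ (k + j) := by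
  induction j with
  | zero => simpa using hv
  | succ j ih =>
    rw [pow_succ', Module.End.mul_apply, ← add_assoc]
    exact comm_mem_pow hz ih

lemma comm_pow_eq_zero (hnil : S ^ (d + 1) = ⊥) {z v : A} (hz : z ∈ S) (hv : v ∈ S) {j : ℕ}
    (hj : d ≤ j) : (comm z ^ j) v = 0 := by
  have := comm_pow_mem_pow hz (k := 1) (by simpa using hv) j
  rwa [pow_eq_bot_of_le hnil (by omega), Submodule.mem_bot] at this

lemma nest_mem_pow {w : List A} (hw : ∀ z ∈ w, z ∈ S) : nest w ∈ S ^ w.length := by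
  induction w with
  | nil => exact Submodule.zero_mem _
  | cons a w ih =>
    by_cases h : w = []
    · subst h; simpa [nest] using hw a (by simp)
    · rw [nest_cons a h, List.length_cons]
      exact comm_mem_pow (hw a (by simp)) (ih fun z hz => hw z (by simp [hz]))

/-- Conjugation by `rexp z`. -/
def conj (z : A) : Module.End ℝ A :=
  LinearMap.mulLeft ℝ (rexp z) * LinearMap.mulRight ℝ (rexp (-z))

lemma conj_apply (z v : A) : conj z v = rexp z * v * rexp (-z) := by
  simp [conj, mul_assoc]

lemma sum_comm_pow (hnil : S ^ (d + 1) = ⊥) {z v : A} (hz : z ∈ S) (hv : v ∈ S) :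
    ∑ k ∈ Finset.range (d + 1), (k.factorial : ℝ)⁻¹ • (comm z ^ k) v = conj z v := by
  have h := rexp_comm (isNilpotent_of_mem hnil hz) v
  rw [conj_apply, ← h.2, rexp_apply_eq_sum h.1 (comm_pow_eq_zero hnil hz hv (Nat.le_succ d))]

lemma conj_mem (hS : S * S ≤ S) (hnil : S ^ (d + 1) = ⊥) {z v : A} (hz : z ∈ S) (hv : v ∈ S) :
    conj z v ∈ S := by
  rw [← sum_comm_pow hnil hz hv]
  refine Submodule.sum_mem _ fun k _ => Submodule.smul_mem _ _ ?_
  have := comm_pow_mem_pow hz (k := 1) (by simpa using hv) k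
  rw [add_comm] at this
  exact pow_succ_le_self hS k this

/-- On `S` conjugation by exp z is exp(ad z), so the logarithmic series is log(W)/(W - 1) at W =
exp(ad z), the inverse of (exp - 1)/X at ad z. The truncation error is a multiple of (ad z)^d, which
sends `v` into S^(d+1) = 0. -/
lemma dexp_log (hS : S * S ≤ S) (hnil : S ^ (d + 1) = ⊥) {z v : A} (hz : z ∈ S) (hv : v ∈ S) :
    aeval (comm z) (dexpPoly d) (∑ m ∈ Finset.range d,
      ((-1 : ℝ) ^ m / (m + 1)) • ((conj z - 1) ^ m) v) = v := by
  set G : Module.End ℝ A := aeval (comm z) (expPoly d - 1) with hG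
  have hGv : ∀ w ∈ S, G w = (conj z - 1) w := by
    intro w hw
    rw [hG, map_sub, map_one, LinearMap.sub_apply, LinearMap.sub_apply, ← sum_comm_pow hnil hz hw,
      expPoly, map_sum, LinearMap.sum_apply]
    congr 1
    refine Finset.sum_congr rfl fun k _ => ?_
    simp [Module.algebraMap_end_apply]
  have hpow : ∀ m : ℕ, ((conj z - 1) ^ m) v = (G ^ m) v ∧ ((conj z - 1) ^ m) v ∈ S := by
    intro m
    induction m with
    | zero => exact ⟨rfl, hv⟩
    | succ m ih =>
      rw [pow_succ', pow_succ', Module.End.mul_apply, Module.End.mul_apply, ← ih.1, hGv _ ih.2]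
      exact ⟨rfl, Submodule.sub_mem _ (conj_mem hS hnil hz ih.2) ih.2⟩
  have h1 : ∑ m ∈ Finset.range d, ((-1 : ℝ) ^ m / (m + 1)) • ((conj z - 1) ^ m) v =
      aeval G (logPoly d) v := by
    rw [logPoly, map_sum, LinearMap.sum_apply]
    refine Finset.sum_congr rfl fun m _ => ?_
    rw [(hpow m).1, map_mul, aeval_C, map_pow, aeval_X, Module.End.mul_apply,
      Module.algebraMap_end_apply]
  obtain ⟨q, hq⟩ := X_pow_dvd_dexpPoly_mul d
  have h2 : dexpPoly d * (logPoly d).comp (expPoly d - 1) = 1 + q * X ^ d := by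
    linear_combination hq
  have h3 := congrArg (fun T : Module.End ℝ A => T v) (congrArg (aeval (comm z)) h2)
  simp only [map_mul, aeval_comp, map_add, map_one, map_pow, aeval_X, Module.End.mul_apply,
    LinearMap.add_apply, Module.End.one_apply, comm_pow_eq_zero hnil hz hv le_rfl, map_zero,
    add_zero] at h3
  rw [h1, hG, h3]

/-- The derivative of the exponential. -/
lemma derivation_rexp (hnil : S ^ (d + 1) = ⊥) (D : A →ₗ[ℝ] A)
    (hD : ∀ x y, D (x * y) = D x * y + x * D y) {f : A} (hf : f ∈ S) (hDf : D f ∈ S) :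
    D (rexp f) = aeval (comm f) (dexpPoly d) (D f) * rexp f := by
  have hn := isNilpotent_of_mem hnil hf
  have hnl : IsNilpotent (LinearMap.mulLeft ℝ f) := (LinearMap.isNilpotent_mulLeft_iff ℝ f).2 hn
  have hmap : ∀ g : A, IsNilpotent g → rexp (LinearMap.mulLeft ℝ g) =
      LinearMap.mulLeft ℝ (rexp g) := fun g hg =>
    (map_rexp (Algebra.lmul ℝ A) hg).symm
  -- The conjugation formula is applied to the operator `D` in End A, with left multiplication by
  -- `f` as the nilpotent element. Evaluated at exp f, the conjugated side is exp(f) D(exp(-f)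
  -- exp(f)) = exp(f) D(1) = 0. The other side is D(exp f) minus the asserted value.
  have h := rexp_comm (A := Module.End ℝ A) hnl D
  have hneg : -LinearMap.mulLeft ℝ f = LinearMap.mulLeft ℝ (-f) := by ext; simp
  rw [hneg, hmap f hn, hmap (-f) hn.neg] at h
  have hD1 : D 1 = 0 := by simpa using hD 1 1
  obtain ⟨⟨N, hN⟩, h⟩ := h
  have hcomm : ∀ k : ℕ, (comm (LinearMap.mulLeft ℝ f) ^ (k + 1)) D =
      -LinearMap.mulLeft ℝ ((comm f ^ k) (D f)) := by
    intro k
    induction k with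
    | zero =>
      ext x
      simp [comm_apply, hD]
    | succ k ih =>
      rw [pow_succ', Module.End.mul_apply, ih, pow_succ' (comm f), Module.End.mul_apply]
      ext x
      simp only [comm_apply, sub_mul, mul_assoc, Module.End.mul_apply, LinearMap.sub_apply,
        LinearMap.neg_apply, LinearMap.mulLeft_apply, mul_neg, neg_mul]
      abel
  have hN' : comm (LinearMap.mulLeft ℝ f) ^ (N + d + 1) = 0 := pow_eq_zero_of_le (by omega) hN
  have h' := congrArg (fun T : Module.End ℝ A => T (rexp f)) h
  rw [rexp_eq_sum hN'] at h'
  simp only [LinearMap.sum_apply, LinearMap.smul_apply, Module.End.mul_apply,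
    LinearMap.mulLeft_apply, rexp_neg_mul_rexp hn, hD1, mul_zero] at h'
  rw [Finset.sum_range_succ'] at h'
  simp only [hcomm, pow_zero, Module.End.one_apply, Nat.factorial_zero, Nat.cast_one, inv_one,
    one_smul, LinearMap.neg_apply, LinearMap.mulLeft_apply, smul_neg, Finset.sum_neg_distrib] at h'
  rw [neg_add_eq_zero] at h'
  rw [← h', dexpPoly, map_sum, LinearMap.sum_apply, Finset.sum_mul]
  refine (Finset.sum_subset (Finset.range_mono (by omega)) fun k _ hk => ?_).symm.trans
    (Finset.sum_congr rfl fun k _ => ?_)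
  · rw [comm_pow_eq_zero hnil hf hDf (not_lt.1 (Finset.mem_range.not.1 hk)), zero_mul, smul_zero]
  · simp [Module.algebraMap_end_apply]

end NilpotentSubmodule

/-! ### The Euler derivative of Dynkin's series. -/

section BakerCampbellHausdorff

open Polynomial

attribute [local instance] LieRing.ofAssociativeRing

variable {A : Type*} [Ring A] [Algebra ℝ A] {S : Submodule ℝ A} {d : ℕ}

/-- The sum of the brackets of the words with `m` blocks, without the weight `1 / length`. -/
def blockSum (d : ℕ) (a b : A) (m : ℕ) : A :=
  ∑ q : Fin m → Fin (d + 1) × Fin (d + 1),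
    if ∀ i, 0 < ((q i).1 : ℕ) + ((q i).2 : ℕ) then
      (1 / ∏ i, ((((q i).1 : ℕ).factorial : ℝ) * (((q i).2 : ℕ).factorial : ℝ))) •
        nest (dynkinWord a b (fun i => ((q i).1 : ℕ)) (fun i => ((q i).2 : ℕ)))
    else 0

lemma nest_replicate_append (a : A) (r : ℕ) {w : List A} (hw : w ≠ []) :
    nest (List.replicate r a ++ w) = (comm a ^ r) (nest w) := by
  induction r with
  | zero => simp
  | succ r ih =>
    rw [List.replicate_succ, List.cons_append, nest_cons _ (by simp [hw]), ih, pow_succ',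
      Module.End.mul_apply]
    rfl

lemma nest_replicate_of_ne_one (a : A) {r : ℕ} (hr : r ≠ 1) : nest (List.replicate r a) = 0 := by
  rcases r with _ | _ | r
  · rfl
  · exact absurd rfl hr
  · rw [show r + 1 + 1 = (r + 1) + 1 from rfl, List.replicate_succ', nest_replicate_append _ _ (by simp),
      pow_succ, Module.End.mul_apply, comm_apply]
    simp [nest]

/-- A derivation that fixes both letters multiplies each nested bracket by the length of its word.
This cancels the factor 1/length in Dynkin's coefficients. -/
lemma derivation_dynkin (D : A →ₗ[ℝ] A) (hD : ∀ x y, D (x * y) = D x * y + x * D y) {a b : A}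
    (ha : D a = a) (hb : D b = b) :
    D (dynkin d a b) =
      ∑ m ∈ Finset.Icc 1 d, ((-1 : ℝ) ^ (m - 1) / m) • blockSum d a b m := by
  have hnest : ∀ w : List A, (∀ z ∈ w, D z = z) → D (nest w) = (w.length : ℝ) • nest w := by
    intro w hw
    induction w with
    | nil => simp [nest]
    | cons c w ih =>
      by_cases h : w = []
      · subst h; simpa [nest] using hw c (by simp)
      · have e : nest (c :: w) = c * nest w - nest w * c := nest_cons c h
        rw [e, map_sub, hD, hD, ih fun z hz => hw z (by simp [hz]), hw c (by simp),
          List.length_cons]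
        push_cast
        simp only [mul_smul_comm, smul_mul_assoc, add_smul, one_smul, smul_sub]
        abel
  simp only [dynkin, blockSum, map_sum, map_smul]
  refine Finset.sum_congr rfl fun m hm => ?_
  congr 1
  refine Finset.sum_congr rfl fun q _ => ?_
  split_ifs with hq
  · rw [map_smul, hnest _ fun z hz => ?_, smul_smul, length_dynkinWord]
    · have h0 : ((∑ i, (((q i).1 : ℕ) + ((q i).2 : ℕ)) : ℕ) : ℝ) ≠ 0 := by
        rw [Nat.cast_ne_zero]
        have : 0 < ∑ i, (((q i).1 : ℕ) + ((q i).2 : ℕ)) := by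
          have hm1 := (Finset.mem_Icc.1 hm).1
          exact Finset.sum_pos (fun i _ => hq i) ⟨⟨0, by omega⟩, Finset.mem_univ _⟩
        omega
      congr 1
      rw [one_div, mul_inv, mul_comm, ← mul_assoc, mul_inv_cancel₀ h0, one_mul, one_div]
    · rcases mem_dynkinWord hz with rfl | rfl <;> assumption
  · exact map_zero _

/-- A right-nested bracket ending in two equal letters vanishes. Hence only the word `a` and the
words a^r b survive, and the latter add up to exp(ad a) b. -/
lemma blockSum_one (hd : 1 ≤ d) (hnil : S ^ (d + 1) = ⊥) {a b : A} (ha : a ∈ S) (hb : b ∈ S) :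
    blockSum d a b 1 = a + conj a b := by
  have h1 : blockSum d a b 1 = ∑ s ∈ Finset.range (d + 1), ∑ r ∈ Finset.range (d + 1),
      if 0 < r + s then ((1 : ℝ) / (r.factorial * s.factorial)) •
        nest (List.replicate r a ++ List.replicate s b) else 0 := by
    rw [Finset.sum_comm, Finset.sum_range, blockSum]
    simp only [Finset.sum_range]
    rw [← (Equiv.funUnique (Fin 1) (Fin (d + 1) × Fin (d + 1))).symm.sum_comp,
      Fintype.sum_prod_type]
    simp [dynkinWord]
  rw [h1, Finset.sum_range_succ', ← sum_comm_pow hnil ha hb, add_comm]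
  congr 1
  · rw [Finset.sum_eq_single 1]
    · simp [nest]
    · intro r _ hr
      simp [nest_replicate_of_ne_one a hr]
    · intro h; simp at h; omega
  · rw [Finset.sum_eq_single 0]
    · refine Finset.sum_congr rfl fun r _ => ?_
      simp [nest_replicate_append, nest]
    · intro s _ hs
      refine Finset.sum_eq_zero fun r _ => ?_
      rw [nest_replicate_append _ _ (by simp), nest_replicate_of_ne_one b (by omega)]
      simp
    · intro h; simp at h; omega

lemma blockSum_mem (hS : S * S ≤ S) {a b : A} (ha : a ∈ S) (hb : b ∈ S) (m : ℕ) :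
    blockSum d a b m ∈ S := by
  refine Submodule.sum_mem _ fun q _ => ?_
  split_ifs
  · refine Submodule.smul_mem _ _ ?_
    have h := nest_mem_pow (S := S) (w := dynkinWord a b (fun i => ((q i).1 : ℕ))
      (fun i => ((q i).2 : ℕ))) fun z hz => by rcases mem_dynkinWord hz with rfl | rfl <;> assumption
    generalize dynkinWord a b (fun i => ((q i).1 : ℕ)) (fun i => ((q i).2 : ℕ)) = w at h ⊢
    cases w with
    | nil => exact Submodule.zero_mem _
    | cons c w => exact pow_succ_le_self hS _ h
  · exact Submodule.zero_mem _

/-- A block put in front applies (ad a)^r (ad b)^s / (r! s!). Summed over all r and s these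
operators give Ad(exp a) Ad(exp b), and the excluded block r = s = 0 accounts for the -1. -/
lemma blockSum_succ (hS : S * S ≤ S) (hnil : S ^ (d + 1) = ⊥) {a b : A} (ha : a ∈ S) (hb : b ∈ S)
    {m : ℕ} (hm : 1 ≤ m) :
    blockSum d a b (m + 1) = (conj a * conj b - 1) (blockSum d a b m) := by
  set T := blockSum d a b m with hT
  have hTS : T ∈ S := blockSum_mem hS ha hb m
  have key : ∀ r s : ℕ, (∑ q : Fin m → Fin (d + 1) × Fin (d + 1),
      if (0 < r + s ∧ ∀ i, 0 < ((q i).1 : ℕ) + ((q i).2 : ℕ)) then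
      (1 / (((r.factorial : ℝ) * s.factorial) *
        ∏ i, ((((q i).1 : ℕ).factorial : ℝ) * (((q i).2 : ℕ).factorial : ℝ)))) •
        nest (List.replicate r a ++ (List.replicate s b ++
          dynkinWord a b (fun i => ((q i).1 : ℕ)) (fun i => ((q i).2 : ℕ))))
      else 0) = if 0 < r + s then (r.factorial : ℝ)⁻¹ • (comm a ^ r)
        ((s.factorial : ℝ)⁻¹ • (comm b ^ s) T) else 0 := by
    intro r s
    by_cases h : 0 < r + s
    · simp only [h, true_and, if_true, hT, blockSum, map_sum, Finset.smul_sum]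
      refine Finset.sum_congr rfl fun q _ => ?_
      split_ifs with hq
      · have hw : dynkinWord a b (fun i => ((q i).1 : ℕ)) (fun i => ((q i).2 : ℕ)) ≠ [] := by
          rw [← List.length_pos_iff, length_dynkinWord]
          exact Finset.sum_pos (fun i _ => hq i) ⟨⟨0, by omega⟩, Finset.mem_univ _⟩
        rw [nest_replicate_append _ _ (by simp [hw]), nest_replicate_append _ _ hw]
        simp only [map_smul, smul_smul]
        congr 1
        rw [one_div, one_div, mul_inv, mul_inv, mul_assoc]
      · simp
    · simp [h]
  have h1 : blockSum d a b (m + 1) = ∑ r ∈ Finset.range (d + 1), ∑ s ∈ Finset.range (d + 1),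
      if 0 < r + s then (r.factorial : ℝ)⁻¹ • (comm a ^ r)
        ((s.factorial : ℝ)⁻¹ • (comm b ^ s) T) else 0 := by
    simp only [← key, Finset.sum_range]
    rw [blockSum, ← (Fin.consEquiv fun _ => Fin (d + 1) × Fin (d + 1)).sum_comp,
      Fintype.sum_prod_type, Fintype.sum_prod_type]
    refine Finset.sum_congr rfl fun r _ => Finset.sum_congr rfl fun s _ =>
      Finset.sum_congr rfl fun q _ => ?_
    simp [Fin.consEquiv, Fin.forall_fin_succ, Fin.prod_univ_succ, dynkinWord, List.ofFn_succ]
  rw [h1, LinearMap.sub_apply, Module.End.mul_apply, Module.End.one_apply,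
    ← sum_comm_pow hnil hb hTS, ← sum_comm_pow hnil ha (by
      rw [sum_comm_pow hnil hb hTS]; exact conj_mem hS hnil hb hTS), eq_sub_iff_add_eq]
  simp only [map_sum, Finset.smul_sum]
  have h2 : T = ∑ r ∈ Finset.range (d + 1), ∑ s ∈ Finset.range (d + 1),
      if 0 < r + s then 0 else (r.factorial : ℝ)⁻¹ • (comm a ^ r)
        ((s.factorial : ℝ)⁻¹ • (comm b ^ s) T) := by
    rw [Finset.sum_eq_single 0 _ (by simp), Finset.sum_eq_single 0 _ (by simp)]
    · simp
    · intro s _ hs; rw [if_pos (by omega)]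
    · intro r _ hr; exact Finset.sum_eq_zero fun s _ => by rw [if_pos (by omega)]
  nth_rewrite 2 [h2]
  rw [← Finset.sum_add_distrib]
  refine Finset.sum_congr rfl fun r _ => ?_
  rw [← Finset.sum_add_distrib]
  refine Finset.sum_congr rfl fun s _ => ?_
  split_ifs <;> simp

/-- The Euler derivative of the series is thus log(W)/(W - 1), with W = Ad(exp a) Ad(exp b), applied
to the right logarithmic derivative a + exp(a) b exp(-a) of exp(a) exp(b). This is the differential
equation that identifies the series. -/
lemma derivation_dynkin_eq (hd : 1 ≤ d) (hS : S * S ≤ S) (hnil : S ^ (d + 1) = ⊥)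
    (D : A →ₗ[ℝ] A) (hD : ∀ x y, D (x * y) = D x * y + x * D y) {a b : A}
    (ha : D a = a) (hb : D b = b) (haS : a ∈ S) (hbS : b ∈ S) :
    D (dynkin d a b) = ∑ m ∈ Finset.range d,
      ((-1 : ℝ) ^ m / (m + 1)) • ((conj a * conj b - 1) ^ m) (a + conj a b) := by
  have h : ∀ m, blockSum d a b (m + 1) = ((conj a * conj b - 1) ^ m) (a + conj a b) := by
    intro m
    induction m with
    | zero => simpa using blockSum_one hd hnil haS hbS
    | succ m ih =>
      rw [blockSum_succ hS hnil haS hbS (by omega), ih, pow_succ', Module.End.mul_apply]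
  have hIcc : Finset.Icc 1 d = Finset.Ico 1 (d + 1) := by ext; simp
  rw [derivation_dynkin D hD ha hb, hIcc, Finset.sum_Ico_eq_sum_range, Nat.add_sub_cancel]
  refine Finset.sum_congr rfl fun m _ => ?_
  rw [add_comm 1 m, h, Nat.add_sub_cancel]
  push_cast
  rfl

end BakerCampbellHausdorff

/-! ### Dynkin's formula by deformation along a formal parameter. -/

section PolynomialDeformation

open Polynomial

attribute [local instance] LieRing.ofAssociativeRing

variable {A : Type*} [Ring A] [Algebra ℝ A] {S : Submodule ℝ A} {d : ℕ}

/-- The polynomials with coefficients in a submodule. -/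
def polySubmodule (S : Submodule ℝ A) : Submodule ℝ A[X] where
  carrier := {p | ∀ i, p.coeff i ∈ S}
  add_mem' hp hq i := by rw [coeff_add]; exact S.add_mem (hp i) (hq i)
  zero_mem' i := by rw [coeff_zero]; exact S.zero_mem
  smul_mem' c p hp i := by rw [coeff_smul]; exact S.smul_mem c (hp i)

lemma polySubmodule_mul_le (S T : Submodule ℝ A) :
    polySubmodule S * polySubmodule T ≤ polySubmodule (S * T) := by
  refine Submodule.mul_le.2 fun p hp q hq i => ?_
  rw [coeff_mul]
  exact Submodule.sum_mem _ fun x _ => Submodule.mul_mem_mul (hp _) (hq _)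

lemma polySubmodule_pow_le (S : Submodule ℝ A) (k : ℕ) :
    polySubmodule S ^ (k + 1) ≤ polySubmodule (S ^ (k + 1)) := by
  induction k with
  | zero => simp
  | succ k ih =>
    rw [pow_succ, pow_succ S]
    exact (mul_le_mul' ih le_rfl).trans (polySubmodule_mul_le _ _)

/-- The polynomials divisible by `X ^ k`. -/
def orderSubmodule (A : Type*) [Ring A] [Algebra ℝ A] (k : ℕ) : Submodule ℝ A[X] where
  carrier := {p | ∀ i < k, p.coeff i = 0}
  add_mem' hp hq i hi := by rw [coeff_add, hp i hi, hq i hi, add_zero]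
  zero_mem' i _ := coeff_zero i
  smul_mem' c p hp i hi := by rw [coeff_smul, hp i hi, smul_zero]

lemma mul_mem_orderSubmodule {j k l : ℕ} {p q : A[X]} (hp : p ∈ orderSubmodule A j)
    (hq : q ∈ orderSubmodule A k) (hl : l ≤ j + k) : p * q ∈ orderSubmodule A l := by
  intro i hi
  rw [coeff_mul]
  refine Finset.sum_eq_zero fun x hx => ?_
  have := Finset.HasAntidiagonal.mem_antidiagonal.1 hx
  by_cases h : x.1 < j
  · rw [hp _ h, zero_mul]
  · rw [hq _ (by omega), mul_zero]

lemma mem_orderSubmodule_zero (p : A[X]) : p ∈ orderSubmodule A 0 := fun i hi => by omega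

/-- The derivation `X d/dX` of a polynomial ring over a noncommutative ring. -/
def eulerDerivation (A : Type*) [Ring A] [Algebra ℝ A] : A[X] →ₗ[ℝ] A[X] where
  toFun p := X * derivative p
  map_add' p q := by rw [derivative_add, mul_add]
  map_smul' c p := by rw [derivative_smul, mul_smul_comm, RingHom.id_apply]

lemma eulerDerivation_mul (p q : A[X]) :
    eulerDerivation A (p * q) = eulerDerivation A p * q + p * eulerDerivation A q := by
  change X * derivative (p * q) = X * derivative p * q + p * (X * derivative q)
  rw [derivative_mul, mul_add, ← mul_assoc, ← mul_assoc, ← mul_assoc, X_mul (p := p)]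

lemma coeff_eulerDerivation (p : A[X]) (n : ℕ) :
    (eulerDerivation A p).coeff n = p.coeff n * n := by
  change (X * derivative p).coeff n = _
  cases n with
  | zero => simp
  | succ n => rw [coeff_X_mul, coeff_derivative]; push_cast; rfl

/-- The evaluation of polynomials at `1`. -/
def evalOne (A : Type*) [Ring A] [Algebra ℝ A] : A[X] →ₐ[ℝ] A :=
  { eval₂RingHom' (RingHom.id A) 1 fun a => Commute.one_right a with
    commutes' := fun r => by
      change eval₂ (RingHom.id A) 1 (algebraMap ℝ A[X] r) = _
      rw [Polynomial.algebraMap_apply, eval₂_C, RingHom.id_apply] }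

lemma evalOne_C_mul_X (x : A) : evalOne A (C x * X) = x := by
  change eval₂ (RingHom.id A) 1 (C x * X) = x
  rw [eval₂_mul_X, eval₂_C]; simp

lemma conj_mem_orderSubmodule {z v : A[X]} {k : ℕ} (hv : v ∈ orderSubmodule A k) :
    conj z v ∈ orderSubmodule A k := by
  rw [conj_apply]
  exact mul_mem_orderSubmodule (k := 0) (mul_mem_orderSubmodule (l := k)
    (mem_orderSubmodule_zero _) hv (Nat.zero_add k).ge) (mem_orderSubmodule_zero _) le_rfl

lemma aeval_comm_mem_orderSubmodule (f : A[X]) (T : ℝ[X]) {v : A[X]} {k : ℕ}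
    (hv : v ∈ orderSubmodule A k) : aeval (comm f) T v ∈ orderSubmodule A k := by
  rw [aeval_eq_sum_range, LinearMap.sum_apply]
  refine Submodule.sum_mem _ fun j _ => Submodule.smul_mem _ _ ?_
  clear * - hv
  induction j with
  | zero => simpa using hv
  | succ j ihj =>
    rw [pow_succ', Module.End.mul_apply, comm_apply]
    exact Submodule.sub_mem _
      (mul_mem_orderSubmodule (mem_orderSubmodule_zero _) ihj (Nat.zero_add k).ge)
      (mul_mem_orderSubmodule ihj (mem_orderSubmodule_zero _) le_rfl)

/-- With W = exp(a) exp(b), the difference is (exp f - W) v exp(-f) + W v (exp(-f) - W⁻¹), and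
exp(-f) - W⁻¹ = W⁻¹ (W - exp f) exp(-f). Each term has a factor of order k, and `v` contributes one
order more. This gain drives the induction in `rexp_eq_of_eulerDerivation`. -/
lemma conj_sub_conj_mem_orderSubmodule {f a b : A[X]} (hf : IsNilpotent f) (ha : IsNilpotent a)
    (hb : IsNilpotent b) {k : ℕ} (h : rexp f - rexp a * rexp b ∈ orderSubmodule A k) {v : A[X]}
    (hv : v ∈ orderSubmodule A 1) :
    conj f v - (conj a * conj b) v ∈ orderSubmodule A (k + 1) := by
  have hW : rexp (-b) * rexp (-a) * (rexp a * rexp b) = 1 := by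
    rw [mul_assoc, ← mul_assoc (rexp (-a)), rexp_neg_mul_rexp ha, one_mul, rexp_neg_mul_rexp hb]
  have e : conj f v - (conj a * conj b) v = (rexp f - rexp a * rexp b) * v * rexp (-f) +
      rexp a * rexp b * v * (rexp (-b) * rexp (-a) * (rexp a * rexp b - rexp f) * rexp (-f)) := by
    have h1 : rexp (-b) * rexp (-a) * (rexp a * rexp b - rexp f) * rexp (-f) =
        rexp (-f) - rexp (-b) * rexp (-a) := by
      rw [mul_sub, hW, sub_mul, one_mul, mul_assoc, rexp_mul_rexp_neg hf, mul_one]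
    rw [h1, Module.End.mul_apply, conj_apply, conj_apply, conj_apply]
    simp only [sub_mul, mul_sub, mul_assoc]
    abel
  rw [e]
  have h' : rexp a * rexp b - rexp f ∈ orderSubmodule A k := by
    rw [← neg_sub]; exact Submodule.neg_mem _ h
  refine Submodule.add_mem _ ?_ ?_
  · exact mul_mem_orderSubmodule (mul_mem_orderSubmodule h hv le_rfl)
      (mem_orderSubmodule_zero _) le_rfl
  · exact mul_mem_orderSubmodule (j := 1) (k := k) (mul_mem_orderSubmodule
      (mem_orderSubmodule_zero _) hv le_rfl) (mul_mem_orderSubmodule (j := k)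
      (mul_mem_orderSubmodule (mem_orderSubmodule_zero _) h' (Nat.zero_add k).ge)
      (mem_orderSubmodule_zero _) le_rfl) (Nat.add_comm k 1).le

lemma conj_sub_one_sub_mem_orderSubmodule {f a b : A[X]} (hf : IsNilpotent f)
    (ha : IsNilpotent a) (hb : IsNilpotent b) {k : ℕ}
    (h : rexp f - rexp a * rexp b ∈ orderSubmodule A k) {p q : A[X]}
    (hpq : p - q ∈ orderSubmodule A (k + 1)) (hq : q ∈ orderSubmodule A 1) :
    (conj f - 1) p - (conj a * conj b - 1) q ∈ orderSubmodule A (k + 1) := by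
  have e : (conj f - 1) p - (conj a * conj b - 1) q =
      (conj f q - (conj a * conj b) q) + conj f (p - q) - (p - q) := by
    rw [LinearMap.sub_apply, LinearMap.sub_apply, map_sub, Module.End.one_apply,
      Module.End.one_apply]
    abel
  rw [e]
  exact Submodule.sub_mem _ (Submodule.add_mem _
    (conj_sub_conj_mem_orderSubmodule hf ha hb h hq) (conj_mem_orderSubmodule hpq)) hpq

lemma conj_pow_sub_mem_orderSubmodule {f a b : A[X]} (hf : IsNilpotent f) (ha : IsNilpotent a)
    (hb : IsNilpotent b) {k : ℕ} (h : rexp f - rexp a * rexp b ∈ orderSubmodule A k) {v : A[X]}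
    (hv : v ∈ orderSubmodule A 1) (m : ℕ) :
    ((conj f - 1) ^ m) v - ((conj a * conj b - 1) ^ m) v ∈ orderSubmodule A (k + 1) ∧
      ((conj a * conj b - 1) ^ m) v ∈ orderSubmodule A 1 := by
  induction m with
  | zero =>
    rw [pow_zero, pow_zero, sub_self]
    exact ⟨Submodule.zero_mem _, hv⟩
  | succ m ihm =>
    rw [pow_succ', pow_succ', Module.End.mul_apply, Module.End.mul_apply (conj a * conj b - 1)]
    refine ⟨conj_sub_one_sub_mem_orderSubmodule hf ha hb h ihm.1 ihm.2, ?_⟩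
    rw [LinearMap.sub_apply, Module.End.mul_apply, Module.End.one_apply]
    exact Submodule.sub_mem _ (conj_mem_orderSubmodule (conj_mem_orderSubmodule ihm.2)) ihm.2

/-- A solution of the differential equation of the exponential of Dynkin's series. -/
lemma rexp_eq_of_eulerDerivation {P : Submodule ℝ A[X]}
    (hPP : P * P ≤ P) (hPnil : P ^ (d + 1) = ⊥) {f a b θ : A[X]} (hf : f ∈ P) (ha : a ∈ P)
    (hb : b ∈ P) (hθ : θ ∈ P) (hθI : θ ∈ orderSubmodule A 1)
    (hDfP : eulerDerivation A f ∈ P)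
    (hDf : eulerDerivation A f = ∑ m ∈ Finset.range d,
      ((-1 : ℝ) ^ m / (m + 1)) • ((conj a * conj b - 1) ^ m) θ)
    (hDW : eulerDerivation A (rexp a * rexp b) = θ * (rexp a * rexp b))
    (h0 : rexp f - rexp a * rexp b ∈ orderSubmodule A 1) : rexp f = rexp a * rexp b := by
  have hfn := isNilpotent_of_mem hPnil hf
  have han := isNilpotent_of_mem hPnil ha
  have hbn := isNilpotent_of_mem hPnil hb
  have main : ∀ k : ℕ, rexp f - rexp a * rexp b ∈ orderSubmodule A (k + 1) := by
    intro k
    induction k with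
    | zero => exact h0
    | succ k ih =>
      -- With conjugation by exp f in place of conj a ∘ conj b, `dexp_log` would give θ exactly. The
      -- replacement costs only terms of order k + 2, by the induction hypothesis.
      have h1 : aeval (comm f) (dexpPoly d) (eulerDerivation A f) - θ ∈
          orderSubmodule A (k + 2) := by
        have h3 := dexp_log hPP hPnil hf hθ
        have h4 : aeval (comm f) (dexpPoly d) (eulerDerivation A f) - θ =
            aeval (comm f) (dexpPoly d) (eulerDerivation A f - ∑ m ∈ Finset.range d,
              ((-1 : ℝ) ^ m / (m + 1)) • ((conj f - 1) ^ m) θ) := by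
          rw [map_sub, h3]
        rw [h4, hDf, ← Finset.sum_sub_distrib]
        refine aeval_comm_mem_orderSubmodule _ _ (Submodule.sum_mem _ fun m _ => ?_)
        rw [← smul_sub, ← neg_sub (((conj f - 1) ^ m) θ), smul_neg]
        exact Submodule.neg_mem _ (Submodule.smul_mem _ _
          (conj_pow_sub_mem_orderSubmodule hfn han hbn ih hθI m).1)
      have h2 : eulerDerivation A (rexp f - rexp a * rexp b) ∈ orderSubmodule A (k + 2) := by
        rw [map_sub, hDW, derivation_rexp hPnil _ eulerDerivation_mul hf hDfP]
        have e : ∀ p W : A[X], p * rexp f - θ * W = (p - θ) * rexp f + θ * (rexp f - W) := by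
          intro p W
          simp only [sub_mul, mul_sub]; abel
        rw [e]
        exact Submodule.add_mem _ (mul_mem_orderSubmodule h1 (mem_orderSubmodule_zero _) le_rfl)
          (mul_mem_orderSubmodule hθI ih (by omega))
      intro i hi
      -- The Euler derivation multiplies the i-th coefficient by i, so it controls every coefficient
      -- except the constant one, which is known from the induction hypothesis.
      rcases Nat.eq_zero_or_pos i with rfl | hi0
      · exact ih 0 (by omega)
      · have h3 := h2 i hi
        rw [coeff_eulerDerivation, ← nsmul_eq_mul', ← Nat.cast_smul_eq_nsmul ℝ] at h3
        exact (smul_eq_zero.1 h3).resolve_left (by positivity)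
  rw [← sub_eq_zero]
  exact Polynomial.ext fun i => main i i (by omega)

/-- The Baker-Campbell-Hausdorff formula in an associative algebra. -/
theorem rexp_dynkin (hS : S * S ≤ S) (hnil : S ^ (d + 1) = ⊥) {x y : A} (hx : x ∈ S)
    (hy : y ∈ S) : rexp (dynkin d x y) = rexp x * rexp y := by
  rcases Nat.eq_zero_or_pos d with rfl | hd
  · rw [zero_add, pow_one] at hnil
    rw [hnil, Submodule.mem_bot] at hx hy
    simp [dynkin, hx, hy]
  -- The elements x and y are replaced by xX and yX. The Euler derivation X d/dX fixes both, and
  -- identities can be proved order by order in X.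
  set P := polySubmodule S
  have hPP : P * P ≤ P := (polySubmodule_mul_le _ _).trans fun p hp i => hS (hp i)
  have hPnil : P ^ (d + 1) = ⊥ := by
    refine le_bot_iff.1 ((polySubmodule_pow_le S d).trans fun p hp => ?_)
    rw [hnil] at hp
    exact (Submodule.mem_bot ℝ).2 (Polynomial.ext fun i => by simpa using hp i)
  set D := eulerDerivation A
  set I := orderSubmodule A
  have hmono : ∀ {z : A}, z ∈ S → C z * X ∈ P ∧ D (C z * X) = C z * X ∧ C z * X ∈ I 1 := by
    intro z hz
    refine ⟨fun i => ?_, ?_, fun i hi => ?_⟩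
    · rw [coeff_C_mul, coeff_X]; split_ifs <;> simp [hz]
    · change X * derivative (C z * X) = _
      rw [derivative_C_mul_X, X_mul]
    · rw [coeff_C_mul, coeff_X, if_neg (by omega), mul_zero]
  obtain ⟨haP, hDa, haI⟩ := hmono hx
  obtain ⟨hbP, hDb, hbI⟩ := hmono hy
  set a := C x * X
  set b := C y * X
  set f := dynkin d a b
  have nil : ∀ {z : A[X]}, z ∈ P → IsNilpotent z := fun hz => isNilpotent_of_mem hPnil hz
  have hnest : ∀ w : List A[X], (∀ z ∈ w, z = a ∨ z = b) → nest w ∈ P ∧ nest w ∈ I 1 := by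
    intro w hw
    induction w with
    | nil => exact ⟨P.zero_mem, (I 1).zero_mem⟩
    | cons c w ih =>
      have hc : c ∈ P ∧ c ∈ I 1 := by
        rcases hw c (by simp) with rfl | rfl
        exacts [⟨haP, haI⟩, ⟨hbP, hbI⟩]
      by_cases h : w = []
      · subst h; exact hc
      · obtain ⟨h1, h2⟩ := ih fun z hz => hw z (by simp [hz])
        have e : nest (c :: w) = c * nest w - nest w * c := nest_cons c h
        rw [e]
        exact ⟨P.sub_mem (hPP (Submodule.mul_mem_mul hc.1 h1)) (hPP (Submodule.mul_mem_mul h1 hc.1)),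
          (I 1).sub_mem (mul_mem_orderSubmodule hc.2 h2 (by omega))
            (mul_mem_orderSubmodule h2 hc.2 (by omega))⟩
  have hsum : ∀ Q : Submodule ℝ A[X], (∀ w : List A[X], (∀ z ∈ w, z = a ∨ z = b) → nest w ∈ Q) →
      f ∈ Q := by
    intro Q hQ
    refine Q.sum_mem fun m _ => Q.smul_mem _ (Q.sum_mem fun q _ => ?_)
    split_ifs
    · exact Q.smul_mem _ (hQ _ fun z hz => mem_dynkinWord hz)
    · exact Q.zero_mem
  have hfP : f ∈ P := hsum P fun w hw => (hnest w hw).1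
  have hfI : f ∈ I 1 := hsum (I 1) fun w hw => (hnest w hw).2
  have hD := eulerDerivation_mul (A := A)
  set W := rexp a * rexp b
  set W' := rexp (-b) * rexp (-a)
  have hW'W : W' * W = 1 := by
    calc W' * W = rexp (-b) * (rexp (-a) * rexp a) * rexp b := by simp only [W, W', mul_assoc]
      _ = 1 := by rw [rexp_neg_mul_rexp (nil haP), mul_one, rexp_neg_mul_rexp (nil hbP)]
  set θ := a + conj a b with hθ
  have hconjP : ∀ {z v : A[X]}, z ∈ P → v ∈ P → conj z v ∈ P := fun hz hv =>
    conj_mem hPP hPnil hz hv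
  have hconjI : ∀ {z v : A[X]} {k : ℕ}, v ∈ I k → conj z v ∈ I k := by
    intro z v k hv
    exact conj_mem_orderSubmodule hv
  have hθP : θ ∈ P := P.add_mem haP (hconjP haP hbP)
  have hθI : θ ∈ I 1 := (I 1).add_mem haI (hconjI hbI)
  have hDW : D W = θ * W := by
    have hself : ∀ {z : A[X]}, z ∈ P → D z = z → D (rexp z) = z * rexp z := by
      intro z hz hDz
      rw [derivation_rexp hPnil D hD hz (by rw [hDz]; exact hz), hDz, dexpPoly, map_sum,
        LinearMap.sum_apply, Finset.sum_eq_single 0]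
      · simp
      · intro k _ hk
        obtain ⟨j, rfl⟩ := Nat.exists_eq_succ_of_ne_zero hk
        simp [pow_succ, comm_apply]
      · intro h; simp at h; omega
    rw [hD, hself haP hDa, hself hbP hDb, hθ, conj_apply, add_mul]
    congr 1
    · noncomm_ring
    · rw [mul_assoc (rexp a * b), ← mul_assoc (rexp (-a)), rexp_neg_mul_rexp (nil haP), one_mul,
        mul_assoc (rexp a)]
  have hDf := derivation_dynkin_eq hd hPP hPnil D hD hDa hDb haP hbP
  have hDfP : D f ∈ P := fun i => by
    rw [coeff_eulerDerivation, ← nsmul_eq_mul', ← Nat.cast_smul_eq_nsmul ℝ]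
    exact S.smul_mem _ (hfP i)
  have hexp : ∀ {z : A[X]}, z ∈ P → z ∈ I 1 → rexp z - 1 ∈ I 1 := by
    intro z hz hzI
    have : z ^ (d + 1) = 0 := by simpa [hPnil] using Submodule.pow_mem_pow P hz (d + 1)
    rw [rexp_eq_sum this, Finset.sum_range_succ']
    simp only [pow_zero, Nat.factorial_zero, Nat.cast_one, inv_one, one_smul, add_sub_cancel_right]
    refine (I 1).sum_mem fun k _ => (I 1).smul_mem _ ?_
    rw [pow_succ]
    exact mul_mem_orderSubmodule (mem_orderSubmodule_zero _) hzI (by omega)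
  have hfW : rexp f = W := by
    refine rexp_eq_of_eulerDerivation hPP hPnil hfP haP hbP hθP hθI hDfP hDf hDW ?_
    have e : rexp f - W = (rexp f - 1) - ((rexp a - 1) * rexp b + (rexp b - 1)) := by
      simp only [W, sub_mul, one_mul]; abel
    change rexp f - W ∈ I 1
    rw [e]
    exact (I 1).sub_mem (hexp hfP hfI) ((I 1).add_mem (mul_mem_orderSubmodule (hexp haP haI)
      (mem_orderSubmodule_zero _) (by omega)) (hexp hbP hbI))
  -- Setting X = 1 returns to the original elements, since the exponential and Dynkin's series
  -- commute with homomorphisms.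
  have h := congrArg (evalOne A) hfW
  rw [map_rexp _ (nil hfP), map_mul, map_rexp _ (nil haP), map_rexp _ (nil hbP),
    evalOne_C_mul_X, evalOne_C_mul_X] at h
  rw [← h]
  congr 1
  have := map_dynkin (evalOne A).toLieHom d a b
  rw [AlgHom.toLieHom_apply, AlgHom.toLieHom_apply, AlgHom.toLieHom_apply, evalOne_C_mul_X,
    evalOne_C_mul_X] at this
  exact this.symm

end PolynomialDeformation

/-! ### Nilpotent filtrations -/

section Filtration

variable {V : Type*} [AddCommGroup V] [Module ℝ V]

/-- The endomorphisms that raise a filtration by one. -/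
def filteredEnd (U : ℕ → Submodule ℝ V) :
    @Submodule ℝ (Module.End ℝ V) _ _ Algebra.toModule where
  carrier := {T | ∀ i, ∀ v ∈ U i, T v ∈ U (i + 1)}
  add_mem' hS hT i v hv := (U (i + 1)).add_mem (hS i v hv) (hT i v hv)
  zero_mem' i _ _ := (U (i + 1)).zero_mem
  smul_mem' c _ hT i v hv := (U (i + 1)).smul_mem c (hT i v hv)

lemma filteredEnd_mul_le {U : ℕ → Submodule ℝ V} (hU : Antitone U) :
    filteredEnd U * filteredEnd U ≤ filteredEnd U :=
  Submodule.mul_le.2 fun _ hS _ hT i v hv => hU (Nat.le_succ (i + 1)) (hS _ _ (hT i v hv))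

lemma filteredEnd_pow_eq_bot {U : ℕ → Submodule ℝ V} {d : ℕ} (h0 : U 0 = ⊤) (hd : U d = ⊥) :
    filteredEnd U ^ d = ⊥ := by
  have h : ∀ (k : ℕ) (T : Module.End ℝ V), T ∈ filteredEnd U ^ k → ∀ i, ∀ v ∈ U i, T v ∈ U (i + k) := by
    intro k
    induction k with
    | zero =>
      intro T hT i v hv
      rw [pow_zero, Submodule.mem_one] at hT
      obtain ⟨c, rfl⟩ := hT
      rw [Module.algebraMap_end_apply]
      exact (U i).smul_mem c hv
    | succ k ih =>
      intro T hT
      rw [pow_succ] at hT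
      refine Submodule.mul_induction_on hT (fun A hA B hB i v hv => ?_) fun A B hA hB i v hv =>
        (U _).add_mem (hA i v hv) (hB i v hv)
      have := ih A hA _ _ (hB i v hv)
      rwa [add_assoc, add_comm 1 k] at this
  refine le_bot_iff.1 fun T hT => (Submodule.mem_bot ℝ).2 (LinearMap.ext fun v => ?_)
  have := h d T hT 0 v (h0 ▸ Submodule.mem_top)
  rwa [zero_add, hd, Submodule.mem_bot] at this

section

variable {U : ℕ → Submodule ℝ V} {d : ℕ} {S T : Module.End ℝ V}

lemma isNilpotent_of_filtration (h0 : U 0 = ⊤) (hd : U d = ⊥)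
    (hT : ∀ i, ∀ v ∈ U i, T v ∈ U (i + 1)) : IsNilpotent T := by
  have h := Submodule.pow_mem_pow (filteredEnd U) (show T ∈ filteredEnd U from hT) d
  rw [filteredEnd_pow_eq_bot h0 hd, Submodule.mem_bot] at h
  exact ⟨d, h⟩

attribute [local instance] LieRing.ofAssociativeRing in
lemma rexp_dynkin_of_filtration (hU : Antitone U) (h0 : U 0 = ⊤) (hd : U (d + 1) = ⊥)
    (hS : ∀ i, ∀ v ∈ U i, S v ∈ U (i + 1)) (hT : ∀ i, ∀ v ∈ U i, T v ∈ U (i + 1)) :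
    rexp (dynkin d S T) = rexp S * rexp T :=
  rexp_dynkin (filteredEnd_mul_le hU) (filteredEnd_pow_eq_bot h0 hd) (x := S) (y := T) hS hT

lemma sum_comm_pow_of_filtration (h0 : U 0 = ⊤) (hd : U (d + 1) = ⊥)
    (hS : ∀ i, ∀ v ∈ U i, S v ∈ U (i + 1)) (hT : ∀ i, ∀ v ∈ U i, T v ∈ U (i + 1)) :
    ∑ k ∈ Finset.range (d + 1), (k.factorial : ℝ)⁻¹ • (comm S ^ k) T =
      rexp S * T * rexp (-S) := by
  rw [← conj_apply]
  exact sum_comm_pow (filteredEnd_pow_eq_bot h0 hd) (z := S) (v := T) hS hT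

end

variable (L : Type*) [LieRing L] [LieAlgebra ℝ L]

/-- The lower central series, as a sequence of subspaces. -/
def lcs (k : ℕ) : Submodule ℝ L := (LieModule.lowerCentralSeries ℝ L L k).toSubmodule

lemma lcs_antitone : Antitone (lcs L) := fun _ _ h =>
  LieModule.antitone_lowerCentralSeries ℝ L L h

lemma lcs_zero : lcs L 0 = ⊤ := by simp [lcs]

variable {L} in
lemma lie_mem_lcs (x : L) {y : L} {k : ℕ} (hy : y ∈ lcs L k) : ⁅x, y⁆ ∈ lcs L (k + 1) := by
  change ⁅x, y⁆ ∈ LieModule.lowerCentralSeries ℝ L L (k + 1)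
  rw [LieModule.lowerCentralSeries_succ]
  exact LieSubmodule.lie_mem_lie (LieSubmodule.mem_top x) hy

/-- Two equal consecutive terms would make the series constant from there on, hence zero by
nilpotency. So every nonzero term loses a dimension. This justifies truncating `bch` and `Ad` at the
dimension. -/
lemma lcs_finrank_eq_bot [FiniteDimensional ℝ L] [LieRing.IsNilpotent L] :
    lcs L (Module.finrank ℝ L) = ⊥ := by
  obtain ⟨K, hK⟩ := LieModule.IsNilpotent.nilpotent ℝ L L
  have hK' : lcs L K = ⊥ := by rw [lcs, hK]; rfl
  have h : ∀ k, lcs L k = ⊥ ∨ Module.finrank ℝ (lcs L k) + k ≤ Module.finrank ℝ L := by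
    intro k
    induction k with
    | zero => exact Or.inr (by simpa using Submodule.finrank_le _)
    | succ k ih =>
      by_cases hb : lcs L k = ⊥
      · exact Or.inl (le_bot_iff.1 ((lcs_antitone L (Nat.le_succ k)).trans hb.le))
      · have hlt : lcs L (k + 1) < lcs L k := by
          refine lt_of_le_of_ne (lcs_antitone L (Nat.le_succ k)) fun heq => hb ?_
          have hst : ∀ j, lcs L (k + j) = lcs L k := by
            intro j
            induction j with
            | zero => rfl
            | succ j ihj =>
              rw [← heq, ← add_assoc]
              have e : LieModule.lowerCentralSeries ℝ L L (k + j) =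
                  LieModule.lowerCentralSeries ℝ L L k :=
                LieSubmodule.toSubmodule_injective ihj
              rw [lcs, lcs, LieModule.lowerCentralSeries_succ, LieModule.lowerCentralSeries_succ, e]
          rw [← hst K]
          exact le_bot_iff.1 ((lcs_antitone L (Nat.le_add_left K k)).trans hK'.le)
        have := Submodule.finrank_lt_finrank_of_lt hlt
        rcases ih with ih | ih
        · exact absurd ih hb
        · exact Or.inr (by omega)
  rcases h (Module.finrank ℝ L) with h | h
  · exact h
  · exact Submodule.finrank_eq_zero.1 (by omega)

variable {L} in
lemma ad_mem_filteredEnd (x : L) :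
    (LieAlgebra.ad ℝ L x : Module.End ℝ L) ∈ filteredEnd (lcs L) := fun _ _ hv =>
  lie_mem_lcs x hv

lemma filteredEnd_lcs_pow [FiniteDimensional ℝ L] [LieRing.IsNilpotent L] :
    filteredEnd (lcs L) ^ (Module.finrank ℝ L + 1) = ⊥ :=
  filteredEnd_pow_eq_bot (lcs_zero L) (le_bot_iff.1 ((lcs_antitone L (Nat.le_succ _)).trans
    (lcs_finrank_eq_bot L).le))

variable {L}

lemma ad_pow_eq_zero [FiniteDimensional ℝ L] [LieRing.IsNilpotent L] (x : L) {k : ℕ}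
    (hk : Module.finrank ℝ L ≤ k) : (LieAlgebra.ad ℝ L x : Module.End ℝ L) ^ k = 0 := by
  have h := filteredEnd_pow_eq_bot (lcs_zero L) (lcs_finrank_eq_bot L)
  have := Submodule.pow_mem_pow _ (ad_mem_filteredEnd x) (Module.finrank ℝ L)
  rw [h, Submodule.mem_bot] at this
  exact pow_eq_zero_of_le hk this

lemma isNilpotent_ad [FiniteDimensional ℝ L] [LieRing.IsNilpotent L] (x : L) :
    IsNilpotent (LieAlgebra.ad ℝ L x : Module.End ℝ L) := ⟨_, ad_pow_eq_zero x le_rfl⟩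

attribute [local instance] LieRing.ofAssociativeRing in
lemma comm_ad_pow (x y : L) (k : ℕ) :
    (comm (LieAlgebra.ad ℝ L x : Module.End ℝ L) ^ k) (LieAlgebra.ad ℝ L y) =
      LieAlgebra.ad ℝ L (((LieAlgebra.ad ℝ L x : Module.End ℝ L) ^ k) y) := by
  induction k with
  | zero => rfl
  | succ k ih =>
    rw [pow_succ', pow_succ', Module.End.mul_apply, Module.End.mul_apply, ih, LieAlgebra.ad_apply,
      LieHom.map_lie]
    rfl

/-- `exp (ad x)` is an automorphism of the Lie algebra. -/
lemma rexp_ad_lie [FiniteDimensional ℝ L] [LieRing.IsNilpotent L] (x y z : L) :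
    rexp (LieAlgebra.ad ℝ L x : Module.End ℝ L) ⁅y, z⁆ =
      ⁅rexp (LieAlgebra.ad ℝ L x : Module.End ℝ L) y,
        rexp (LieAlgebra.ad ℝ L x : Module.End ℝ L) z⁆ := by
  set T : Module.End ℝ L := LieAlgebra.ad ℝ L x with hT
  have hn : IsNilpotent T := isNilpotent_ad x
  have h1 := sum_comm_pow (filteredEnd_lcs_pow L) (ad_mem_filteredEnd x) (ad_mem_filteredEnd y)
  have h2 : conj T (LieAlgebra.ad ℝ L y : Module.End ℝ L) =
      LieAlgebra.ad ℝ L (rexp T y) := by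
    rw [← h1, rexp_eq_sum (ad_pow_eq_zero x (Nat.le_succ _)), LinearMap.sum_apply, map_sum]
    refine Finset.sum_congr rfl fun k _ => ?_
    rw [comm_ad_pow, LinearMap.smul_apply, map_smul]
  have h3 := congrArg (fun S : Module.End ℝ L => S (rexp T z)) h2
  simp only [conj_apply, LieAlgebra.ad_apply, Module.End.mul_apply] at h3
  rw [← h3]
  congr 1
  have h4 := congrArg (fun S : Module.End ℝ L => S z) (rexp_neg_mul_rexp hn)
  simp only [Module.End.mul_apply, Module.End.one_apply] at h4
  rw [h4]

end Filtration

/-! ### Curves in a Lie algebra -/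

section Curves

variable {𝔤 : Type u} [MetricLieAlgebra 𝔤]

lemma nestedBracket_eq_nest (w : List 𝔤) : nestedBracket w = nest w := by
  induction w with
  | nil => rfl
  | cons a w ih =>
    cases w with
    | nil => rfl
    | cons b w => rw [nestedBracket, nest, ih]

lemma bch_eq_dynkin (X Y : 𝔤) : bch X Y = dynkin (Module.finrank ℝ 𝔤) X Y := by
  simp only [bch, dynkin, nestedBracket_eq_nest]
  rfl

variable [FiniteDimensional ℝ 𝔤]

/-- The Lie bracket as a continuous bilinear map. -/
def lieCLM (𝔤 : Type u) [MetricLieAlgebra 𝔤] [FiniteDimensional ℝ 𝔤] : 𝔤 →L[ℝ] 𝔤 →L[ℝ] 𝔤 :=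
  LinearMap.toContinuousLinearMap
    ((LinearMap.toContinuousLinearMap : (𝔤 →ₗ[ℝ] 𝔤) ≃ₗ[ℝ] (𝔤 →L[ℝ] 𝔤)).toLinearMap ∘ₗ
      (LieAlgebra.ad ℝ 𝔤 : 𝔤 →ₗ[ℝ] Module.End ℝ 𝔤))

lemma lieCLM_apply (X Y : 𝔤) : lieCLM 𝔤 X Y = ⁅X, Y⁆ := rfl

lemma contDiff_lie {E : Type*} [NormedAddCommGroup E] [NormedSpace ℝ E] {f g : E → 𝔤}
    (hf : ContDiff ℝ ∞ f) (hg : ContDiff ℝ ∞ g) : ContDiff ℝ ∞ fun x => ⁅f x, g x⁆ :=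
  (lieCLM 𝔤).isBoundedBilinearMap.contDiff.comp (hf.prodMk hg)

lemma hasDerivAt_lie {p q : ℝ → 𝔤} {p' q' : 𝔤} {t : ℝ} (hp : HasDerivAt p p' t)
    (hq : HasDerivAt q q' t) :
    HasDerivAt (fun s => ⁅p s, q s⁆) (⁅p t, q'⁆ + ⁅p', q t⁆) t := by
  have h1 := (lieCLM 𝔤).hasFDerivAt_of_bilinear hp.hasFDerivAt hq.hasFDerivAt
  have h2 := h1.hasDerivAt
  simpa [lieCLM_apply] using h2

/-- The Lie algebra of smooth curves. -/
def smoothCurves (𝔤 : Type u) [MetricLieAlgebra 𝔤] : Submodule ℝ (ℝ → 𝔤) where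
  carrier := {p | ContDiff ℝ ∞ p}
  add_mem' {p q} (hp : ContDiff ℝ ∞ p) (hq : ContDiff ℝ ∞ q) := hp.add hq
  zero_mem' := (contDiff_const : ContDiff ℝ ∞ fun _ : ℝ => (0 : 𝔤))
  smul_mem' c p (hp : ContDiff ℝ ∞ p) := hp.const_smul c

lemma curve_contDiff (p : smoothCurves 𝔤) : ContDiff ℝ ∞ p.1 := p.2

instance : LieRing (smoothCurves 𝔤) where
  bracket p q := ⟨fun t => ⁅p.1 t, q.1 t⁆, contDiff_lie (curve_contDiff p) (curve_contDiff q)⟩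
  add_lie p q r := Subtype.ext (funext fun t => add_lie (p.1 t) (q.1 t) (r.1 t))
  lie_add p q r := Subtype.ext (funext fun t => lie_add (p.1 t) (q.1 t) (r.1 t))
  lie_self p := Subtype.ext (funext fun t => lie_self (p.1 t))
  leibniz_lie p q r := Subtype.ext (funext fun t => leibniz_lie (p.1 t) (q.1 t) (r.1 t))

instance : LieAlgebra ℝ (smoothCurves 𝔤) where
  lie_smul c p q := Subtype.ext (funext fun t => lie_smul c (p.1 t) (q.1 t))

/-- The evaluation of a curve at `t`. -/
def evalCurve (t : ℝ) : smoothCurves 𝔤 →ₗ⁅ℝ⁆ 𝔤 where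
  toFun p := p.1 t
  map_add' _ _ := rfl
  map_smul' _ _ := rfl
  map_lie' := rfl

lemma evalCurve_apply (t : ℝ) (p : smoothCurves 𝔤) : evalCurve t p = p.1 t := rfl

lemma curve_hasDerivAt (p : smoothCurves 𝔤) (t : ℝ) : HasDerivAt p.1 (deriv p.1 t) t :=
  (((curve_contDiff p).differentiable (by simp)) t).hasDerivAt

/-- The derivative of a curve. -/
def curveDeriv : smoothCurves 𝔤 →ₗ[ℝ] smoothCurves 𝔤 where
  toFun p := ⟨deriv p.1, (contDiff_infty_iff_deriv.1 (curve_contDiff p)).2⟩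
  map_add' p q := Subtype.ext (funext fun t =>
    ((curve_hasDerivAt p t).add (curve_hasDerivAt q t)).deriv)
  map_smul' c p := Subtype.ext (funext fun t => ((curve_hasDerivAt p t).const_smul c).deriv)

lemma curveDeriv_lie (p q : smoothCurves 𝔤) :
    curveDeriv ⁅p, q⁆ = ⁅p, curveDeriv q⁆ + ⁅curveDeriv p, q⁆ :=
  Subtype.ext (funext fun t => (hasDerivAt_lie (curve_hasDerivAt p t) (curve_hasDerivAt q t)).deriv)

attribute [local instance] LieRing.ofAssociativeRing

/-- The action of the curves on the extension of their Lie algebra by `d/dt`. -/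
def curveRep : smoothCurves 𝔤 →ₗ⁅ℝ⁆ Module.End ℝ (smoothCurves 𝔤 × ℝ) where
  toFun p :=
    { toFun := fun v => (⁅p, v.1⁆ - v.2 • curveDeriv p, 0)
      map_add' := fun v w => by
        refine Prod.ext ?_ (by simp)
        simp only [Prod.fst_add, Prod.snd_add, lie_add, add_smul]; abel
      map_smul' := fun c v => by
        refine Prod.ext ?_ (by simp)
        simp [lie_smul, smul_sub, mul_smul] }
  map_add' p q := by
    refine LinearMap.ext fun v => Prod.ext ?_ (by simp)
    simp only [add_lie, map_add, smul_add, LinearMap.coe_mk, AddHom.coe_mk, LinearMap.add_apply,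
      Prod.fst_add]
    abel
  map_smul' c p := by
    refine LinearMap.ext fun v => Prod.ext ?_ (by simp)
    simp [smul_lie, smul_sub, smul_comm c]
  map_lie' := by
    intro p q
    refine LinearMap.ext fun v => Prod.ext ?_ ?_
    · simp only [LinearMap.coe_mk, AddHom.coe_mk, LieRing.of_associative_ring_bracket,
        LinearMap.sub_apply, Module.End.mul_apply, Prod.fst_sub, zero_smul, sub_zero,
        curveDeriv_lie, lie_lie, lie_sub, lie_smul, smul_add]
      rw [← lie_skew (curveDeriv p) q]
      simp only [smul_neg]
      abel
    · simp [LieRing.of_associative_ring_bracket]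

lemma curveRep_apply (p : smoothCurves 𝔤) (v : smoothCurves 𝔤 × ℝ) :
    curveRep p v = (⁅p, v.1⁆ - v.2 • curveDeriv p, 0) := rfl

/-- The filtration of the extension of the Lie algebra of curves by the lower central series. -/
def curveFiltration (𝔤 : Type u) [MetricLieAlgebra 𝔤] :
    ℕ → Submodule ℝ (smoothCurves 𝔤 × ℝ)
  | 0 => ⊤
  | k + 1 =>
    { carrier := {v | v.2 = 0 ∧ ∀ t, v.1.1 t ∈ lcs 𝔤 k}
      add_mem' := fun hv hw => ⟨by simp [hv.1, hw.1], fun t => (lcs 𝔤 k).add_mem (hv.2 t) (hw.2 t)⟩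
      zero_mem' := ⟨rfl, fun _ => (lcs 𝔤 k).zero_mem⟩
      smul_mem' := fun c v hv => ⟨by simp [hv.1], fun t => (lcs 𝔤 k).smul_mem c (hv.2 t)⟩ }

lemma curveFiltration_antitone : Antitone (curveFiltration 𝔤) := by
  refine antitone_nat_of_succ_le fun k => ?_
  cases k with
  | zero => exact le_top
  | succ k => exact fun v hv => ⟨hv.1, fun t => lcs_antitone 𝔤 (Nat.le_succ k) (hv.2 t)⟩

lemma curveRep_mem (p : smoothCurves 𝔤) : ∀ k, ∀ v ∈ curveFiltration 𝔤 k,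
    curveRep p v ∈ curveFiltration 𝔤 (k + 1) := by
  intro k v hv
  refine ⟨rfl, fun t => ?_⟩
  cases k with
  | zero => rw [lcs_zero]; exact Submodule.mem_top
  | succ k =>
    rw [curveRep_apply, hv.1, zero_smul, sub_zero]
    exact lie_mem_lcs _ (hv.2 t)

/-- The product of curves of group elements. -/
def bchCurve (p q : smoothCurves 𝔤) : smoothCurves 𝔤 := dynkin (Module.finrank ℝ 𝔤) p q

lemma bchCurve_apply (p q : smoothCurves 𝔤) (t : ℝ) : (bchCurve p q).1 t = bch (p.1 t) (q.1 t) := by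
  rw [bch_eq_dynkin, ← evalCurve_apply, bchCurve, map_dynkin]; rfl

variable [LieRing.IsNilpotent 𝔤]

lemma curveFiltration_eq_bot : curveFiltration 𝔤 (Module.finrank ℝ 𝔤 + 1) = ⊥ := by
  refine le_bot_iff.1 fun v hv => (Submodule.mem_bot ℝ).2 (Prod.ext (Subtype.ext ?_) hv.1)
  refine funext fun t => ?_
  have := hv.2 t
  rwa [lcs_finrank_eq_bot, Submodule.mem_bot] at this

lemma isNilpotent_curveRep (p : smoothCurves 𝔤) : IsNilpotent (curveRep p) :=
  isNilpotent_of_filtration rfl curveFiltration_eq_bot (curveRep_mem p)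

lemma rexp_curveRep_bchCurve (p q : smoothCurves 𝔤) :
    rexp (curveRep (bchCurve p q)) = rexp (curveRep p) * rexp (curveRep q) := by
  rw [bchCurve, map_dynkin]
  exact rexp_dynkin_of_filtration curveFiltration_antitone rfl curveFiltration_eq_bot
    (curveRep_mem p) (curveRep_mem q)

/-- Unlike the adjoint representation of 𝔤, this one sees the centre: applied to d/dt it returns
minus the derivative of the curve, which determines the curve up to its initial value. The logarithm
of a nilpotent element is unique, so exponentials suffice. -/
lemma curve_ext {p q : smoothCurves 𝔤} (h : rexp (curveRep p) = rexp (curveRep q))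
    (h0 : p.1 0 = q.1 0) : p = q := by
  have h1 := rexp_injective (isNilpotent_curveRep p) (isNilpotent_curveRep q) h
  have h2 := congrArg (fun T : Module.End ℝ (smoothCurves 𝔤 × ℝ) => (T (0, 1)).1) h1
  simp only [curveRep_apply, lie_zero, one_smul, zero_sub, neg_inj] at h2
  refine Subtype.ext (funext fun t => ?_)
  have h3 : ∀ s, HasDerivAt (fun s => p.1 s - q.1 s) 0 s := by
    intro s
    have h4 : deriv p.1 s = deriv q.1 s := congrFun (congrArg Subtype.val h2) s
    have h6 := (curve_hasDerivAt p s).sub (curve_hasDerivAt q s)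
    rw [h4, sub_self] at h6
    exact h6
  have h5 := is_const_of_deriv_eq_zero (fun s => (h3 s).differentiableAt) (fun s => (h3 s).deriv) t 0
  simp only [h0, sub_self] at h5
  exact sub_eq_zero.1 h5

/-- The curve `t ↦ t X`. -/
def lineCurve (X : 𝔤) : smoothCurves 𝔤 := ⟨fun t => t • X, (contDiff_id.smul contDiff_const : ContDiff ℝ ∞ fun t : ℝ => t • X)⟩

end Curves

/-! ### The group law -/

section GroupLaw

attribute [local instance] LieRing.ofAssociativeRing

variable {𝔤 : Type u} [MetricLieAlgebra 𝔤]

lemma bch_zero_zero : bch (0 : 𝔤) 0 = 0 := by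
  have := map_dynkin (0 : 𝔤 →ₗ⁅ℝ⁆ 𝔤) (Module.finrank ℝ 𝔤) 0 0
  rw [bch_eq_dynkin]
  simpa using this.symm

variable [FiniteDimensional ℝ 𝔤] [LieRing.IsNilpotent 𝔤]

lemma Ad_eq_rexp (X : 𝔤) : Ad X = rexp (LieAlgebra.ad ℝ 𝔤 X : Module.End ℝ 𝔤) := by
  rw [rexp_eq_sum (ad_pow_eq_zero X (Nat.le_succ _))]; rfl

lemma Ad_bch (X Y : 𝔤) : Ad (bch X Y) = Ad X * Ad Y := by
  rw [Ad_eq_rexp, Ad_eq_rexp, Ad_eq_rexp, bch_eq_dynkin, map_dynkin]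
  exact rexp_dynkin_of_filtration (lcs_antitone 𝔤) (lcs_zero 𝔤)
    (le_bot_iff.1 ((lcs_antitone 𝔤 (Nat.le_succ _)).trans (lcs_finrank_eq_bot 𝔤).le))
    (ad_mem_filteredEnd X) (ad_mem_filteredEnd Y)

lemma Ad_mul_Ad_neg (X : 𝔤) : Ad X * Ad (-X) = 1 := by
  rw [Ad_eq_rexp, Ad_eq_rexp, map_neg]
  exact rexp_mul_rexp_neg (isNilpotent_ad X)

lemma Ad_Ad_neg (X Y : 𝔤) : Ad X (Ad (-X) Y) = Y :=
  congrArg (fun T : Module.End ℝ 𝔤 => T Y) (Ad_mul_Ad_neg X)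

lemma Ad_neg_Ad (X Y : 𝔤) : Ad (-X) (Ad X Y) = Y := by
  simpa using Ad_Ad_neg (-X) Y

lemma bchCurve_line_zero {p q : smoothCurves 𝔤} (hp : p.1 0 = 0) (hq : q.1 0 = 0) :
    (bchCurve p q).1 0 = 0 := by
  rw [bchCurve_apply, hp, hq, bch_zero_zero]

lemma lineCurve_zero (X : 𝔤) : (lineCurve X).1 0 = 0 := zero_smul ℝ X

lemma lineCurve_one (X : 𝔤) : (lineCurve X).1 1 = X := one_smul ℝ X

lemma lineCurve_smul_add (s t : ℝ) (X : 𝔤) :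
    lineCurve ((s + t) • X) = s • lineCurve X + t • lineCurve X := by
  refine Subtype.ext (funext fun r => ?_)
  change r • (s + t) • X = s • r • X + t • r • X
  rw [add_smul, smul_add, smul_comm r s, smul_comm r t]

/-- Group identities follow by applying this to the lines t ↦ tX, which all start at 0 and reach X
at t = 1. -/
lemma curve_ext_one {p q : smoothCurves 𝔤} (h : rexp (curveRep p) = rexp (curveRep q))
    (hp : p.1 0 = 0) (hq : q.1 0 = 0) : p.1 1 = q.1 1 := by
  rw [curve_ext h (hp.trans hq.symm)]

lemma bch_assoc (X Y Z : 𝔤) : bch (bch X Y) Z = bch X (bch Y Z) := by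
  have h := curve_ext_one (p := bchCurve (bchCurve (lineCurve X) (lineCurve Y)) (lineCurve Z))
    (q := bchCurve (lineCurve X) (bchCurve (lineCurve Y) (lineCurve Z)))
    (by simp only [rexp_curveRep_bchCurve, mul_assoc])
    (bchCurve_line_zero (bchCurve_line_zero (lineCurve_zero X) (lineCurve_zero Y))
      (lineCurve_zero Z))
    (bchCurve_line_zero (lineCurve_zero X) (bchCurve_line_zero (lineCurve_zero Y)
      (lineCurve_zero Z)))
  simpa only [bchCurve_apply, lineCurve_one] using h

lemma bch_smul_smul (s t : ℝ) (X : 𝔤) : bch (s • X) (t • X) = (s + t) • X := by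
  have h := curve_ext_one (p := bchCurve (s • lineCurve X) (t • lineCurve X))
    (q := lineCurve ((s + t) • X)) (by
      rw [rexp_curveRep_bchCurve, lineCurve_smul_add, map_add, map_smul, map_smul, rexp_add]
      · exact (Commute.refl (curveRep (lineCurve X))).smul_left s |>.smul_right t
      · exact (isNilpotent_curveRep _).smul s
      · exact (isNilpotent_curveRep _).smul t)
    (bchCurve_line_zero (by simp [lineCurve_zero]) (by simp [lineCurve_zero]))
    (lineCurve_zero _)
  rw [bchCurve_apply, lineCurve_one] at h
  rw [← h]
  change _ = bch (s • (lineCurve X).1 1) (t • (lineCurve X).1 1)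
  rw [lineCurve_one]

@[simp] lemma bch_zero (X : 𝔤) : bch X 0 = X := by
  simpa using bch_smul_smul 1 0 X

@[simp] lemma zero_bch (X : 𝔤) : bch 0 X = X := by
  simpa using bch_smul_smul 0 1 X

@[simp] lemma bch_neg_self (X : 𝔤) : bch X (-X) = 0 := by
  simpa using bch_smul_smul 1 (-1) X

@[simp] lemma neg_bch_self (X : 𝔤) : bch (-X) X = 0 := by
  simpa using bch_smul_smul (-1) 1 X

@[simp] lemma neg_bch_cancel_left (X Y : 𝔤) : bch (-X) (bch X Y) = Y := by
  rw [← bch_assoc, neg_bch_self, zero_bch]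

@[simp] lemma bch_neg_cancel_left (X Y : 𝔤) : bch X (bch (-X) Y) = Y := by
  rw [← bch_assoc, bch_neg_self, zero_bch]

@[simp] lemma neg_bch_cancel_right (X Y : 𝔤) : bch (bch X (-Y)) Y = X := by
  rw [bch_assoc, neg_bch_self, bch_zero]

lemma curveRep_ad_pow (p q : smoothCurves 𝔤) (k : ℕ) :
    curveRep (((LieAlgebra.ad ℝ (smoothCurves 𝔤) p : Module.End ℝ (smoothCurves 𝔤)) ^ k) q) =
      (comm (curveRep p) ^ k) (curveRep q) := by
  induction k with
  | zero => rfl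
  | succ k ih =>
    rw [pow_succ', pow_succ', Module.End.mul_apply, Module.End.mul_apply, ← ih, LieAlgebra.ad_apply,
      LieHom.map_lie]
    rfl

lemma ad_curve_pow_apply (p q : smoothCurves 𝔤) (k : ℕ) (t : ℝ) :
    (((LieAlgebra.ad ℝ (smoothCurves 𝔤) p : Module.End ℝ (smoothCurves 𝔤)) ^ k) q).1 t =
      ((LieAlgebra.ad ℝ 𝔤 (p.1 t) : Module.End ℝ 𝔤) ^ k) (q.1 t) := by
  induction k with
  | zero => rfl
  | succ k ih =>
    rw [pow_succ', pow_succ', Module.End.mul_apply, Module.End.mul_apply, ← ih]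
    rfl

/-- The curve `Ad (p t) (q t)`. -/
def AdCurve (p q : smoothCurves 𝔤) : smoothCurves 𝔤 :=
  ∑ k ∈ Finset.range (Module.finrank ℝ 𝔤 + 1), (k.factorial : ℝ)⁻¹ •
    ((LieAlgebra.ad ℝ (smoothCurves 𝔤) p : Module.End ℝ (smoothCurves 𝔤)) ^ k) q

lemma AdCurve_apply (p q : smoothCurves 𝔤) (t : ℝ) : (AdCurve p q).1 t = Ad (p.1 t) (q.1 t) := by
  rw [← evalCurve_apply, AdCurve, map_sum, Ad, LinearMap.sum_apply]
  refine Finset.sum_congr rfl fun k _ => ?_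
  rw [map_smul, evalCurve_apply, ad_curve_pow_apply, LinearMap.smul_apply]

lemma curveRep_AdCurve (p q : smoothCurves 𝔤) :
    curveRep (AdCurve p q) = rexp (curveRep p) * curveRep q * rexp (-curveRep p) := by
  rw [AdCurve, map_sum, ← sum_comm_pow_of_filtration rfl curveFiltration_eq_bot (curveRep_mem p)
    (curveRep_mem q)]
  exact Finset.sum_congr rfl fun k _ => by rw [map_smul, curveRep_ad_pow]

/-- Conjugation is the adjoint action. -/
lemma bch_conj (X Y : 𝔤) : bch (bch X Y) (-X) = Ad X Y := by
  have h := curve_ext_one (p := bchCurve (bchCurve (lineCurve X) (lineCurve Y)) (-lineCurve X))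
    (q := AdCurve (lineCurve X) (lineCurve Y)) (by
      rw [curveRep_AdCurve, rexp_curveRep_bchCurve, rexp_curveRep_bchCurve, map_neg,
        rexp_conj (isNilpotent_curveRep _) (isNilpotent_curveRep _)])
    (bchCurve_line_zero (bchCurve_line_zero (lineCurve_zero X) (lineCurve_zero Y))
      (by simp [lineCurve_zero]))
    (by rw [AdCurve_apply, lineCurve_zero, lineCurve_zero, map_zero])
  rw [AdCurve_apply, bchCurve_apply, bchCurve_apply, lineCurve_one, lineCurve_one] at h
  rw [← h]
  change _ = bch (bch X Y) (-(lineCurve X).1 1)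
  rw [lineCurve_one]

/-- The differential of the exponential map in the right trivialization. -/
def dexp (X : 𝔤) : Module.End ℝ 𝔤 :=
  ∑ k ∈ Finset.range (Module.finrank ℝ 𝔤), ((k + 1).factorial : ℝ)⁻¹ •
    (LieAlgebra.ad ℝ 𝔤 X : Module.End ℝ 𝔤) ^ k

lemma curveRep_pow_inl (p q : smoothCurves 𝔤) (k : ℕ) :
    (curveRep p ^ k) (q, 0) =
      (((LieAlgebra.ad ℝ (smoothCurves 𝔤) p : Module.End ℝ (smoothCurves 𝔤)) ^ k) q, 0) := by
  induction k with
  | zero => rfl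
  | succ k ih =>
    rw [pow_succ', pow_succ', Module.End.mul_apply, Module.End.mul_apply, ih, curveRep_apply]
    simp

lemma ad_curve_pow_eq_zero (p q : smoothCurves 𝔤) {k : ℕ} (hk : Module.finrank ℝ 𝔤 ≤ k) :
    ((LieAlgebra.ad ℝ (smoothCurves 𝔤) p : Module.End ℝ (smoothCurves 𝔤)) ^ k) q = 0 := by
  refine Subtype.ext (funext fun t => ?_)
  rw [ad_curve_pow_apply, ad_pow_eq_zero _ hk]; rfl

lemma rexp_curveRep_inl (p q : smoothCurves 𝔤) :
    rexp (curveRep p) (q, 0) = (AdCurve p q, 0) := by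
  rw [rexp_apply_eq_sum (isNilpotent_curveRep p) (M := Module.finrank ℝ 𝔤 + 1) (by
    rw [curveRep_pow_inl, ad_curve_pow_eq_zero p q (Nat.le_succ _)]; rfl)]
  simp only [curveRep_pow_inl, AdCurve]
  refine Prod.ext ?_ ?_
  · simp [Prod.fst_sum]
  · simp [Prod.snd_sum]

/-- The curve `dexp (p t) (p' t)`. -/
def dexpCurve (p : smoothCurves 𝔤) : smoothCurves 𝔤 :=
  ∑ k ∈ Finset.range (Module.finrank ℝ 𝔤), ((k + 1).factorial : ℝ)⁻¹ •
    ((LieAlgebra.ad ℝ (smoothCurves 𝔤) p : Module.End ℝ (smoothCurves 𝔤)) ^ k) (curveDeriv p)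

lemma dexpCurve_apply (p : smoothCurves 𝔤) (t : ℝ) :
    (dexpCurve p).1 t = dexp (p.1 t) (deriv p.1 t) := by
  rw [← evalCurve_apply, dexpCurve, map_sum, dexp, LinearMap.sum_apply]
  refine Finset.sum_congr rfl fun k _ => ?_
  rw [map_smul, evalCurve_apply, ad_curve_pow_apply, LinearMap.smul_apply]
  rfl

lemma rexp_curveRep_inr (p : smoothCurves 𝔤) :
    rexp (curveRep p) (0, 1) = (-dexpCurve p, 1) := by
  have h1 : curveRep p (0, 1) = (-curveDeriv p, 0) := by
    rw [curveRep_apply]; simp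
  have h : ∀ k, (curveRep p ^ (k + 1)) (0, 1) =
      (-((LieAlgebra.ad ℝ (smoothCurves 𝔤) p : Module.End ℝ (smoothCurves 𝔤)) ^ k)
        (curveDeriv p), 0) := by
    intro k
    rw [pow_succ, Module.End.mul_apply, h1, curveRep_pow_inl, map_neg]
  rw [rexp_apply_eq_sum (isNilpotent_curveRep p) (M := Module.finrank ℝ 𝔤 + 1) (by
    rw [h, ad_curve_pow_eq_zero _ _ le_rfl, neg_zero]; rfl), Finset.sum_range_succ']
  simp only [h, dexpCurve]
  refine Prod.ext ?_ ?_
  · simp [Prod.fst_sum]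
  · simp [Prod.snd_sum]

/-- The product formula for the right logarithmic derivative. -/
lemma dexp_bch (p q : smoothCurves 𝔤) (t : ℝ) :
    dexp (bch (p.1 t) (q.1 t)) (deriv (bchCurve p q).1 t) =
      dexp (p.1 t) (deriv p.1 t) + Ad (p.1 t) (dexp (q.1 t) (deriv q.1 t)) := by
  have h := congrArg (fun T : Module.End ℝ (smoothCurves 𝔤 × ℝ) => T (0, 1))
    (rexp_curveRep_bchCurve p q)
  simp only [Module.End.mul_apply, rexp_curveRep_inr] at h
  have e : ((-dexpCurve q, 1) : smoothCurves 𝔤 × ℝ) = (0, 1) + (-dexpCurve q, 0) := by simp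
  -- The exponential of a curve moves the vector d/dt by minus its right logarithmic derivative and
  -- acts on curves by Ad. Comparing the curve components of the two sides gives the product rule.
  rw [e, map_add, rexp_curveRep_inr, rexp_curveRep_inl] at h
  have h1 := congrArg (fun v : smoothCurves 𝔤 × ℝ => v.1.1 t) h
  have h2 : -(dexpCurve (bchCurve p q)).1 t =
      -(dexpCurve p).1 t + (AdCurve p (-dexpCurve q)).1 t := h1
  have h3 : (-dexpCurve q).1 t = -(dexpCurve q).1 t := rfl
  rw [AdCurve_apply, h3, map_neg, dexpCurve_apply, dexpCurve_apply, dexpCurve_apply, ← neg_add,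
    neg_inj, bchCurve_apply] at h2
  exact h2

end GroupLaw

/-! ### Smoothness and invariance of the Lebesgue measure -/

section Smoothness

variable {𝔤 : Type u} [MetricLieAlgebra 𝔤] [FiniteDimensional ℝ 𝔤]

lemma contDiff_nest {E : Type*} [NormedAddCommGroup E] [NormedSpace ℝ E] {w : List (E → 𝔤)}
    (hw : ∀ f ∈ w, ContDiff ℝ ∞ f) : ContDiff ℝ ∞ fun x => nest (w.map fun f => f x) := by
  induction w with
  | nil => exact contDiff_const
  | cons f w ih =>
    by_cases h : w = []
    · subst h; exact hw f (by simp)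
    · have : (fun x => nest ((f :: w).map fun f => f x)) =
          fun x => ⁅f x, nest (w.map fun f => f x)⁆ := by
        funext x
        rw [List.map_cons, nest_cons _ (by simpa using h)]
      rw [this]
      exact contDiff_lie (hw f (by simp)) (ih fun g hg => hw g (by simp [hg]))

lemma contDiff_bch {E : Type*} [NormedAddCommGroup E] [NormedSpace ℝ E] {f g : E → 𝔤}
    (hf : ContDiff ℝ ∞ f) (hg : ContDiff ℝ ∞ g) : ContDiff ℝ ∞ fun x => bch (f x) (g x) := by
  simp only [bch_eq_dynkin, dynkin]
  refine ContDiff.sum fun m _ => ContDiff.const_smul _ (ContDiff.sum fun q _ => ?_)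
  split_ifs
  · refine ContDiff.const_smul _ ?_
    have : ∀ x, dynkinWord (f x) (g x) (fun i => ((q i).1 : ℕ)) (fun i => ((q i).2 : ℕ)) =
        (dynkinWord f g (fun i => ((q i).1 : ℕ)) (fun i => ((q i).2 : ℕ))).map fun h => h x :=
      fun x => (map_dynkinWord (fun h : E → 𝔤 => h x) f g _ _).symm
    simp only [this]
    exact contDiff_nest fun h hh => by rcases mem_dynkinWord hh with rfl | rfl <;> assumption
  · exact contDiff_const

lemma continuous_bch : Continuous fun p : 𝔤 × 𝔤 => bch p.1 p.2 :=
  (contDiff_bch contDiff_fst contDiff_snd).continuous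

variable [LieRing.IsNilpotent 𝔤]

lemma det_one_add_of_isNilpotent {V : Type*} [AddCommGroup V] [Module ℝ V]
    [FiniteDimensional ℝ V] {T : Module.End ℝ V} (hT : IsNilpotent T) :
    LinearMap.det (1 + T) = 1 := by
  have h := IsNilpotent.charpoly_eq_X_pow_finrank hT.neg
  have h1 := congrArg (Polynomial.eval 1) h
  rw [LinearMap.eval_charpoly] at h1
  simpa using h1

lemma det_of_sum_ad {c : ℕ → ℝ} (h0 : c 0 = 1) (X : 𝔤) {N : ℕ} (hN : 0 < N) :
    LinearMap.det (∑ k ∈ Finset.range N, c k • (LieAlgebra.ad ℝ 𝔤 X : Module.End ℝ 𝔤) ^ k) = 1 := by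
  obtain ⟨N, rfl⟩ := Nat.exists_eq_succ_of_ne_zero hN.ne'
  rw [Finset.sum_range_succ', h0, pow_zero, one_smul, add_comm]
  refine det_one_add_of_isNilpotent ?_
  have : ∑ k ∈ Finset.range N, c (k + 1) • (LieAlgebra.ad ℝ 𝔤 X : Module.End ℝ 𝔤) ^ (k + 1) =
      (LieAlgebra.ad ℝ 𝔤 X : Module.End ℝ 𝔤) *
        ∑ k ∈ Finset.range N, c (k + 1) • (LieAlgebra.ad ℝ 𝔤 X : Module.End ℝ 𝔤) ^ k := by
    rw [Finset.mul_sum]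
    exact Finset.sum_congr rfl fun k _ => by rw [pow_succ', mul_smul_comm]
  rw [this]
  refine Commute.isNilpotent_mul_right ?_ (isNilpotent_ad X)
  exact Commute.sum_right _ _ _ fun k _ => ((Commute.refl _).pow_right k).smul_right _

lemma hasFDerivAt_bch_left (g X : 𝔤) :
    HasFDerivAt (bch g) (fderiv ℝ (bch g) X) X :=
  (((contDiff_bch contDiff_const contDiff_id).differentiable (by simp)) X).hasFDerivAt

/-- Left translations have Jacobian determinant one. -/
lemma det_fderiv_bch (g X : 𝔤) : (fderiv ℝ (bch g) X).det = 1 := by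
  rcases Nat.eq_zero_or_pos (Module.finrank ℝ 𝔤) with h0 | hpos
  · exact LinearMap.det_eq_one_of_finrank_eq_zero h0 _
  -- This is the product rule for the constant curve g and the line X + tV at t = 0.
  have h : ∀ V : 𝔤, dexp (bch g X) (fderiv ℝ (bch g) X V) = Ad g (dexp X V) := by
    intro V
    set p : smoothCurves 𝔤 := ⟨fun _ => g, (contDiff_const : ContDiff ℝ ∞ fun _ : ℝ => g)⟩
    have hq : HasDerivAt (fun t : ℝ => X + t • V) V 0 := by
      simpa using ((hasDerivAt_id (0 : ℝ)).smul_const V).const_add X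
    set q : smoothCurves 𝔤 := ⟨fun t => X + t • V,
      (contDiff_const.add (contDiff_id.smul contDiff_const) :
        ContDiff ℝ ∞ fun t : ℝ => X + t • V)⟩
    have h1 := dexp_bch p q 0
    have h2 : (bchCurve p q).1 = fun t => bch g (X + t • V) := by
      funext t; rw [bchCurve_apply]
    have h3 : q.1 0 = X := by simp [q]
    have h4 : deriv p.1 0 = 0 := deriv_const 0 g
    have h5 : deriv q.1 0 = V := hq.deriv
    have h6 : HasDerivAt (fun t : ℝ => bch g (X + t • V)) (fderiv ℝ (bch g) X V) 0 := by
      have := hasFDerivAt_bch_left g X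
      rw [show X = X + (0 : ℝ) • V by simp] at this
      have := this.comp_hasDerivAt (0 : ℝ) hq
      rw [zero_smul, add_zero] at this
      exact this
    rw [h2, h3, h4, h5, h6.deriv, map_zero, zero_add] at h1
    exact h1
  -- Here `dexp` and `Ad` are 1 plus nilpotent operators and have determinant one, so the Jacobian
  -- of the translation has too.
  have h1 : dexp (bch g X) * (fderiv ℝ (bch g) X : 𝔤 →ₗ[ℝ] 𝔤) = Ad g * dexp X :=
    LinearMap.ext h
  have h2 := congrArg LinearMap.det h1
  have hd : ∀ Y : 𝔤, LinearMap.det (dexp Y) = 1 := fun Y =>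
    det_of_sum_ad (c := fun k => ((k + 1).factorial : ℝ)⁻¹) (by simp) Y hpos
  have hA : LinearMap.det (Ad g) = 1 :=
    det_of_sum_ad (c := fun k => (k.factorial : ℝ)⁻¹) (by simp) g (Nat.succ_pos _)
  rw [map_mul, map_mul, hd, hd, hA, one_mul, one_mul] at h2
  exact h2

variable [MeasurableSpace 𝔤] [BorelSpace 𝔤]

/-- Left translations preserve the Lebesgue measure. -/
lemma measurePreserving_bch (g : 𝔤) : MeasurePreserving (bch g) volume volume := by
  have himg : ∀ (h : 𝔤) {s : Set 𝔤}, MeasurableSet s → volume (bch h '' s) = volume s := by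
    intro h s hs
    rw [← lintegral_abs_det_fderiv_eq_addHaar_image volume hs
      (fun x _ => (hasFDerivAt_bch_left h x).hasFDerivWithinAt)
      (fun x _ y _ hxy => by simpa using congrArg (bch (-h)) hxy)]
    simp [det_fderiv_bch]
  have hc : Continuous (bch g) := (contDiff_bch contDiff_const contDiff_id).continuous
  refine ⟨hc.measurable, Measure.ext fun s hs => ?_⟩
  rw [Measure.map_apply hc.measurable hs, ← himg (-g) hs]
  congr 1
  ext x
  constructor
  · exact fun hx => ⟨bch g x, hx, by simp⟩
  · rintro ⟨y, hy, rfl⟩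
    simpa using hy

end Smoothness

/-! ### Functionals on a nilpotent Lie algebra and polarizing subalgebras -/

section Pukanszky

/-- `exp (ad x)`. -/
def expAd {L : Type*} [LieRing L] [LieAlgebra ℝ L] (x : L) : Module.End ℝ L :=
  rexp (LieAlgebra.ad ℝ L x : Module.End ℝ L)

variable {L : Type u} [LieRing L] [LieAlgebra ℝ L] [FiniteDimensional ℝ L] [LieRing.IsNilpotent L]

lemma expAd_apply (x y : L) {N : ℕ} (h : (LieAlgebra.ad ℝ L x : Module.End ℝ L) ^ N = 0) :
    expAd x y = ∑ k ∈ Finset.range N,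
      (k.factorial : ℝ)⁻¹ • ((LieAlgebra.ad ℝ L x : Module.End ℝ L) ^ k) y := by
  rw [expAd, rexp_eq_sum h, LinearMap.sum_apply]
  rfl

lemma expAd_lie (x y z : L) : expAd x ⁅y, z⁆ = ⁅expAd x y, expAd x z⁆ := rexp_ad_lie x y z

lemma expAd_neg_expAd (x y : L) : expAd (-x) (expAd x y) = y := by
  have h := congrArg (fun T : Module.End ℝ L => T y)
    (rexp_neg_mul_rexp (isNilpotent_ad x))
  simp only [← map_neg] at h
  exact h

lemma LieHom.map_expAd {L' : Type*} [LieRing L'] [LieAlgebra ℝ L'] [FiniteDimensional ℝ L']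
    [LieRing.IsNilpotent L'] (f : L →ₗ⁅ℝ⁆ L') (x y : L) :
    f (expAd x y) = expAd (f x) (f y) := by
  rw [expAd_apply x y (ad_pow_eq_zero x (Nat.le_add_right _ (Module.finrank ℝ L'))),
    expAd_apply (f x) (f y) (ad_pow_eq_zero (f x) (Nat.le_add_left _ (Module.finrank ℝ L))),
    map_sum]
  refine Finset.sum_congr rfl fun k _ => ?_
  rw [map_smul]
  congr 1
  clear * -
  induction k with
  | zero => rfl
  | succ k ih =>
    rw [pow_succ', pow_succ', Module.End.mul_apply, Module.End.mul_apply, ← ih,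
      LieAlgebra.ad_apply, LieAlgebra.ad_apply, LieHom.map_lie]

lemma expAd_sub_mem {x y : L} {S : Submodule ℝ L} (h : ⁅x, y⁆ ∈ S) (hS : ∀ w ∈ S, ⁅x, w⁆ ∈ S) :
    expAd x y - y ∈ S := by
  rw [expAd_apply x y (ad_pow_eq_zero x (Nat.le_succ _)), Finset.sum_range_succ']
  simp only [pow_zero, Nat.factorial_zero, Nat.cast_one, inv_one, one_smul, Module.End.one_apply,
    add_sub_cancel_right]
  refine S.sum_mem fun k hk => S.smul_mem _ ?_
  clear hk
  induction k with
  | zero => simpa using h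
  | succ k ih =>
    rw [pow_succ', Module.End.mul_apply]
    exact hS _ ih

lemma expAd_mem {x y : L} {S : Submodule ℝ L} (hy : y ∈ S) (hS : ∀ w ∈ S, ⁅x, w⁆ ∈ S) :
    expAd x y ∈ S := by
  simpa using S.add_mem (expAd_sub_mem (hS y hy) hS) hy

lemma expAd_of_lie_lie {x y : L} (h : ⁅x, ⁅x, y⁆⁆ = 0) : expAd x y = y + ⁅x, y⁆ := by
  rw [expAd_apply x y (ad_pow_eq_zero x (Nat.le_add_right _ 2)), Finset.sum_range_succ',
    Finset.sum_range_succ']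
  have : ∀ k, ((LieAlgebra.ad ℝ L x : Module.End ℝ L) ^ (k + 1 + 1)) y = 0 := fun k => by
    rw [add_assoc, pow_add, Module.End.mul_apply]
    simp [pow_two, h]
  simp only [this]
  simp [add_comm]

lemma expAd_of_lie_eq_zero {x y : L} (h : ⁅x, y⁆ = 0) : expAd x y = y := by
  rw [expAd_of_lie_lie (by rw [h, lie_zero]), h, add_zero]

/-- Two functionals are related if they are on the same coadjoint orbit. -/
def CoadjRel (l l' : Module.Dual ℝ L) : Prop :=
  Relation.ReflTransGen (fun a b => ∃ x : L, b = a ∘ₗ expAd x) l l'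

lemma CoadjRel.comp_of_surjective {L' : Type*} [LieRing L'] [LieAlgebra ℝ L']
    [FiniteDimensional ℝ L'] [LieRing.IsNilpotent L'] {f : L →ₗ⁅ℝ⁆ L'}
    (hf : Function.Surjective f) {a b : Module.Dual ℝ L'} (h : CoadjRel a b) :
    CoadjRel (a ∘ₗ (f : L →ₗ[ℝ] L')) (b ∘ₗ (f : L →ₗ[ℝ] L')) := by
  induction h with
  | refl => exact Relation.ReflTransGen.refl
  | tail _ hs ih =>
    obtain ⟨x, rfl⟩ := hs
    obtain ⟨x, rfl⟩ := hf x
    exact ih.tail ⟨x, LinearMap.ext fun y => congrArg _ (LieHom.map_expAd f x y).symm⟩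

/-- An orbit in the dual of the source lifts along the homomorphism, because each move by exp(ad x)
is the restriction of the move by exp(ad f(x)). -/
lemma CoadjRel.exists_of_hom {L' : Type*} [LieRing L'] [LieAlgebra ℝ L']
    [FiniteDimensional ℝ L'] [LieRing.IsNilpotent L'] (f : L' →ₗ⁅ℝ⁆ L) (l : Module.Dual ℝ L)
    {b : Module.Dual ℝ L'} (h : CoadjRel (l ∘ₗ (f : L' →ₗ[ℝ] L)) b) :
    ∃ l', CoadjRel l l' ∧ l' ∘ₗ (f : L' →ₗ[ℝ] L) = b := by
  induction h with
  | refl => exact ⟨l, Relation.ReflTransGen.refl, rfl⟩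
  | tail _ hs ih =>
    obtain ⟨x, rfl⟩ := hs
    obtain ⟨l', h1, rfl⟩ := ih
    exact ⟨l' ∘ₗ expAd (f x), h1.tail ⟨f x, rfl⟩,
      LinearMap.ext fun y => congrArg _ (LieHom.map_expAd f x y).symm⟩

/-- The subalgebra `𝔪` is an isotropic subspace that equals its orthogonal. -/
structure IsLagrangian (l : Module.Dual ℝ L) (𝔪 : LieSubalgebra ℝ L) : Prop where
  isotropic : ∀ x ∈ 𝔪, ∀ y ∈ 𝔪, l ⁅x, y⁆ = 0
  mem : ∀ y, (∀ x ∈ 𝔪, l ⁅x, y⁆ = 0) → y ∈ 𝔪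

/-- Functionals that agree on a Lagrangian subalgebra are on one coadjoint orbit. -/
def OrbitProperty (L : Type u) [LieRing L] [LieAlgebra ℝ L] [FiniteDimensional ℝ L]
    [LieRing.IsNilpotent L] : Prop :=
  ∀ (l l' : Module.Dual ℝ L) (𝔪 : LieSubalgebra ℝ L), IsLagrangian l 𝔪 →
    (∀ x ∈ 𝔪, l' x = l x) → CoadjRel l l'

/-- The centralizer of an element. -/
def centralizerOf (y : L) : LieSubalgebra ℝ L where
  __ := LinearMap.ker (LieAlgebra.ad ℝ L y : Module.End ℝ L)
  lie_mem' {a b} ha hb := by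
    change ⁅y, ⁅a, b⁆⁆ = 0
    have ha : ⁅y, a⁆ = 0 := ha
    have hb : ⁅y, b⁆ = 0 := hb
    rw [leibniz_lie, ha, hb]; simp

lemma mem_centralizerOf {y a : L} : a ∈ centralizerOf y ↔ ⁅y, a⁆ = 0 := Iff.rfl

instance (S : LieSubalgebra ℝ L) : LieRing.IsNilpotent S :=
  Function.Injective.lieAlgebra_isNilpotent (f := S.incl) Subtype.val_injective

/-- `y` is in the second centre: `[w, y] = β (w) z` with `z` central, and `l (z) = 1`. -/
structure KirillovData (l : Module.Dual ℝ L) (y z : L) (β : Module.Dual ℝ L) : Prop where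
  lie_y : ∀ w : L, ⁅w, y⁆ = β w • z
  lie_z : ∀ w : L, ⁅w, z⁆ = 0
  apply_z : l z = 1
  ne_zero : β ≠ 0

namespace KirillovData

variable {l l' : Module.Dual ℝ L} {y z : L} {β : Module.Dual ℝ L} {𝔪 : LieSubalgebra ℝ L}

lemma beta_eq (h : KirillovData l y z β) (w : L) : β w = l ⁅w, y⁆ := by
  rw [h.lie_y, map_smul, h.apply_z, smul_eq_mul, mul_one]

lemma z_ne (h : KirillovData l y z β) : z ≠ 0 := by
  rintro rfl; simpa using h.apply_z

lemma mem_centralizer_iff (h : KirillovData l y z β) {w : L} : w ∈ centralizerOf y ↔ β w = 0 := by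
  rw [mem_centralizerOf, ← lie_skew, h.lie_y, neg_eq_zero, smul_eq_zero, or_iff_left h.z_ne]

lemma beta_y (h : KirillovData l y z β) : β y = 0 := by
  rw [h.beta_eq, lie_self, map_zero]

lemma beta_z (h : KirillovData l y z β) : β z = 0 := by
  rw [h.beta_eq, ← lie_skew, h.lie_z, neg_zero, map_zero]

lemma beta_lie (h : KirillovData l y z β) (a b : L) : β ⁅a, b⁆ = 0 := by
  rw [h.beta_eq, lie_lie, h.lie_y, h.lie_y, lie_smul, lie_smul, h.lie_z, h.lie_z]
  simp

lemma finrank_lt (h : KirillovData l y z β) :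
    Module.finrank ℝ (centralizerOf y) < Module.finrank ℝ L := by
  refine Submodule.finrank_lt (s := (centralizerOf y).toSubmodule) fun htop => h.ne_zero ?_
  refine LinearMap.ext fun w => h.mem_centralizer_iff.1 ?_
  change w ∈ (centralizerOf y).toSubmodule
  rw [htop]; trivial

lemma exists_eq_one (h : KirillovData l y z β) : ∃ w, β w = 1 := by
  obtain ⟨w, hw⟩ : ∃ w, β w ≠ 0 := by
    by_contra! hc
    exact h.ne_zero (LinearMap.ext hc)
  exact ⟨(β w)⁻¹ • w, by rw [map_smul, smul_eq_mul, inv_mul_cancel₀ hw]⟩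

/-- By induction `l` can be moved to `l1` that agrees with `l'` on the hyperplane β = 0. The
difference is then a multiple of β, and exp(ad(cy)) changes `l1` by exactly -cβ, because [y, a] =
-β(a)z and l1(z) = 1. -/
lemma coadjRel_of_le (h : KirillovData l y z β) (hm : IsLagrangian l 𝔪)
    (hle : 𝔪 ≤ centralizerOf y) (hl : ∀ x ∈ 𝔪, l' x = l x)
    (ih : OrbitProperty (centralizerOf y)) : CoadjRel l l' := by
  set i : centralizerOf y →ₗ⁅ℝ⁆ L := (centralizerOf y).incl with hi
  have hzm : z ∈ 𝔪 := hm.mem z fun x _ => by rw [h.lie_z, map_zero]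
  have h1 : CoadjRel (l ∘ₗ (i : centralizerOf y →ₗ[ℝ] L)) (l' ∘ₗ (i : centralizerOf y →ₗ[ℝ] L)) :=
    ih _ _ (𝔪.comap i)
      ⟨fun a ha b hb => hm.isotropic a ha b hb, fun b hb => hm.mem b fun a ha =>
        hb ⟨a, hle ha⟩ ha⟩ fun a ha => hl a ha
  obtain ⟨l1, h2, h3⟩ := CoadjRel.exists_of_hom i l h1
  obtain ⟨w, hw⟩ := h.exists_eq_one
  have h4 : ∀ a, β a = 0 → l1 a = l' a := fun a ha =>
    congrArg (fun f : Module.Dual ℝ (centralizerOf y) => f ⟨a, h.mem_centralizer_iff.2 ha⟩) h3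
  have hz1 : l1 z = 1 := by rw [h4 z h.beta_z, hl z hzm, h.apply_z]
  -- The multiple is read off at w, where β(w) = 1.
  refine h2.tail ⟨(l1 w - l' w) • y, LinearMap.ext fun a => ?_⟩
  have h5 : ∀ b, ⁅y, b⁆ = -(β b • z) := fun b => by rw [← lie_skew, h.lie_y]
  have h6 : expAd ((l1 w - l' w) • y) a = a - ((l1 w - l' w) * β a) • z := by
    rw [expAd_of_lie_lie, smul_lie, h5, smul_neg, smul_smul, ← sub_eq_add_neg]
    rw [smul_lie, smul_lie, h5 a, smul_neg, smul_smul, lie_neg, lie_smul, h.lie_z]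
    simp
  rw [LinearMap.comp_apply, h6]
  have h7 := h4 (a - β a • w) (by rw [map_sub, map_smul, hw]; simp)
  simp only [map_sub, map_smul, smul_eq_mul, hz1] at h7 ⊢
  linarith

/-- The subalgebra is exchanged for (𝔪 ∩ ker β) + ℝy, which lies in the centralizer, and the
previous case applies. Before that, `l` is moved along an element of 𝔪, so that it also agrees with
`l'` at y. -/
lemma coadjRel_of_not_le (h : KirillovData l y z β) (hm : IsLagrangian l 𝔪)
    (hle : ¬ 𝔪 ≤ centralizerOf y) (hl : ∀ x ∈ 𝔪, l' x = l x)
    (ih : OrbitProperty (centralizerOf y)) : CoadjRel l l' := by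
  obtain ⟨x, hx, hx1⟩ : ∃ x ∈ 𝔪, β x = 1 := by
    obtain ⟨x, hx, hx0⟩ := Set.not_subset.1 hle
    have hx0 : β x ≠ 0 := fun h0 => hx0 (h.mem_centralizer_iff.2 h0)
    exact ⟨(β x)⁻¹ • x, 𝔪.smul_mem _ hx, by rw [map_smul, smul_eq_mul, inv_mul_cancel₀ hx0]⟩
  have hzm : z ∈ 𝔪 := hm.mem z fun x _ => by rw [h.lie_z, map_zero]
  set s : ℝ := l' y - l y with hs
  set l1 : Module.Dual ℝ L := l ∘ₗ expAd (s • x) with hl1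
  have hsx : s • x ∈ 𝔪 := 𝔪.smul_mem _ hx
  have hez : expAd (s • x) z = z := expAd_of_lie_eq_zero (h.lie_z _)
  have hey : expAd (s • x) y = y + s • z := by
    have h0 : ⁅s • x, y⁆ = s • z := by rw [smul_lie, h.lie_y, hx1, one_smul]
    rw [expAd_of_lie_lie, h0]
    rw [h0, lie_smul, h.lie_z, smul_zero]
  have hl1m : ∀ a ∈ 𝔪, l1 a = l a := by
    intro a ha
    have : expAd (s • x) a - a ∈ 𝔪.toSubmodule ⊓ LinearMap.ker l :=
      expAd_sub_mem ⟨𝔪.lie_mem hsx ha, hm.isotropic _ hsx _ ha⟩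
        fun w hw => ⟨𝔪.lie_mem hsx hw.1, hm.isotropic _ hsx _ hw.1⟩
    have h0 : l (expAd (s • x) a - a) = 0 := this.2
    rw [map_sub, sub_eq_zero] at h0
    exact h0
  have hl1y : l1 y = l' y := by
    rw [hl1, LinearMap.comp_apply, hey, map_add, map_smul, h.apply_z, smul_eq_mul, hs]; ring
  have hK : KirillovData l1 y z β := ⟨h.lie_y, h.lie_z, by rw [hl1m z hzm, h.apply_z], h.ne_zero⟩
  set S : Submodule ℝ L := 𝔪.toSubmodule ⊓ LinearMap.ker β with hS
  have hSx : ∀ r : ℝ, ∀ a ∈ S, expAd (r • x) a ∈ S := fun r a ha =>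
    expAd_mem ha fun w hw => ⟨𝔪.lie_mem (𝔪.smul_mem _ hx) hw.1, h.beta_lie _ _⟩
  have hlie : ∀ a ∈ S, ∀ b ∈ S, ∀ c d : ℝ, ⁅a + c • y, b + d • y⁆ = ⁅a, b⁆ := by
    intro a ha b hb c d
    have ha : ⁅a, y⁆ = 0 := by rw [h.lie_y, show β a = 0 from ha.2, zero_smul]
    have hb : ⁅y, b⁆ = 0 := by rw [← lie_skew, h.lie_y, show β b = 0 from hb.2, zero_smul, neg_zero]
    simp [ha, hb]
  have hmem : ∀ a, a ∈ S ⊔ Submodule.span ℝ {y} ↔ ∃ b ∈ S, ∃ c : ℝ, a = b + c • y := by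
    intro a
    rw [Submodule.mem_sup]
    constructor
    · rintro ⟨b, hb, e, he, rfl⟩
      obtain ⟨c, rfl⟩ := Submodule.mem_span_singleton.1 he
      exact ⟨b, hb, c, rfl⟩
    · rintro ⟨b, hb, c, rfl⟩
      exact ⟨b, hb, _, Submodule.smul_mem _ _ (Submodule.mem_span_singleton_self y), rfl⟩
  set 𝔪' : LieSubalgebra ℝ L :=
    { S ⊔ Submodule.span ℝ {y} with
      lie_mem' := by
        intro a b ha hb
        obtain ⟨a, ha', c, rfl⟩ := (hmem _).1 ha
        obtain ⟨b, hb', d, rfl⟩ := (hmem _).1 hb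
        rw [hlie a ha' b hb']
        exact (hmem _).2 ⟨_, ⟨𝔪.lie_mem ha'.1 hb'.1, h.beta_lie _ _⟩, 0, by simp⟩ } with hm'
  have hmem' : ∀ a, a ∈ 𝔪' ↔ ∃ b ∈ S, ∃ c : ℝ, a = b + c • y := hmem
  have hL : IsLagrangian l1 𝔪' := by
    refine ⟨fun a ha b hb => ?_, fun v hv => ?_⟩
    · obtain ⟨a, ha', c, rfl⟩ := (hmem' _).1 ha
      obtain ⟨b, hb', d, rfl⟩ := (hmem' _).1 hb
      rw [hlie a ha' b hb', hl1m _ (𝔪.lie_mem ha'.1 hb'.1), hm.isotropic a ha'.1 b hb'.1]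
    · have hβv : β v = 0 := by
        have := hv y ((hmem' _).2 ⟨0, S.zero_mem, 1, by simp⟩)
        rw [← lie_skew, map_neg, neg_eq_zero, ← hK.beta_eq] at this
        exact this
      set v' := expAd (s • x) v with hv'
      have hβv' : β v' = 0 := by
        have : v' - v ∈ LinearMap.ker β := expAd_sub_mem (h.beta_lie _ _) fun w _ => h.beta_lie _ _
        have h0 : β (v' - v) = 0 := this
        rwa [map_sub, hβv, sub_zero] at h0
      have h1 : ∀ a ∈ S, l ⁅a, v'⁆ = 0 := by
        intro a ha
        have h2 := hv (expAd (-(s • x)) a)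
          ((hmem' _).2 ⟨_, (neg_smul s x) ▸ hSx (-s) a ha, 0, by simp⟩)
        rw [hl1, LinearMap.comp_apply, expAd_lie] at h2
        have h3 := expAd_neg_expAd (-(s • x)) a
        rw [neg_neg] at h3
        rwa [h3] at h2
      -- As l[x, y] = 1 and l[a, y] = 0 for a in `S`, subtracting cy makes v' orthogonal to x
      -- without losing orthogonality to `S`. Since 𝔪 = S + ℝx, the difference lies in 𝔪.
      set c := l ⁅x, v'⁆ with hc
      have h2 : v' - c • y ∈ 𝔪 := by
        refine hm.mem _ fun a ha => ?_
        have h3 := h1 (a - β a • x) ⟨𝔪.sub_mem ha (𝔪.smul_mem _ hx), by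
          simp [hx1]⟩
        rw [sub_lie, map_sub, smul_lie, map_smul, ← hc] at h3
        rw [lie_sub, map_sub, lie_smul, map_smul, ← h.beta_eq]
        simp only [smul_eq_mul] at h3 ⊢
        linarith
      have h3 : expAd (-(s • x)) (v' - c • y) ∈ S := by
        rw [← neg_smul]
        exact hSx _ _ ⟨h2, by simp [hβv', h.beta_y]⟩
      have h4 : expAd (-(s • x)) y = y - s • z := by
        have h5 := expAd_neg_expAd (s • x) y
        rw [hey, map_add, map_smul, expAd_of_lie_eq_zero (h.lie_z _)] at h5
        exact eq_sub_of_add_eq h5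
      rw [map_sub, hv', expAd_neg_expAd, map_smul, h4] at h3
      refine (hmem' _).2 ⟨_, S.sub_mem h3 (S.smul_mem (c * s) (⟨hzm, h.beta_z⟩ : z ∈ S)), c, ?_⟩
      rw [smul_sub, smul_smul]
      abel
  have hle' : 𝔪' ≤ centralizerOf y := by
    intro a ha
    obtain ⟨a, ha', c, rfl⟩ := (hmem' _).1 ha
    refine h.mem_centralizer_iff.2 ?_
    rw [map_add, map_smul, h.beta_y, show β a = 0 from ha'.2]; simp
  have hfin : CoadjRel l1 l' := hK.coadjRel_of_le hL hle' (fun a ha => by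
    obtain ⟨a, ha', c, rfl⟩ := (hmem' _).1 ha
    rw [map_add, map_smul, map_add, map_smul, hl1y, hl a ha'.1, hl1m a ha'.1]) ih
  exact Relation.ReflTransGen.head ⟨s • x, rfl⟩ hfin

end KirillovData

/-- The central elements in the kernel of a functional form an ideal. -/
def centralKer (l : Module.Dual ℝ L) : LieIdeal ℝ L where
  __ := (LieAlgebra.center ℝ L).toSubmodule ⊓ LinearMap.ker l
  lie_mem {x m} hm := by
    have : ⁅x, m⁆ = 0 := (LieModule.mem_maxTrivSubmodule ℝ L L m).1 hm.1 x
    rw [this]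
    exact Submodule.zero_mem _

lemma mem_centralKer {l : Module.Dual ℝ L} {z : L} :
    z ∈ centralKer l ↔ (∀ w : L, ⁅w, z⁆ = 0) ∧ l z = 0 :=
  and_congr (LieModule.mem_maxTrivSubmodule ℝ L L z) Iff.rfl

/-- A Lagrangian subalgebra contains all central elements. Hence both functionals vanish on the
central part of ker l, and the whole situation descends to the quotient by it. -/
lemma coadjRel_of_quotient {l l' : Module.Dual ℝ L} {𝔪 : LieSubalgebra ℝ L}
    (hm : IsLagrangian l 𝔪) (hl : ∀ x ∈ 𝔪, l' x = l x)
    (ih : ∀ (_ : LieRing.IsNilpotent (L ⧸ centralKer l)), OrbitProperty (L ⧸ centralKer l)) :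
    CoadjRel l l' := by
  set I := centralKer l with hI
  set p : L →ₗ⁅ℝ⁆ L ⧸ I :=
    { LieSubmodule.Quotient.mk' I with map_lie' := fun {a b} => LieSubmodule.Quotient.mk_bracket I a b } with hp
  have hsurj : Function.Surjective p := LieSubmodule.Quotient.surjective_mk' I
  have : LieRing.IsNilpotent (L ⧸ I) := Function.Surjective.lieAlgebra_isNilpotent hsurj
  have hle : I.toSubmodule ≤ LinearMap.ker l := fun a ha => (mem_centralKer.1 ha).2
  have hIm : ∀ a ∈ I, a ∈ 𝔪 := fun a ha => hm.mem a fun w _ => by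
    rw [(mem_centralKer.1 ha).1, map_zero]
  have hle' : I.toSubmodule ≤ LinearMap.ker l' := fun a ha => (hl a (hIm a ha)).trans (hle ha)
  set lb : Module.Dual ℝ (L ⧸ I) := I.toSubmodule.liftQ l hle with hlb
  set lb' : Module.Dual ℝ (L ⧸ I) := I.toSubmodule.liftQ l' hle' with hlb'
  have h1 : ∀ a, lb (p a) = l a := fun a => rfl
  have h2 : ∀ a, lb' (p a) = l' a := fun a => rfl
  have h3 : CoadjRel lb lb' := by
    refine ih this lb lb' (𝔪.map p) ⟨?_, ?_⟩ ?_
    · rintro _ ⟨a, ha, rfl⟩ _ ⟨b, hb, rfl⟩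
      exact hm.isotropic a ha b hb
    · intro b hb
      obtain ⟨b, rfl⟩ := hsurj b
      exact ⟨b, hm.mem b fun a ha => hb (p a) ⟨a, ha, rfl⟩, rfl⟩
    · rintro _ ⟨a, ha, rfl⟩
      exact hl a ha
  exact h3.comp_of_surjective hsurj

/-- In a nonabelian nilpotent Lie algebra the second centre is larger than the centre. -/
lemma exists_second_center (h : ∃ a b : L, ⁅a, b⁆ ≠ 0) :
    ∃ y : L, (∃ w : L, ⁅w, y⁆ ≠ 0) ∧ ∀ v w : L, ⁅v, ⁅w, y⁆⁆ = 0 := by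
  classical
  -- The element sought is a noncentral one from the last noncentral term of the lower central
  -- series. Its brackets lie in the next term, which is central.
  have hex : ∃ k, ∀ y ∈ lcs L k, ∀ w : L, ⁅w, y⁆ = 0 :=
    ⟨_, fun y hy w => by
      rw [lcs_finrank_eq_bot, Submodule.mem_bot] at hy
      rw [hy, lie_zero]⟩
  have hk := Nat.find_spec hex
  obtain ⟨k, hk1⟩ : ∃ k, Nat.find hex = k + 1 := by
    refine Nat.exists_eq_succ_of_ne_zero fun h0 => ?_
    rw [h0, lcs_zero] at hk
    obtain ⟨a, b, hab⟩ := h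
    exact hab (hk b trivial a)
  have := Nat.find_min hex (m := k) (by omega)
  push Not at this
  obtain ⟨y, hy, w, hw⟩ := this
  exact ⟨y, ⟨w, hw⟩, fun v w => hk _ (by rw [hk1]; exact lie_mem_lcs w hy) v⟩

/-- Induction on the dimension as in Kirillov's lemma. If some nonzero central element is killed by
`l`, the quotient is smaller. Otherwise `l` is injective on the centre, a noncentral y in the second
centre satisfies [v, y] = β(v)z, and the centralizer of y is smaller. -/
theorem orbitProperty (d : ℕ) : ∀ (L : Type u) [LieRing L] [LieAlgebra ℝ L]
    [FiniteDimensional ℝ L] [LieRing.IsNilpotent L], Module.finrank ℝ L = d → OrbitProperty L := by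
  induction d using Nat.strong_induction_on with
  | _ d ih =>
  intro L _ _ _ _ hd l l' 𝔪 hm hl
  by_cases hab : ∃ a b : L, ⁅a, b⁆ ≠ 0
  swap
  · push Not at hab
    have : l' = l := LinearMap.ext fun a => hl a (hm.mem a fun b _ => by rw [hab, map_zero])
    rw [this]; exact Relation.ReflTransGen.refl
  by_cases hI : centralKer l = ⊥
  swap
  · refine coadjRel_of_quotient hm hl fun _ => ih _ ?_ _ rfl
    rw [← hd]
    have h1 := (centralKer l).toSubmodule.finrank_quotient_add_finrank
    have h2 : Module.finrank ℝ (centralKer l).toSubmodule ≠ 0 := fun h0 =>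
      hI (by simpa using Submodule.finrank_eq_zero.1 h0)
    change Module.finrank ℝ (L ⧸ (centralKer l).toSubmodule) < _
    omega
  · obtain ⟨y, ⟨w, hw⟩, hy⟩ := exists_second_center hab
    have h0 : ∀ z : L, (∀ v : L, ⁅v, z⁆ = 0) → l z = 0 → z = 0 := fun z h1 h2 => by
      have : z ∈ centralKer l := mem_centralKer.2 ⟨h1, h2⟩
      rwa [hI, LieSubmodule.mem_bot] at this
    have hlz : l ⁅w, y⁆ ≠ 0 := fun h1 => hw (h0 _ (fun v => hy v w) h1)
    have hK : KirillovData l y ((l ⁅w, y⁆)⁻¹ • ⁅w, y⁆)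
        (-(l ∘ₗ (LieAlgebra.ad ℝ L y : Module.End ℝ L))) := by
      have hβ : ∀ v, (-(l ∘ₗ (LieAlgebra.ad ℝ L y : Module.End ℝ L))) v = l ⁅v, y⁆ := fun v => by
        rw [LinearMap.neg_apply, LinearMap.comp_apply, LieAlgebra.ad_apply, ← lie_skew, map_neg,
          neg_neg]
      refine ⟨fun v => ?_, fun v => by rw [lie_smul, hy, smul_zero], ?_, fun h1 => hlz ?_⟩
      · rw [hβ, smul_smul, ← sub_eq_zero]
        refine h0 _ (fun u => ?_) ?_
        · rw [lie_sub, lie_smul, hy, hy, smul_zero, sub_zero]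
        · rw [map_sub, map_smul, smul_eq_mul, mul_assoc, inv_mul_cancel₀ hlz, mul_one, sub_self]
      · rw [map_smul, smul_eq_mul, inv_mul_cancel₀ hlz]
      · rw [← hβ, h1]; rfl
    have ih' := ih _ (by rw [← hd]; exact hK.finrank_lt) (centralizerOf y) rfl
    by_cases hle : 𝔪 ≤ centralizerOf y
    · exact hK.coadjRel_of_le hm hle hl ih'
    · exact hK.coadjRel_of_not_le hm hle hl ih'

end Pukanszky

/-! ### Coadjoint orbits and polarizations -/

section Orbits

variable {𝔤 : Type u} [MetricLieAlgebra 𝔤] [FiniteDimensional ℝ 𝔤] [LieRing.IsNilpotent 𝔤]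

/-- Adjoining a vector orthogonal to an isotropic subspace leaves it isotropic, so a maximal one
already contains its orthogonal. -/
lemma IsPolarizing.isLagrangian {l : StrongDual ℝ 𝔤} {𝔪 : LieSubalgebra ℝ 𝔤}
    (h : IsPolarizing l 𝔪) : IsLagrangian (l : 𝔤 →ₗ[ℝ] ℝ) 𝔪 := by
  refine ⟨fun x hx y hy => h.prop x hx y hy, fun y hy => ?_⟩
  have hy' : ∀ x ∈ 𝔪, l ⁅x, y⁆ = 0 := hy
  have hiso : IsIsotropic l (𝔪.toSubmodule ⊔ Submodule.span ℝ {y}) := by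
    intro a ha b hb
    obtain ⟨a, ha', e, he, rfl⟩ := Submodule.mem_sup.1 ha
    obtain ⟨c, rfl⟩ := Submodule.mem_span_singleton.1 he
    obtain ⟨b, hb', e, he, rfl⟩ := Submodule.mem_sup.1 hb
    obtain ⟨d, rfl⟩ := Submodule.mem_span_singleton.1 he
    have h1 : l ⁅y, b⁆ = 0 := by rw [← lie_skew, map_neg, hy' b hb', neg_zero]
    have h2 : l ⁅a, b⁆ = 0 := h.prop a ha' b hb'
    simp [hy' a ha', h1, h2]
  exact h.le_of_ge hiso le_sup_left
    (Submodule.mem_sup_right (Submodule.mem_span_singleton_self y))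

lemma Ad_eq_expAd (X : 𝔤) : Ad X = expAd X := Ad_eq_rexp X

lemma CoadjRel.exists_Ad {l l' : Module.Dual ℝ 𝔤} (h : CoadjRel l l') :
    ∃ W : 𝔤, ∀ Y, l' Y = l (Ad W Y) := by
  induction h with
  | refl => exact ⟨0, fun Y => by rw [Ad_eq_expAd, expAd_of_lie_eq_zero (zero_lie Y)]⟩
  | tail _ hs ih =>
    obtain ⟨x, rfl⟩ := hs
    obtain ⟨W, hW⟩ := ih
    exact ⟨bch W x, fun Y => by
      rw [LinearMap.comp_apply, hW, Ad_bch, Module.End.mul_apply, Ad_eq_expAd x]⟩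

/-- A functional `l'` with `l' = l ∘ Ad g` on `Ad (g⁻¹) 𝔪`, for `𝔪` polarizing, is in the orbit of `l`. -/
lemma mem_coadjointOrbit {l l' : StrongDual ℝ 𝔤} {𝔪 : LieSubalgebra ℝ 𝔤} (h : IsPolarizing l 𝔪)
    (g : 𝔤) (hl : ∀ x ∈ 𝔪, l' (Ad (-g) x) = l x) : l' ∈ coadjointOrbit l := by
  obtain ⟨W, hW⟩ := (orbitProperty _ 𝔤 rfl (l : 𝔤 →ₗ[ℝ] ℝ) ((l' : 𝔤 →ₗ[ℝ] ℝ) ∘ₗ Ad (-g)) 𝔪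
    h.isLagrangian hl).exists_Ad
  refine ⟨-(bch W g), fun Y => ?_⟩
  have h1 := hW (Ad g Y)
  rw [LinearMap.comp_apply, Ad_neg_Ad] at h1
  rw [neg_neg, Ad_bch]
  exact h1

end Orbits

/-! ### The invariant measure on `M \ G` -/

section Subalgebras

variable {L : Type*} [LieRing L] [LieAlgebra ℝ L]

lemma nest_mem (A : LieSubalgebra ℝ L) {w : List L} (hw : ∀ a ∈ w, a ∈ A) : nest w ∈ A := by
  induction w with
  | nil => exact A.zero_mem
  | cons a w ih =>
    by_cases h : w = []
    · subst h; exact hw a (by simp)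
    · rw [nest_cons a h]
      exact A.lie_mem (hw a (by simp)) (ih fun b hb => hw b (by simp [hb]))

/-- All three brackets of a word with at least two letters lie in `K`. For a single letter the
difference cancels. -/
lemma nest_dynkinWord_sub_mem {A : LieSubalgebra ℝ L} {K : Submodule ℝ L}
    (hK : ∀ a ∈ A, ∀ b ∈ A, ⁅a, b⁆ ∈ K) {x y : L} (hx : x ∈ A) (hy : y ∈ A) {m : ℕ}
    (r s : Fin m → ℕ) :
    nest (dynkinWord x y r s) - (nest (dynkinWord x 0 r s) + nest (dynkinWord 0 y r s)) ∈ K := by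
  have key : ∀ (w : List (Fin 2)), nest (w.map ![x, y]) -
      (nest (w.map ![x, 0]) + nest (w.map ![0, y])) ∈ K := by
    intro w
    have h2 : ∀ (f : Fin 2 → L), (∀ i, f i ∈ A) → ∀ a b v, nest ((a :: b :: v).map f) ∈ K :=
      fun f hf a b v => hK _ (hf a) _ (nest_mem A (w := (b :: v).map f) (by
        intro c hc
        obtain ⟨d, -, rfl⟩ := List.mem_map.1 hc
        exact hf d))
    match w with
    | [] => simp [nest]
    | [a] => fin_cases a <;> simp [nest]
    | a :: b :: v =>
      refine K.sub_mem (h2 _ ?_ a b v) (K.add_mem (h2 _ ?_ a b v) (h2 _ ?_ a b v)) <;>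
      · intro i; fin_cases i <;> simp [hx, hy]
  have := key (dynkinWord 0 1 r s)
  simpa only [map_dynkinWord, Matrix.cons_val_zero, Matrix.cons_val_one] using this

lemma dynkin_sub_mem {A : LieSubalgebra ℝ L} {K : Submodule ℝ L}
    (hK : ∀ a ∈ A, ∀ b ∈ A, ⁅a, b⁆ ∈ K) {x y : L} (hx : x ∈ A) (hy : y ∈ A) (d : ℕ) :
    dynkin d x y - (dynkin d x 0 + dynkin d 0 y) ∈ K := by
  simp only [dynkin]
  rw [← Finset.sum_add_distrib, ← Finset.sum_sub_distrib]
  refine K.sum_mem fun m _ => ?_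
  rw [← smul_add, ← smul_sub, ← Finset.sum_add_distrib, ← Finset.sum_sub_distrib]
  refine K.smul_mem _ (K.sum_mem fun q _ => ?_)
  split_ifs
  · rw [← smul_add, ← smul_sub]
    exact K.smul_mem _ (nest_dynkinWord_sub_mem hK hx hy _ _)
  · simp

/-- A subalgebra of codimension one of a nilpotent Lie algebra is an ideal. -/
lemma lie_mem_of_codim_one [FiniteDimensional ℝ L] [LieRing.IsNilpotent L]
    {A B : LieSubalgebra ℝ L} {e : L}
    (hB : B.toSubmodule = A.toSubmodule ⊔ Submodule.span ℝ {e}) :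
    ∀ a ∈ B, ∀ b ∈ B, ⁅a, b⁆ ∈ A := by
  have hmem : ∀ b, b ∈ B ↔ ∃ a ∈ A, ∃ c : ℝ, b = a + c • e := by
    intro b
    rw [← LieSubalgebra.mem_toSubmodule, hB, Submodule.mem_sup]
    constructor
    · rintro ⟨a, ha, f, hf, rfl⟩
      obtain ⟨c, rfl⟩ := Submodule.mem_span_singleton.1 hf
      exact ⟨a, ha, c, rfl⟩
    · rintro ⟨a, ha, c, rfl⟩
      exact ⟨a, ha, _, Submodule.smul_mem _ _ (Submodule.mem_span_singleton_self e), rfl⟩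
  by_cases he : e ∈ A
  · intro a ha b hb
    obtain ⟨a, ha', c, rfl⟩ := (hmem a).1 ha
    obtain ⟨b, hb', d, rfl⟩ := (hmem b).1 hb
    exact A.lie_mem (A.add_mem ha' (A.smul_mem _ he)) (A.add_mem hb' (A.smul_mem _ he))
  have heB : e ∈ B := (hmem e).2 ⟨0, A.zero_mem, 1, by simp⟩
  have h1 : ∀ a ∈ A, ⁅a, e⁆ ∈ A := by
    intro a ha
    obtain ⟨a', ha', c, hc⟩ := (hmem _).1 (B.lie_mem ((hmem a).2 ⟨a, ha, 0, by simp⟩) heB)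
    -- Here ad a acts on the line B/A by the scalar c. Nilpotency of ad a forces c = 0.
    have h2 : ∀ k : ℕ, ((LieAlgebra.ad ℝ L a : Module.End ℝ L) ^ k) e - c ^ k • e ∈ A := by
      intro k
      induction k with
      | zero => simp
      | succ k ih =>
        have h3 := A.add_mem (A.lie_mem ha ih) (A.smul_mem (c ^ k) ha')
        rw [lie_sub, lie_smul, hc] at h3
        rw [pow_succ' (LieAlgebra.ad ℝ L a : Module.End ℝ L), Module.End.mul_apply,
          LieAlgebra.ad_apply, pow_succ, mul_smul]
        convert h3 using 1
        rw [smul_add]; abel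
    have h3 := h2 (Module.finrank ℝ L)
    rw [ad_pow_eq_zero a le_rfl, LinearMap.zero_apply, zero_sub] at h3
    have hc0 : c = 0 := by
      by_contra hc0
      have h4 := A.smul_mem (-(c ^ Module.finrank ℝ L)⁻¹) h3
      rw [smul_neg, neg_smul, neg_neg, smul_smul, inv_mul_cancel₀ (pow_ne_zero _ hc0),
        one_smul] at h4
      exact he h4
    rw [hc, hc0, zero_smul, add_zero]
    exact ha'
  intro a ha b hb
  obtain ⟨a, ha', c, rfl⟩ := (hmem a).1 ha
  obtain ⟨b, hb', d, rfl⟩ := (hmem b).1 hb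
  have h3 : ⁅e, b⁆ ∈ A := by
    rw [← lie_skew]; exact A.neg_mem (h1 b hb')
  simp only [add_lie, lie_add, smul_lie, lie_smul, lie_self, smul_zero, add_zero]
  exact A.add_mem (A.add_mem (A.lie_mem ha' hb') (A.smul_mem _ h3)) (A.smul_mem _ (h1 a ha'))

end Subalgebras

/-! ### Right invariance in Malcev coordinates. -/

section Measure

variable {𝔤 : Type u} [MetricLieAlgebra 𝔤] [FiniteDimensional ℝ 𝔤] [LieRing.IsNilpotent 𝔤]

lemma bch_sub_mem {A : LieSubalgebra ℝ 𝔤} {K : Submodule ℝ 𝔤}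
    (hK : ∀ a ∈ A, ∀ b ∈ A, ⁅a, b⁆ ∈ K) {x y : 𝔤} (hx : x ∈ A) (hy : y ∈ A) :
    bch x y - (x + y) ∈ K := by
  have := dynkin_sub_mem hK hx hy (Module.finrank ℝ 𝔤)
  rwa [← bch_eq_dynkin, ← bch_eq_dynkin, ← bch_eq_dynkin, bch_zero, zero_bch] at this

lemma cosetRep_snoc {k : ℕ} (X : Fin (k + 1) → 𝔤) (t : Fin k → ℝ) (r : ℝ) :
    cosetRep X (Fin.snoc (α := fun _ => ℝ) t r) =
      bch (cosetRep (fun i => X i.castSucc) t) (r • X (Fin.last k)) := by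
  rw [cosetRep, List.ofFn_succ', List.concat_eq_append, List.foldl_append]
  simp [cosetRep]

lemma cosetRep_succ {k : ℕ} (X : Fin (k + 1) → 𝔤) (t : Fin (k + 1) → ℝ) :
    cosetRep X t =
      bch (cosetRep (fun i => X i.castSucc) fun i => t i.castSucc) (t (Fin.last k) • X (Fin.last k)) := by
  rw [cosetRep, List.ofFn_succ', List.concat_eq_append, List.foldl_append]
  rfl

lemma _root_.Continuous.bch {E : Type*} [TopologicalSpace E] {f g : E → 𝔤} (hf : Continuous f)
    (hg : Continuous g) : Continuous fun x => NilpotentOrbit.bch (f x) (g x) :=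
  Continuous.comp (g := fun p : 𝔤 × 𝔤 => NilpotentOrbit.bch p.1 p.2) (f := fun x => (f x, g x))
    continuous_bch (hf.prodMk hg)

lemma continuous_cosetRep {k : ℕ} (X : Fin k → 𝔤) : Continuous (cosetRep X) := by
  induction k with
  | zero => exact continuous_of_const fun t s => by rw [Subsingleton.elim t s]
  | succ k ih =>
    have h : cosetRep X = fun t => bch (cosetRep (fun i => X i.castSucc) fun i => t i.castSucc)
        (t (Fin.last k) • X (Fin.last k)) := funext fun t => cosetRep_succ X t
    rw [h]
    have h1 : Continuous fun (t : Fin (k + 1) → ℝ) (i : Fin k) => t i.castSucc :=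
      continuous_pi fun i => continuous_apply _
    have h2 : Continuous fun t : Fin (k + 1) → ℝ => t (Fin.last k) • X (Fin.last k) :=
      (continuous_apply _).smul continuous_const
    have h3 : Continuous fun t : Fin (k + 1) → ℝ =>
        cosetRep (fun i => X i.castSucc) fun i => t i.castSucc := (ih fun i => X i.castSucc).comp h1
    exact h3.bch h2

lemma lintegral_fin_succ {k : ℕ} {F : (Fin (k + 1) → ℝ) → ENNReal} (hF : Measurable F) :
    ∫⁻ t, F t = ∫⁻ r : ℝ, ∫⁻ t : Fin k → ℝ, F (Fin.snoc (α := fun _ => ℝ) t r) := by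
  have h := (volume_preserving_piFinSuccAbove (fun _ : Fin (k + 1) => ℝ) (Fin.last k)).symm
  rw [← h.lintegral_comp hF, Measure.volume_eq_prod, lintegral_prod
    (fun p => F ((MeasurableEquiv.piFinSuccAbove (fun _ => ℝ) (Fin.last k)).symm p))
    (hF.comp h.measurable).aemeasurable]
  refine lintegral_congr fun r => lintegral_congr fun t => ?_
  congr 1
  exact Fin.insertNth_last' r t

variable [MeasurableSpace 𝔤] [BorelSpace 𝔤]

/-- Right invariance of the Lebesgue measure in the coordinates of a weak Malcev basis. -/
lemma lintegral_cosetRep_bch_aux {𝔪 : LieSubalgebra ℝ 𝔤} {k : ℕ} : ∀ (X : Fin k → 𝔤),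
    (∀ j ≤ k, ∃ 𝔥 : LieSubalgebra ℝ 𝔤,
      𝔥.toSubmodule = 𝔪.toSubmodule ⊔ Submodule.span ℝ (X '' {i | (i : ℕ) < j})) →
    ∀ {Φ : 𝔤 → ENNReal}, Measurable Φ → (∀ m ∈ 𝔪, ∀ g, Φ (bch m g) = Φ g) →
    ∀ x ∈ 𝔪.toSubmodule ⊔ Submodule.span ℝ (Set.range X),
    ∫⁻ t, Φ (bch (cosetRep X t) x) = ∫⁻ t, Φ (cosetRep X t) := by
  induction k with
  | zero =>
    intro X _ Φ _ hinv x hx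
    have hx : x ∈ 𝔪 := by simpa using hx
    refine lintegral_congr fun t => ?_
    have h0 : cosetRep X t = 0 := by simp [cosetRep]
    have := hinv x hx 0
    rw [h0, zero_bch]
    rwa [bch_zero] at this
  | succ k ih =>
    intro X hX Φ hΦ hinv x hx
    set X' : Fin k → 𝔤 := fun i => X i.castSucc with hX'
    set e := X (Fin.last k) with he
    have himg : ∀ j ≤ k, X' '' {i | (i : ℕ) < j} = X '' {i | (i : ℕ) < j} := by
      intro j hj
      ext y
      constructor
      · rintro ⟨i, hi, rfl⟩
        exact ⟨i.castSucc, hi, rfl⟩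
      · rintro ⟨i, hi, rfl⟩
        have hi : (i : ℕ) < j := hi
        exact ⟨⟨i, by omega⟩, hi, rfl⟩
    have hX'c : ∀ j ≤ k, ∃ 𝔥 : LieSubalgebra ℝ 𝔤,
        𝔥.toSubmodule = 𝔪.toSubmodule ⊔ Submodule.span ℝ (X' '' {i | (i : ℕ) < j}) :=
      fun j hj => by rw [himg j hj]; exact hX j (by omega)
    obtain ⟨A, hA⟩ := hX'c k le_rfl
    obtain ⟨B, hB⟩ := hX (k + 1) le_rfl
    have hall : {i : Fin k | (i : ℕ) < k} = Set.univ := Set.eq_univ_of_forall fun i => i.2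
    have hall' : {i : Fin (k + 1) | (i : ℕ) < k + 1} = Set.univ :=
      Set.eq_univ_of_forall fun i => i.2
    rw [hall, Set.image_univ] at hA
    rw [hall', Set.image_univ] at hB
    have hrange : Set.range X = Set.range X' ∪ {e} := by
      ext y
      simp only [Set.mem_range, Set.mem_union, Set.mem_singleton_iff, hX', he]
      constructor
      · rintro ⟨i, rfl⟩
        induction i using Fin.lastCases with
        | last => exact Or.inr rfl
        | cast i => exact Or.inl ⟨i, rfl⟩
      · rintro (⟨i, rfl⟩ | rfl)
        exacts [⟨_, rfl⟩, ⟨_, rfl⟩]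
    have hBA : B.toSubmodule = A.toSubmodule ⊔ Submodule.span ℝ {e} := by
      rw [hA, hB, hrange, Submodule.span_union, sup_assoc]
    have hid := lie_mem_of_codim_one hBA
    have hxB : x ∈ B := by rw [← LieSubalgebra.mem_toSubmodule, hB]; exact hx
    have heB : e ∈ B := by
      rw [← LieSubalgebra.mem_toSubmodule, hBA]
      exact Submodule.mem_sup_right (Submodule.mem_span_singleton_self e)
    have hAB : ∀ a ∈ A, a ∈ B := fun a ha => by
      rw [← LieSubalgebra.mem_toSubmodule, hBA]; exact Submodule.mem_sup_left ha
    obtain ⟨y, hy, s, hxs⟩ : ∃ y ∈ A, ∃ s : ℝ, x = y + s • e := by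
      rw [← LieSubalgebra.mem_toSubmodule, hBA] at hxB
      obtain ⟨a, ha, f, hf, rfl⟩ := Submodule.mem_sup.1 hxB
      obtain ⟨c, rfl⟩ := Submodule.mem_span_singleton.1 hf
      exact ⟨a, ha, c, rfl⟩
    -- The translation by x splits into one by x' in `A` and one along the last basis vector. That
    -- x' lies in `A` follows because the product differs from the sum by an element of [B, B],
    -- which is contained in `A`.
    set x' := bch x (-(s • e)) with hx'
    have hx'A : x' ∈ A := by
      have h1 := bch_sub_mem (K := A.toSubmodule) hid hxB (B.neg_mem (B.smul_mem s heB))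
      have h2 := A.add_mem h1 hy
      rw [hxs] at h2
      rw [hx', hxs]
      convert h2 using 1
      abel
    have hxx' : x = bch x' (s • e) := by rw [hx', neg_bch_cancel_right]
    have hAd : ∀ r : ℝ, Ad (r • e) x' ∈ A := fun r => by
      rw [Ad_eq_expAd]
      exact expAd_mem (S := A.toSubmodule) hx'A fun w hw =>
        hid _ (B.smul_mem r heB) _ (hAB w hw)
    have hc := continuous_cosetRep X
    have hmeas : Measurable fun t => Φ (bch (cosetRep X t) x) :=
      hΦ.comp (hc.bch continuous_const).measurable
    rw [lintegral_fin_succ hmeas, lintegral_fin_succ (F := fun t => Φ (cosetRep X t)) (hΦ.comp hc.measurable)]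
    have hstep : ∀ r : ℝ, ∫⁻ t : Fin k → ℝ,
        Φ (bch (cosetRep X (Fin.snoc (α := fun _ => ℝ) t r)) x) =
        ∫⁻ t : Fin k → ℝ, Φ (bch (cosetRep X' t) ((r + s) • e)) := by
      intro r
      -- Moving x' to the left past exp(re) turns it into Ad(re)x', which is still in `A`. There the
      -- induction hypothesis removes it, applied to the right translate of Φ by exp((r + s)e).
      have h1 : ∀ t : Fin k → ℝ, bch (cosetRep X (Fin.snoc (α := fun _ => ℝ) t r)) x =
          bch (bch (cosetRep X' t) (Ad (r • e) x')) ((r + s) • e) := by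
        intro t
        rw [cosetRep_snoc, hxx', ← bch_smul_smul, ← bch_conj]
        simp only [bch_assoc, neg_bch_cancel_left]
        rfl
      simp only [h1]
      exact ih X' hX'c (Φ := fun g => Φ (bch g ((r + s) • e)))
        (hΦ.comp (continuous_id.bch continuous_const).measurable)
        (fun m hm g => by rw [bch_assoc, hinv m hm]) _ (by
          rw [← hA]; exact hAd r)
    simp only [hstep]
    -- What remains of the translation is the shift of the last coordinate by s.
    rw [lintegral_add_right_eq_self (fun r : ℝ => ∫⁻ t : Fin k → ℝ, Φ (bch (cosetRep X' t) (r • e))) s]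
    refine lintegral_congr fun r => lintegral_congr fun t => ?_
    exact congrArg Φ (cosetRep_snoc X t r).symm

lemma lintegral_cosetRep_bch {𝔪 : LieSubalgebra ℝ 𝔤} {k : ℕ} {X : Fin k → 𝔤}
    (hX : IsMalcevBasisMod 𝔪 X) {Φ : 𝔤 → ENNReal} (hΦ : Measurable Φ)
    (hinv : ∀ m ∈ 𝔪, ∀ g, Φ (bch m g) = Φ g) (x : 𝔤) :
    ∫⁻ t, Φ (bch (cosetRep X t) x) = ∫⁻ t, Φ (cosetRep X t) :=
  lintegral_cosetRep_bch_aux X hX.2.2 hΦ hinv x (by rw [hX.2.1]; trivial)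

end Measure

/-! ### Sobolev norms of test functions -/

section Sobolev

variable {E : Type*} [NormedAddCommGroup E] [InnerProductSpace ℝ E] [FiniteDimensional ℝ E]
  [MeasurableSpace E] [BorelSpace E]

/-- `∫ ‖F‖ ≤ 3 r ∫ ‖DF‖` for functions supported in a ball of radius `r`. -/
lemma integral_norm_le_of_support [Nontrivial E] {G : Type*} [NormedAddCommGroup G]
    [NormedSpace ℝ G] [CompleteSpace G] {F : E → G} (hF : ContDiff ℝ 1 F) {r : ℝ} (hr : 0 < r)
    (hsupp : ∀ x ∉ Metric.closedBall (0 : E) r, F x = 0) :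
    ∫ x, ‖F x‖ ≤ 3 * r * ∫ x, ‖fderiv ℝ F x‖ := by
  obtain ⟨v, hv⟩ := exists_norm_eq E zero_le_one
  have hcF : Continuous F := hF.continuous
  have hcD : Continuous (fderiv ℝ F) := hF.continuous_fderiv one_ne_zero
  have hcs : HasCompactSupport F :=
    HasCompactSupport.of_support_subset_isCompact (isCompact_closedBall (0 : E) r)
      fun x hx => by_contra fun h => hx (hsupp x h)
  have hline : ∀ x : E, Continuous fun s : ℝ => x + s • v := fun x => by fun_prop
  have h1 : ∀ x, ‖F x‖ₑ ≤ ∫⁻ s in Set.Ioc 0 (3 * r), ‖fderiv ℝ F (x + s • v)‖ₑ := by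
    intro x
    by_cases hx : x ∈ Metric.closedBall (0 : E) r
    swap
    · rw [hsupp x hx, enorm_zero]; exact zero_le
    -- From a point of norm at most r, a step of length 3r along a unit vector ends at norm at least
    -- 2r, outside the support. So F(x) is minus an integral of its derivative along the segment.
    have hx' : F (x + (3 * r) • v) = 0 := by
      refine hsupp _ fun h => ?_
      rw [mem_closedBall_zero_iff] at h hx
      have h2 : ‖(3 * r) • v‖ = 3 * r := by
        rw [norm_smul, hv, mul_one, Real.norm_of_nonneg (by positivity)]
      have h3 : ‖(3 * r) • v‖ ≤ ‖x + (3 * r) • v‖ + ‖x‖ := by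
        simpa using norm_sub_le (x + (3 * r) • v) x
      linarith
    have hd : ∀ s ∈ Set.uIcc 0 (3 * r),
        HasDerivAt (fun s : ℝ => F (x + s • v)) (fderiv ℝ F (x + s • v) v) s := fun s _ => by
      have h2 : HasDerivAt (fun s : ℝ => x + s • v) v s := by
        simpa using ((hasDerivAt_id s).smul_const v).const_add x
      exact ((hF.differentiable one_ne_zero) (x + s • v)).hasFDerivAt.comp_hasDerivAt s h2
    have hcont : Continuous fun s : ℝ => fderiv ℝ F (x + s • v) v :=
      (hcD.comp (hline x)).clm_apply continuous_const
    have h2 := intervalIntegral.integral_eq_sub_of_hasDerivAt hd (hcont.intervalIntegrable _ _)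
    rw [hx', zero_smul, add_zero, zero_sub,
      intervalIntegral.integral_of_le (by positivity)] at h2
    rw [← enorm_neg, ← h2]
    refine (enorm_integral_le_lintegral_enorm _).trans (lintegral_mono fun s => ?_)
    rw [← ofReal_norm, ← ofReal_norm]
    refine ENNReal.ofReal_le_ofReal ?_
    simpa [hv] using (fderiv ℝ F (x + s • v)).le_opNorm v
  have h2 : ∫⁻ x, ‖F x‖ₑ ≤ ENNReal.ofReal (3 * r) * ∫⁻ x, ‖fderiv ℝ F x‖ₑ := by
    calc ∫⁻ x, ‖F x‖ₑ ≤ ∫⁻ x, ∫⁻ s in Set.Ioc 0 (3 * r), ‖fderiv ℝ F (x + s • v)‖ₑ :=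
          lintegral_mono h1
      _ = ∫⁻ s in Set.Ioc 0 (3 * r), ∫⁻ x, ‖fderiv ℝ F (x + s • v)‖ₑ := by
          refine lintegral_lintegral_swap (Continuous.aemeasurable ?_)
          exact (hcD.comp (by fun_prop : Continuous fun p : E × ℝ => p.1 + p.2 • v)).enorm
      _ = ∫⁻ s in Set.Ioc 0 (3 * r), ∫⁻ x, ‖fderiv ℝ F x‖ₑ := by
          refine lintegral_congr fun s => ?_
          exact lintegral_add_right_eq_self (fun x => ‖fderiv ℝ F x‖ₑ) (s • v)
      _ = _ := by rw [lintegral_const]; simp [mul_comm]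
  have hint : Integrable (fderiv ℝ F) :=
    hcD.integrable_of_hasCompactSupport (hcs.fderiv (𝕜 := ℝ))
  rw [integral_norm_eq_lintegral_enorm hcF.aestronglyMeasurable,
    integral_norm_eq_lintegral_enorm hcD.aestronglyMeasurable]
  have h3 := ENNReal.toReal_mono (ENNReal.mul_ne_top ENNReal.ofReal_ne_top hint.2.ne) h2
  rwa [ENNReal.toReal_mul, ENNReal.toReal_ofReal (by positivity)] at h3

/-- Smooth functions supported in the closed ball of radius `r` around zero. -/
structure IsTest (r : ℝ) (φ : E → ℂ) : Prop where
  contDiff : ContDiff ℝ ∞ φ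
  tsupport_subset : tsupport φ ⊆ Metric.closedBall 0 r

namespace IsTest

variable {r : ℝ} {φ ψ : E → ℂ}

lemma hasCompactSupport (h : IsTest r φ) : HasCompactSupport φ :=
  (isCompact_closedBall (0 : E) r).of_isClosed_subset (isClosed_tsupport φ) h.tsupport_subset

lemma mono (h : IsTest r φ) {r' : ℝ} (hr : r ≤ r') : IsTest r' φ :=
  ⟨h.contDiff, h.tsupport_subset.trans (Metric.closedBall_subset_closedBall hr)⟩

lemma of_support (hφ : ContDiff ℝ ∞ φ) (hs : ∀ x ∉ Metric.closedBall (0 : E) r, φ x = 0) :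
    IsTest r φ :=
  ⟨hφ, closure_minimal (fun _ hx => by_contra fun h => hx (hs _ h)) Metric.isClosed_closedBall⟩

lemma eq_zero (h : IsTest r φ) {x : E} (hx : x ∉ Metric.closedBall (0 : E) r) : φ x = 0 :=
  image_eq_zero_of_notMem_tsupport fun h' => hx (h.tsupport_subset h')

lemma iteratedFDeriv_eq_zero (h : IsTest r φ) (i : ℕ) {x : E}
    (hx : x ∉ Metric.closedBall (0 : E) r) : iteratedFDeriv ℝ i φ x = 0 := by
  by_contra h'
  exact hx (h.tsupport_subset (support_iteratedFDeriv_subset i h'))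

lemma fderiv_eq_zero (h : IsTest r φ) {x : E}
    (hx : x ∉ Metric.closedBall (0 : E) r) : fderiv ℝ φ x = 0 := by
  by_contra h'
  exact hx (h.tsupport_subset (support_fderiv_subset ℝ h'))

lemma continuous_iteratedFDeriv (h : IsTest r φ) (i : ℕ) :
    Continuous fun x => iteratedFDeriv ℝ i φ x :=
  h.contDiff.continuous_iteratedFDeriv (by exact_mod_cast le_top)

lemma integrable_iteratedFDeriv (h : IsTest r φ) (i : ℕ) :
    Integrable fun x => iteratedFDeriv ℝ i φ x :=
  (h.continuous_iteratedFDeriv i).integrable_of_hasCompactSupport (h.hasCompactSupport.iteratedFDeriv i)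

lemma integrable (h : IsTest r φ) : Integrable φ :=
  h.contDiff.continuous.integrable_of_hasCompactSupport h.hasCompactSupport

lemma add (h : IsTest r φ) (h' : IsTest r ψ) : IsTest r fun x => φ x + ψ x :=
  of_support (h.contDiff.add h'.contDiff) fun x hx => by rw [h.eq_zero hx, h'.eq_zero hx, add_zero]

lemma sum {ι : Type*} {s : Finset ι} {f : ι → E → ℂ} (h : ∀ i ∈ s, IsTest r (f i)) :
    IsTest r fun x => ∑ i ∈ s, f i x :=
  of_support (ContDiff.sum fun i hi => (h i hi).contDiff) fun _ hx =>
    Finset.sum_eq_zero fun i hi => (h i hi).eq_zero hx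

lemma smul (h : IsTest r φ) {a : E → ℝ} (ha : ContDiff ℝ ∞ a) : IsTest r fun x => a x • φ x :=
  of_support (ha.smul h.contDiff) fun x hx => by rw [h.eq_zero hx, smul_zero]

lemma const_mul (h : IsTest r φ) (c : ℂ) : IsTest r fun x => c * φ x :=
  of_support (contDiff_const.mul h.contDiff) fun x hx => by rw [h.eq_zero hx, mul_zero]

lemma dirDeriv (h : IsTest r φ) (v : E) : IsTest r fun x => fderiv ℝ φ x v :=
  of_support ((h.contDiff.fderiv_right (m := ∞) (by simp)).clm_apply contDiff_const)
    fun x hx => by rw [h.fderiv_eq_zero hx, zero_apply]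

end IsTest

/-- `∑_{i ≤ j} ∫ ‖Dⁱφ‖`. -/
def sobL1 (j : ℕ) (φ : E → ℂ) : ℝ :=
  ∑ i ∈ Finset.range (j + 1), ∫ x, ‖iteratedFDeriv ℝ i φ x‖

lemma sobL1_nonneg (j : ℕ) (φ : E → ℂ) : 0 ≤ sobL1 j φ :=
  Finset.sum_nonneg fun _ _ => integral_nonneg fun _ => norm_nonneg _

lemma integral_iteratedFDeriv_le_sobL1 {i j : ℕ} (hij : i ≤ j) (φ : E → ℂ) :
    ∫ x, ‖iteratedFDeriv ℝ i φ x‖ ≤ sobL1 j φ :=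
  Finset.single_le_sum (f := fun i => ∫ x, ‖iteratedFDeriv ℝ i φ x‖)
    (fun _ _ => integral_nonneg fun _ => norm_nonneg _) (Finset.mem_range.2 (Nat.lt_succ_of_le hij))

lemma sobL1_zero (φ : E → ℂ) : sobL1 0 φ = ∫ x, ‖φ x‖ := by
  simp [sobL1]

lemma sobL1_mono {i j : ℕ} (hij : i ≤ j) (φ : E → ℂ) : sobL1 i φ ≤ sobL1 j φ :=
  Finset.sum_le_sum_of_subset_of_nonneg (Finset.range_mono (Nat.succ_le_succ hij))
    fun _ _ _ => integral_nonneg fun _ => norm_nonneg _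

variable {r : ℝ} {φ ψ : E → ℂ}

lemma sobL1_add (h : IsTest r φ) (h' : IsTest r ψ) (j : ℕ) :
    sobL1 j (fun x => φ x + ψ x) ≤ sobL1 j φ + sobL1 j ψ := by
  rw [sobL1, sobL1, sobL1, ← Finset.sum_add_distrib]
  refine Finset.sum_le_sum fun i _ => ?_
  rw [← integral_add (h.integrable_iteratedFDeriv i).norm (h'.integrable_iteratedFDeriv i).norm]
  refine integral_mono ((h.add h').integrable_iteratedFDeriv i).norm
    ((h.integrable_iteratedFDeriv i).norm.add (h'.integrable_iteratedFDeriv i).norm) fun x => ?_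
  have h1 := iteratedFDeriv_add_apply (𝕜 := ℝ) (x := x) (i := i)
    (h.contDiff.contDiffAt.of_le (by exact_mod_cast le_top))
    (h'.contDiff.contDiffAt.of_le (by exact_mod_cast le_top))
  change ‖iteratedFDeriv ℝ i (φ + ψ) x‖ ≤ _
  rw [h1]
  exact norm_add_le _ _

lemma sobL1_sum {ι : Type*} (s : Finset ι) {f : ι → E → ℂ} (h : ∀ i ∈ s, IsTest r (f i)) (j : ℕ) :
    sobL1 j (fun x => ∑ i ∈ s, f i x) ≤ ∑ i ∈ s, sobL1 j (f i) := by
  classical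
  induction s using Finset.induction_on with
  | empty => simp [sobL1]
  | insert a s ha ih =>
    simp only [Finset.sum_insert ha]
    refine (sobL1_add (h a (Finset.mem_insert_self a s))
      (IsTest.sum fun i hi => h i (Finset.mem_insert_of_mem hi)) j).trans ?_
    gcongr
    exact ih fun i hi => h i (Finset.mem_insert_of_mem hi)

lemma sobL1_dirDeriv (h : IsTest r φ) (v : E) (j : ℕ) :
    sobL1 j (fun x => fderiv ℝ φ x v) ≤ ‖v‖ * sobL1 (j + 1) φ := by
  have h1 : sobL1 j (fun x => fderiv ℝ φ x v) ≤
      ∑ i ∈ Finset.range (j + 1), ‖v‖ * ∫ x, ‖iteratedFDeriv ℝ (i + 1) φ x‖ := by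
    refine Finset.sum_le_sum fun i _ => ?_
    rw [← integral_const_mul]
    refine integral_mono ((h.dirDeriv v).integrable_iteratedFDeriv i).norm
      ((h.integrable_iteratedFDeriv (i + 1)).norm.const_mul _) fun x => ?_
    dsimp only
    rw [← norm_iteratedFDeriv_fderiv]
    exact norm_iteratedFDeriv_clm_apply_const (N := ∞)
      ((h.contDiff.fderiv_right (m := ∞) (by simp)).contDiffAt) (by exact_mod_cast le_top)
  refine h1.trans ?_
  rw [← Finset.mul_sum]
  refine mul_le_mul_of_nonneg_left ?_ (norm_nonneg v)
  rw [sobL1, Finset.sum_range_succ' _ (j + 1)]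
  exact le_add_of_nonneg_right (integral_nonneg fun _ => norm_nonneg _)

/-- A common bound on the unit ball for the derivatives of a smooth function. -/
lemma exists_bound_iteratedFDeriv {a : E → ℝ} (ha : ContDiff ℝ ∞ a) (j : ℕ) :
    ∃ B : ℝ, 0 ≤ B ∧ ∀ i ≤ j, ∀ x ∈ Metric.closedBall (0 : E) 1, ‖iteratedFDeriv ℝ i a x‖ ≤ B := by
  have h : ∀ i : ℕ, ∃ B : ℝ, ∀ x ∈ Metric.closedBall (0 : E) 1, ‖iteratedFDeriv ℝ i a x‖ ≤ B :=
    fun i => (isCompact_closedBall (0 : E) 1).exists_bound_of_continuousOn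
      (ha.continuous_iteratedFDeriv (m := i) (by exact_mod_cast le_top)).continuousOn
  choose B hB using h
  refine ⟨∑ i ∈ Finset.range (j + 1), |B i|, Finset.sum_nonneg fun _ _ => abs_nonneg _,
    fun i hi x hx => ((hB i x hx).trans (le_abs_self _)).trans ?_⟩
  exact Finset.single_le_sum (f := fun i => |B i|) (fun _ _ => abs_nonneg _)
    (Finset.mem_range.2 (Nat.lt_succ_of_le hi))

/-- Only the Leibniz term with all derivatives on φ carries the size of `a` itself. It is kept apart
because the other terms have fewer derivatives on φ and become small on small supports, whatever the
bound on the derivatives of `a`. -/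
lemma norm_iteratedFDeriv_smul_le' (h : IsTest r φ) (hr : r ≤ 1) {a : E → ℝ} (ha : ContDiff ℝ ∞ a)
    {j : ℕ} {B : ℝ} (hB0 : 0 ≤ B)
    (hB : ∀ i ≤ j, ∀ x ∈ Metric.closedBall (0 : E) 1, ‖iteratedFDeriv ℝ i a x‖ ≤ B) {i : ℕ}
    (hi : i ≤ j) (x : E) :
    ‖iteratedFDeriv ℝ i (fun x => a x • φ x) x‖ ≤ ‖a x‖ * ‖iteratedFDeriv ℝ i φ x‖ +
      2 ^ j * B * ∑ k ∈ Finset.range i, ‖iteratedFDeriv ℝ k φ x‖ := by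
  by_cases hx : x ∈ Metric.closedBall (0 : E) r
  swap
  · rw [(h.smul ha).iteratedFDeriv_eq_zero i hx, norm_zero]
    positivity
  have hx1 := Metric.closedBall_subset_closedBall hr hx
  refine (norm_iteratedFDeriv_smul_le (N := ∞) ha h.contDiff x (by exact_mod_cast le_top)).trans ?_
  rw [Finset.sum_range_succ', add_comm, Finset.mul_sum, ← Finset.sum_range_reflect]
  refine add_le_add (by simp) (Finset.sum_le_sum fun k hk => ?_)
  have hk : k < i := Finset.mem_range.1 hk
  rw [show i - 1 - k + 1 = i - k by omega, show i - (i - k) = k by omega]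
  refine mul_le_mul_of_nonneg_right ?_ (norm_nonneg _)
  refine mul_le_mul ?_ (hB _ (by omega) x hx1) (norm_nonneg _) (by positivity)
  calc ((i.choose (i - k) : ℕ) : ℝ) ≤ ((2 ^ i : ℕ) : ℝ) := by
        exact_mod_cast Nat.choose_le_two_pow i (i - k)
    _ ≤ 2 ^ j := by
        push_cast
        exact pow_le_pow_right₀ one_le_two hi

lemma sobL1_smul_le_aux (h : IsTest r φ) (hr : r ≤ 1) {a : E → ℝ} (ha : ContDiff ℝ ∞ a)
    {j : ℕ} {B σ : ℝ} (hB0 : 0 ≤ B) (hσ : ∀ x ∈ Metric.closedBall (0 : E) r, ‖a x‖ ≤ σ)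
    (hB : ∀ i ≤ j, ∀ x ∈ Metric.closedBall (0 : E) 1, ‖iteratedFDeriv ℝ i a x‖ ≤ B) {i : ℕ}
    (hi : i ≤ j) :
    ∫ x, ‖iteratedFDeriv ℝ i (fun x => a x • φ x) x‖ ≤
      σ * (∫ x, ‖iteratedFDeriv ℝ i φ x‖) +
        2 ^ j * B * ∑ k ∈ Finset.range i, ∫ x, ‖iteratedFDeriv ℝ k φ x‖ := by
  have hs : Integrable fun x => ∑ k ∈ Finset.range i, ‖iteratedFDeriv ℝ k φ x‖ :=
    integrable_finsetSum _ fun k _ => (h.integrable_iteratedFDeriv k).norm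
  rw [← integral_const_mul, ← integral_finsetSum _ fun k _ => (h.integrable_iteratedFDeriv k).norm,
    ← integral_const_mul, ← integral_add ((h.integrable_iteratedFDeriv i).norm.const_mul _)
      (hs.const_mul _)]
  refine integral_mono ((h.smul ha).integrable_iteratedFDeriv i).norm
    (((h.integrable_iteratedFDeriv i).norm.const_mul _).add (hs.const_mul _)) fun x => ?_
  refine (norm_iteratedFDeriv_smul_le' h hr ha hB0 hB hi x).trans ?_
  refine add_le_add_left ?_ _
  by_cases hx : x ∈ Metric.closedBall (0 : E) r
  · exact mul_le_mul_of_nonneg_right (hσ x hx) (norm_nonneg _)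
  · rw [h.iteratedFDeriv_eq_zero i hx]; simp

lemma exists_sobL1_smul_le {a : E → ℝ} (ha : ContDiff ℝ ∞ a) (j : ℕ) :
    ∃ C : ℝ, 0 ≤ C ∧ ∀ φ : E → ℂ, IsTest 1 φ → sobL1 j (fun x => a x • φ x) ≤ C * sobL1 j φ := by
  obtain ⟨B, hB0, hB⟩ := exists_bound_iteratedFDeriv ha j
  refine ⟨(j + 1) * (B + 2 ^ j * B), by positivity, fun φ h => ?_⟩
  have hσ : ∀ x ∈ Metric.closedBall (0 : E) 1, ‖a x‖ ≤ B := fun x hx => by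
    have := hB 0 (Nat.zero_le _) x hx
    rwa [norm_iteratedFDeriv_zero] at this
  calc sobL1 j (fun x => a x • φ x) ≤
      ∑ i ∈ Finset.range (j + 1), (B + 2 ^ j * B) * sobL1 j φ := by
        refine Finset.sum_le_sum fun i hi => ?_
        have hi : i ≤ j := Nat.lt_succ_iff.1 (Finset.mem_range.1 hi)
        refine (sobL1_smul_le_aux h le_rfl ha hB0 hσ hB hi).trans ?_
        rw [add_mul]
        have h1 : ∑ k ∈ Finset.range i, ∫ x, ‖iteratedFDeriv ℝ k φ x‖ ≤ sobL1 j φ :=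
          Finset.sum_le_sum_of_subset_of_nonneg (Finset.range_mono (by omega))
            fun _ _ _ => integral_nonneg fun _ => norm_nonneg _
        gcongr
        exact integral_iteratedFDeriv_le_sobL1 hi φ
    _ = _ := by rw [Finset.sum_const, Finset.card_range, nsmul_eq_mul]; push_cast; ring

lemma integral_iteratedFDeriv_le_succ [Nontrivial E] (h : IsTest r φ) (hr : 0 < r) (i : ℕ) :
    ∫ x, ‖iteratedFDeriv ℝ i φ x‖ ≤ 3 * r * ∫ x, ‖iteratedFDeriv ℝ (i + 1) φ x‖ := by
  have h1 : ContDiff ℝ 1 (iteratedFDeriv ℝ i φ) :=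
    h.contDiff.iteratedFDeriv_right (m := 1) (by exact_mod_cast le_top)
  refine (integral_norm_le_of_support h1 hr fun x hx => h.iteratedFDeriv_eq_zero i hx).trans ?_
  simp only [norm_fderiv_iteratedFDeriv]
  exact le_rfl

/-- Multiplication by a function that vanishes at zero has small norm on functions with small
support. -/
lemma exists_sobL1_smul_le_small [Nontrivial E] {a : E → ℝ} (ha : ContDiff ℝ ∞ a) (h0 : a 0 = 0)
    (j : ℕ) {δ : ℝ} (hδ : 0 < δ) :
    ∃ r : ℝ, 0 < r ∧ r ≤ 1 ∧
      ∀ φ : E → ℂ, IsTest r φ → sobL1 j (fun x => a x • φ x) ≤ δ * sobL1 j φ := by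
  obtain ⟨B, hB0, hB⟩ := exists_bound_iteratedFDeriv ha j
  set δ' : ℝ := δ / (2 * (j + 1)) with hδ'
  have hδ'0 : 0 < δ' := by positivity
  obtain ⟨r1, hr1, hr1'⟩ := Metric.continuous_iff.1 ha.continuous 0 δ' hδ'0
  -- The first bound makes |a| small on the support. The last one makes the lower Leibniz terms
  -- small, each of which gains 3r from the Poincaré inequality. There are j + 1 orders with two
  -- contributions each, whence δ' = δ / (2(j + 1)).
  set r : ℝ := min (min (r1 / 2) 1) (δ' / (2 ^ j * B * 3 + 1)) with hr
  have hrpos : 0 < r := by positivity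
  have hrle : r ≤ 1 := (min_le_left _ _).trans (min_le_right _ _)
  have hrr1 : r < r1 := ((min_le_left _ _).trans (min_le_left _ _)).trans_lt (by linarith)
  have hrB : 2 ^ j * B * (3 * r) ≤ δ' := by
    have h1 : r ≤ δ' / (2 ^ j * B * 3 + 1) := min_le_right _ _
    rw [le_div_iff₀ (by positivity)] at h1
    nlinarith
  refine ⟨r, hrpos, hrle, fun φ h => ?_⟩
  have hσ : ∀ x ∈ Metric.closedBall (0 : E) r, ‖a x‖ ≤ δ' := fun x hx => by
    have := hr1' x ((Metric.mem_closedBall.1 hx).trans_lt hrr1)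
    rw [h0, dist_zero_right] at this
    exact this.le
  calc sobL1 j (fun x => a x • φ x) ≤
      ∑ i ∈ Finset.range (j + 1), (δ' + δ') * sobL1 j φ := by
        refine Finset.sum_le_sum fun i hi => ?_
        have hi : i ≤ j := Nat.lt_succ_iff.1 (Finset.mem_range.1 hi)
        refine (sobL1_smul_le_aux h hrle ha hB0 hσ hB hi).trans ?_
        rw [add_mul]
        refine add_le_add (mul_le_mul_of_nonneg_left (integral_iteratedFDeriv_le_sobL1 hi φ)
          hδ'0.le) ?_
        have h1 : ∑ k ∈ Finset.range i, ∫ x, ‖iteratedFDeriv ℝ k φ x‖ ≤ 3 * r * sobL1 j φ := by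
          calc _ ≤ ∑ k ∈ Finset.range i, 3 * r * ∫ x, ‖iteratedFDeriv ℝ (k + 1) φ x‖ :=
                Finset.sum_le_sum fun k _ => integral_iteratedFDeriv_le_succ h hrpos k
            _ = 3 * r * ∑ k ∈ Finset.range i, ∫ x, ‖iteratedFDeriv ℝ (k + 1) φ x‖ := by
                rw [Finset.mul_sum]
            _ ≤ _ := by
                refine mul_le_mul_of_nonneg_left ?_ (by positivity)
                refine le_trans ?_ (sobL1_mono hi φ)
                rw [sobL1, Finset.sum_range_succ' _ i]
                exact le_add_of_nonneg_right (integral_nonneg fun _ => norm_nonneg _)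
        calc 2 ^ j * B * ∑ k ∈ Finset.range i, ∫ x, ‖iteratedFDeriv ℝ k φ x‖
            ≤ 2 ^ j * B * (3 * r * sobL1 j φ) := by gcongr
          _ = 2 ^ j * B * (3 * r) * sobL1 j φ := by ring
          _ ≤ _ := mul_le_mul_of_nonneg_right hrB (sobL1_nonneg _ _)
    _ = (j + 1) * (2 * δ') * sobL1 j φ := by
        rw [Finset.sum_const, Finset.card_range, nsmul_eq_mul]; push_cast; ring
    _ = _ := by rw [hδ']; field_simp

/-- A derivative may be traded for a small factor on functions with small support. -/
lemma sobL1_le_succ [Nontrivial E] (h : IsTest r φ) (hr : 0 < r) (j : ℕ) :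
    sobL1 j φ ≤ 3 * r * sobL1 (j + 1) φ := by
  calc sobL1 j φ ≤ ∑ i ∈ Finset.range (j + 1), 3 * r * ∫ x, ‖iteratedFDeriv ℝ (i + 1) φ x‖ :=
        Finset.sum_le_sum fun i _ => integral_iteratedFDeriv_le_succ h hr i
    _ = 3 * r * ∑ i ∈ Finset.range (j + 1), ∫ x, ‖iteratedFDeriv ℝ (i + 1) φ x‖ := by
        rw [Finset.mul_sum]
    _ ≤ _ := by
        refine mul_le_mul_of_nonneg_left ?_ (by positivity)
        rw [sobL1, Finset.sum_range_succ' _ (j + 1)]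
        exact le_add_of_nonneg_right (integral_nonneg fun _ => norm_nonneg _)

end Sobolev

/-! ### Iterated directional derivatives and their symmetry. -/

section IteratedDirections

variable {E : Type*} [NormedAddCommGroup E] [InnerProductSpace ℝ E]

/-- The iterated directional derivative along a list of vectors. -/
def listDeriv (w : List E) (φ : E → ℂ) : E → ℂ := w.foldr (fun v f => fun x => fderiv ℝ f x v) φ

lemma listDeriv_cons (v : E) (w : List E) (φ : E → ℂ) :
    listDeriv (v :: w) φ = fun x => fderiv ℝ (listDeriv w φ) x v := rfl

lemma contDiff_listDeriv {φ : E → ℂ} (h : ContDiff ℝ ∞ φ) (w : List E) :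
    ContDiff ℝ ∞ (listDeriv w φ) := by
  induction w with
  | nil => exact h
  | cons v w ih => exact (ih.fderiv_right (m := ∞) (by simp)).clm_apply contDiff_const

lemma listDeriv_swap {φ : E → ℂ} (h : ContDiff ℝ ∞ φ) (v w : E) :
    (fun x => fderiv ℝ (fun x => fderiv ℝ φ x w) x v) =
      fun x => fderiv ℝ (fun x => fderiv ℝ φ x v) x w := by
  have hd : Differentiable ℝ (fderiv ℝ φ) :=
    (h.fderiv_right (m := ∞) (by simp)).differentiable (by simp)
  have h1 : ∀ x v w, fderiv ℝ (fun x => fderiv ℝ φ x w) x v = fderiv ℝ (fderiv ℝ φ) x v w := by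
    intro x v w
    have := ((hd x).hasFDerivAt.clm_apply (hasFDerivAt_const w x)).fderiv
    rw [this]
    simp
  funext x
  rw [h1, h1]
  exact (h.contDiffAt.isSymmSndFDerivAt
    (by
      rw [minSmoothness_of_isRCLikeNormedField]
      exact WithTop.coe_le_coe.2 (le_top : (2 : ℕ∞) ≤ ⊤))) v w

/-- By the symmetry of second derivatives, a list of basis directions may be sorted into the order
used by `multiDeriv`. -/
lemma listDeriv_perm {φ : E → ℂ} (h : ContDiff ℝ ∞ φ) {w w' : List E} (hw : w.Perm w') :
    listDeriv w φ = listDeriv w' φ := by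
  induction hw with
  | nil => rfl
  | cons v _ ih => rw [listDeriv_cons, listDeriv_cons, ih]
  | swap v v' w => exact listDeriv_swap (contDiff_listDeriv h w) _ _
  | trans _ _ ih ih' => exact ih.trans ih'

lemma iteratedFDeriv_eq_listDeriv {φ : E → ℂ} (h : ContDiff ℝ ∞ φ) {i : ℕ} (w : Fin i → E) (x : E) :
    iteratedFDeriv ℝ i φ x w = listDeriv (List.ofFn w) φ x := by
  induction i generalizing x with
  | zero => simp [listDeriv]
  | succ i ih =>
    have hd : DifferentiableAt ℝ (iteratedFDeriv ℝ i φ) x :=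
      (h.differentiable_iteratedFDeriv (m := i) (by exact_mod_cast WithTop.coe_lt_top _)) x
    rw [iteratedFDeriv_succ_apply_left, List.ofFn_succ, listDeriv_cons]
    have h1 : listDeriv (List.ofFn fun j : Fin i => w j.succ) φ =
        fun y => iteratedFDeriv ℝ i φ y (Fin.tail w) := by
      funext y
      exact (ih (Fin.tail w) y).symm
    rw [h1]
    have h2 := (hd.hasFDerivAt.continuousMultilinear_apply_const (Fin.tail w)).fderiv
    change _ = fderiv ℝ (fun y => iteratedFDeriv ℝ i φ y (Fin.tail w)) x (w 0)
    rw [h2]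
    rfl

lemma norm_multilinear_le_sum {ι : Type*} [Fintype ι] [DecidableEq ι] (b : OrthonormalBasis ι ℝ E)
    {i : ℕ} (A : ContinuousMultilinearMap ℝ (fun _ : Fin i => E) ℂ) :
    ‖A‖ ≤ ∑ f : Fin i → ι, ‖A fun k => b (f k)‖ := by
  refine ContinuousMultilinearMap.opNorm_le_bound
    (Finset.sum_nonneg fun _ _ => norm_nonneg _) fun m => ?_
  have h1 : m = fun k => ∑ j, inner ℝ (b j) (m k) • b j := funext fun k => (b.sum_repr' (m k)).symm
  have h2 : A m = ∑ f : Fin i → ι, A fun k => inner ℝ (b (f k)) (m k) • b (f k) := by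
    conv_lhs => rw [h1]
    exact A.toMultilinearMap.map_sum fun k j => inner ℝ (b j) (m k) • b j
  rw [h2, Finset.sum_mul]
  refine (norm_sum_le _ _).trans (Finset.sum_le_sum fun f _ => ?_)
  rw [A.map_smul_univ (fun k => inner ℝ (b (f k)) (m k)) fun k => b (f k), norm_smul, mul_comm,
    norm_prod]
  refine mul_le_mul_of_nonneg_left (Finset.prod_le_prod (fun _ _ => norm_nonneg _) fun k _ => ?_)
    (norm_nonneg _)
  simpa using norm_inner_le_norm (𝕜 := ℝ) (b (f k)) (m k)

end IteratedDirections

/-! ### Comparison of the two Sobolev norms. -/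

section Comparison

lemma ofFn_perm_flatten {i n : ℕ} (f : Fin i → Fin n) :
    (List.ofFn f).Perm (List.ofFn fun j =>
      List.replicate (Finset.univ.filter fun k => f k = j).card j).flatten := by
  rw [List.perm_iff_count]
  intro a
  rw [List.count_flatten, List.map_ofFn, List.sum_ofFn]
  have h1 : ∀ j, (List.count a ∘ fun j => List.replicate (Finset.univ.filter fun k => f k = j).card j) j
      = if j = a then (Finset.univ.filter fun k => f k = a).card else 0 := by
    intro j
    rw [Function.comp_apply, List.count_replicate]
    by_cases h : j = a
    · subst h; simp
    · simp [h]
  simp only [h1, Finset.sum_ite_eq', Finset.mem_univ, if_true]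
  rw [← Multiset.coe_count, ← Fin.univ_val_map, Multiset.count_map]
  simp only [eq_comm (a := a)]
  rfl

variable {𝔤 : Type u} [MetricLieAlgebra 𝔤] [FiniteDimensional ℝ 𝔤] [MeasurableSpace 𝔤]
  [BorelSpace 𝔤]

lemma integral_norm_le_sobolevNorm {n : ℕ} (b : Fin n → 𝔤) {φ : 𝔤 → ℂ} (h : ContDiff ℝ ∞ φ)
    {i K : ℕ} (hi : i ≤ K) (f : Fin i → Fin n) :
    ∫ x, ‖iteratedFDeriv ℝ i φ x fun k => b (f k)‖ ≤ sobolevNorm b K φ := by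
  set α : Fin n → ℕ := fun j => (Finset.univ.filter fun k => f k = j).card with hα
  have h1 : ∀ x, iteratedFDeriv ℝ i φ x (fun k => b (f k)) = multiDeriv b α φ x := by
    intro x
    rw [iteratedFDeriv_eq_listDeriv h]
    refine congrFun (listDeriv_perm h ?_) x
    have h2 := (ofFn_perm_flatten f).map b
    rw [List.map_ofFn, List.map_flatten, List.map_ofFn] at h2
    simpa [Function.comp_def] using h2
  have h3 : α ∈ (Finset.univ : Finset (Fin n)).piAntidiag i := by
    rw [Finset.mem_piAntidiag]
    refine ⟨?_, fun _ _ => Finset.mem_univ _⟩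
    have := Finset.card_eq_sum_card_fiberwise (f := f) (s := Finset.univ) (t := Finset.univ)
      fun _ _ => Finset.mem_univ _
    simpa [hα] using this.symm
  simp only [h1]
  have hnn : ∀ α : Fin n → ℕ, 0 ≤ ∫ x, ‖multiDeriv b α φ x‖ := fun α =>
    integral_nonneg fun _ => norm_nonneg _
  refine (Finset.single_le_sum (f := fun α => ∫ x, ‖multiDeriv b α φ x‖) (fun α _ => hnn α) h3).trans ?_
  exact Finset.single_le_sum
    (f := fun j => ∑ α ∈ (Finset.univ : Finset (Fin n)).piAntidiag j, ∫ x, ‖multiDeriv b α φ x‖)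
    (fun _ _ => Finset.sum_nonneg fun α _ => hnn α) (Finset.mem_range.2 (Nat.lt_succ_of_le hi))

lemma integral_norm_le_sobolevNorm_zero {n : ℕ} (b : Fin n → 𝔤) {φ : 𝔤 → ℂ}
    (h : ContDiff ℝ ∞ φ) (K : ℕ) : ∫ x, ‖φ x‖ ≤ sobolevNorm b K φ := by
  simpa using integral_norm_le_sobolevNorm b h (Nat.zero_le K) Fin.elim0

lemma sobL1_le_sobolevNorm {n : ℕ} (b : OrthonormalBasis (Fin n) ℝ 𝔤) {r : ℝ} {φ : 𝔤 → ℂ}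
    (h : IsTest r φ) (K : ℕ) :
    sobL1 K φ ≤ (∑ i ∈ Finset.range (K + 1), (n : ℝ) ^ i) * sobolevNorm b K φ := by
  rw [sobL1, Finset.sum_mul]
  refine Finset.sum_le_sum fun i hi => ?_
  have hi : i ≤ K := Nat.lt_succ_iff.1 (Finset.mem_range.1 hi)
  have hint : ∀ f : Fin i → Fin n, Integrable fun x => ‖iteratedFDeriv ℝ i φ x fun k => b (f k)‖ :=
    fun f => by
      refine Integrable.norm ?_
      exact ((ContinuousMultilinearMap.apply ℝ (fun _ : Fin i => 𝔤) ℂ fun k => b (f k))).integrable_comp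
        (h.integrable_iteratedFDeriv i)
  calc ∫ x, ‖iteratedFDeriv ℝ i φ x‖
      ≤ ∫ x, ∑ f : Fin i → Fin n, ‖iteratedFDeriv ℝ i φ x fun k => b (f k)‖ :=
        integral_mono (h.integrable_iteratedFDeriv i).norm (integrable_finsetSum _ fun f _ => hint f)
          fun x => norm_multilinear_le_sum b _
    _ = ∑ f : Fin i → Fin n, ∫ x, ‖iteratedFDeriv ℝ i φ x fun k => b (f k)‖ :=
        integral_finsetSum _ fun f _ => hint f
    _ ≤ ∑ f : Fin i → Fin n, sobolevNorm b K φ :=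
        Finset.sum_le_sum fun f _ => integral_norm_le_sobolevNorm b h.contDiff hi f
    _ = _ := by simp

end Comparison

/-! ### Differentiation of the Fourier integral along left translations -/

/-- Differentiation under the integral of the product of a locally integrable function and a smooth
function with compact support. -/
lemma hasDerivAt_integral_mul {E : Type*} [NormedAddCommGroup E] [NormedSpace ℝ E]
    [FiniteDimensional ℝ E] [MeasurableSpace E] [BorelSpace E] {μ : Measure E} {F : E → ℂ}
    (hF : LocallyIntegrable F μ) {H : ℝ × E → ℂ} (hH : ContDiff ℝ 1 H) {K : Set E}
    (hK : IsCompact K) (hs : ∀ s ∈ Metric.ball (0 : ℝ) 1, ∀ x ∉ K, H (s, x) = 0) {H' : E → ℂ}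
    (hH' : ∀ x, HasDerivAt (fun s => H (s, x)) (H' x) 0) :
    HasDerivAt (fun s => ∫ x, F x * H (s, x) ∂μ) (∫ x, F x * H' x ∂μ) 0 := by
  have hball : Metric.ball (0 : ℝ) 1 ∈ 𝓝 (0 : ℝ) := Metric.ball_mem_nhds 0 one_pos
  set D : ℝ × E → ℂ := fun p => fderiv ℝ H p (1, 0) with hD
  have hDc : Continuous D := (hH.continuous_fderiv one_ne_zero).clm_apply continuous_const
  have hd : ∀ s x, HasDerivAt (fun s => H (s, x)) (D (s, x)) s := fun s x => by
    have h1 : HasDerivAt (fun s : ℝ => (s, x)) ((1 : ℝ), (0 : E)) s :=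
      (hasDerivAt_id s).prodMk (hasDerivAt_const s x)
    exact ((hH.differentiable one_ne_zero) (s, x)).hasFDerivAt.comp_hasDerivAt s h1
  have hD0 : ∀ s ∈ Metric.ball (0 : ℝ) 1, ∀ x ∉ K, D (s, x) = 0 := fun s hs1 x hx => by
    have h1 : (fun s => H (s, x)) =ᶠ[𝓝 s] fun _ => 0 := by
      filter_upwards [Metric.isOpen_ball.mem_nhds hs1] with s' hs' using hs s' hs' x hx
    exact (hd s x).unique ((hasDerivAt_const s 0).congr_of_eventuallyEq h1)
  obtain ⟨B, hB⟩ := ((isCompact_closedBall (0 : ℝ) 1).prod hK).exists_bound_of_continuousOn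
    hDc.continuousOn
  have hFK : IntegrableOn F K μ := hF.integrableOn_isCompact hK
  have hcs : ∀ s, Continuous fun x => H (s, x) := fun s =>
    hH.continuous.comp (Continuous.prodMk_right s)
  have hH'eq : ∀ x, H' x = D (0, x) := fun x => (hH' x).unique (hd 0 x)
  have key := hasDerivAt_integral_of_dominated_loc_of_deriv_le (μ := μ) (𝕜 := ℝ)
    (F := fun s x => F x * H (s, x)) (F' := fun s x => F x * D (s, x)) (x₀ := 0)
    (bound := K.indicator fun x => ‖F x‖ * B) hball
    (Filter.Eventually.of_forall fun s =>
      hF.aestronglyMeasurable.mul (hcs s).aestronglyMeasurable) ?_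
    (hF.aestronglyMeasurable.mul
      (hDc.comp (Continuous.prodMk_right (0 : ℝ))).aestronglyMeasurable) ?_ ?_ ?_
  · simp only [hH'eq]
    exact key.2
  · refine (integrableOn_iff_integrable_of_support_subset fun x hx => ?_).1
      (hFK.mul_continuousOn (hcs 0).continuousOn hK)
    by_contra h
    exact hx (by simp [hs 0 (Metric.mem_ball_self one_pos) x h])
  · refine Filter.Eventually.of_forall fun x s hs1 => ?_
    by_cases hx : x ∈ K
    · rw [Set.indicator_of_mem hx, norm_mul]
      exact mul_le_mul_of_nonneg_left (hB (s, x) ⟨Metric.ball_subset_closedBall hs1, hx⟩)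
        (norm_nonneg _)
    · rw [Set.indicator_of_notMem hx, hD0 s hs1 x hx]; simp
  · exact (integrable_indicator_iff hK.isClosed.measurableSet).2 (hFK.norm.mul_const B)
  · exact Filter.Eventually.of_forall fun x s _ => (hd s x).const_mul (F x)

section Translations

variable {𝔤 : Type u} [MetricLieAlgebra 𝔤] [FiniteDimensional ℝ 𝔤]

/-- The vector field `x ↦ d/ds (exp (s Y) x)`. -/
def leftField (Y x : 𝔤) : 𝔤 := fderiv ℝ (fun p : 𝔤 × 𝔤 => bch p.1 p.2) (0, x) (Y, 0)

lemma contDiff_bch_prod : ContDiff ℝ ∞ fun p : 𝔤 × 𝔤 => bch p.1 p.2 :=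
  contDiff_bch contDiff_fst contDiff_snd

lemma contDiff_leftField (Y : 𝔤) : ContDiff ℝ ∞ (leftField Y) := by
  have h1 : ContDiff ℝ ∞ (fderiv ℝ fun p : 𝔤 × 𝔤 => bch p.1 p.2) :=
    contDiff_bch_prod.fderiv_right (m := ∞) (by simp)
  exact (h1.comp (contDiff_const.prodMk contDiff_id)).clm_apply contDiff_const

lemma leftField_sum {ι : Type*} (s : Finset ι) (c : ι → ℝ) (Y : ι → 𝔤) (x : 𝔤) :
    leftField (∑ i ∈ s, c i • Y i) x = ∑ i ∈ s, c i • leftField (Y i) x := by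
  have h : ((∑ i ∈ s, c i • Y i, 0) : 𝔤 × 𝔤) = ∑ i ∈ s, c i • (Y i, (0 : 𝔤)) := by
    refine Prod.ext ?_ ?_
    · simp [Prod.fst_sum]
    · simp [Prod.snd_sum]
  rw [leftField, h, map_sum]
  exact Finset.sum_congr rfl fun i _ => map_smul _ _ _

variable [LieRing.IsNilpotent 𝔤]

lemma hasDerivAt_bch_smul (Y x : 𝔤) : HasDerivAt (fun s : ℝ => bch (s • Y) x) (leftField Y x) 0 := by
  have h1 : HasDerivAt (fun s : ℝ => (s • Y, x)) ((Y, 0) : 𝔤 × 𝔤) 0 := by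
    have h2 := (hasDerivAt_id (0 : ℝ)).smul_const Y
    rw [one_smul] at h2
    exact h2.prodMk (hasDerivAt_const (0 : ℝ) x)
  have h3 := (contDiff_bch_prod.differentiable (by simp) ((0 : 𝔤), x)).hasFDerivAt
  rw [show ((0 : 𝔤), x) = ((0 : ℝ) • Y, x) by rw [zero_smul]] at h3
  have h4 := h3.comp_hasDerivAt (0 : ℝ) h1
  rw [zero_smul] at h4
  exact h4

/-- Consequently the field minus Y vanishes at the origin, which makes the error term in
`twistedDeriv` small on small supports. -/
lemma leftField_zero (Y : 𝔤) : leftField Y 0 = Y := by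
  have h1 := hasDerivAt_bch_smul Y (0 : 𝔤)
  simp only [bch_zero] at h1
  have h2 := (hasDerivAt_id (0 : ℝ)).smul_const Y
  rw [one_smul] at h2
  exact h1.unique h2

/-- The character `x ↦ exp (- 2 π i η (x))`. -/
def expChar (η : StrongDual ℝ 𝔤) (x : 𝔤) : ℂ :=
  Complex.exp (-(2 * Real.pi * Complex.I * (η x : ℂ)))

lemma contDiff_expChar (η : StrongDual ℝ 𝔤) : ContDiff ℝ ∞ (expChar η) := by
  have h1 : ContDiff ℝ ∞ fun x : 𝔤 => (η x : ℂ) :=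
    Complex.ofRealCLM.contDiff.comp η.contDiff
  exact ((contDiff_const.mul h1).neg).cexp

lemma norm_expChar (η : StrongDual ℝ 𝔤) (x : 𝔤) : ‖expChar η x‖ = 1 := by
  rw [expChar, show -(2 * Real.pi * Complex.I * (η x : ℂ)) = ((-(2 * Real.pi * η x) : ℝ) : ℂ) * Complex.I
    by push_cast; ring]
  exact Complex.norm_exp_ofReal_mul_I _

lemma hasFDerivAt_expChar_line (η : StrongDual ℝ 𝔤) {p : ℝ → 𝔤} {p' : 𝔤} {s : ℝ}
    (hp : HasDerivAt p p' s) :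
    HasDerivAt (fun s => expChar η (p s))
      (expChar η (p s) * -(2 * Real.pi * Complex.I * (η p' : ℂ))) s := by
  have h1 : HasDerivAt (fun s => η (p s)) (η p') s := η.hasFDerivAt.comp_hasDerivAt s hp
  exact ((h1.ofReal_comp.const_mul (2 * Real.pi * Complex.I)).neg).cexp

variable [MeasurableSpace 𝔤] [BorelSpace 𝔤]

/-- The Fourier integral of the translates of `u`, at the group element `g`. -/
def transFourier (u : 𝔤 → ℂ) (η : StrongDual ℝ 𝔤) (φ : 𝔤 → ℂ) (g : 𝔤) : ℂ :=
  ∫ x, u (bch g x) * (φ x * expChar η x)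

lemma measurableEmbedding_bch (g : 𝔤) : MeasurableEmbedding (bch g) := by
  let e : 𝔤 ≃ₜ 𝔤 :=
    { toFun := bch g
      invFun := bch (-g)
      left_inv := fun x => neg_bch_cancel_left g x
      right_inv := fun x => bch_neg_cancel_left g x
      continuous_toFun := (continuous_const (y := g)).bch continuous_id
      continuous_invFun := (continuous_const (y := -g)).bch continuous_id }
  exact e.measurableEmbedding

lemma transFourier_integrable {u : 𝔤 → ℂ} {g : 𝔤} (hF : LocallyIntegrable fun x => u (bch g x))
    {r : ℝ} {φ : 𝔤 → ℂ} (hφ : IsTest r φ) (η : StrongDual ℝ 𝔤) :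
    Integrable fun x => u (bch g x) * (φ x * expChar η x) := by
  refine hF.integrable_smul_right_of_hasCompactSupport
    (hφ.contDiff.continuous.mul (contDiff_expChar η).continuous) ?_
  exact hφ.hasCompactSupport.mul_right

lemma transFourier_add {u : 𝔤 → ℂ} {g : 𝔤} (hF : LocallyIntegrable fun x => u (bch g x))
    {r : ℝ} {φ ψ : 𝔤 → ℂ} (hφ : IsTest r φ) (hψ : IsTest r ψ) (η : StrongDual ℝ 𝔤) :
    transFourier u η (fun x => φ x + ψ x) g = transFourier u η φ g + transFourier u η ψ g := by
  rw [transFourier, transFourier, transFourier,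
    ← integral_add (transFourier_integrable hF hφ η) (transFourier_integrable hF hψ η)]
  exact integral_congr_ae (Filter.Eventually.of_forall fun x => by ring)

lemma transFourier_const_mul {u : 𝔤 → ℂ} {g : 𝔤} (c : ℂ) (φ : 𝔤 → ℂ) (η : StrongDual ℝ 𝔤) :
    transFourier u η (fun x => c * φ x) g = c * transFourier u η φ g := by
  rw [transFourier, transFourier, ← integral_const_mul]
  exact integral_congr_ae (Filter.Eventually.of_forall fun x => by ring)

lemma transFourier_sum {u : 𝔤 → ℂ} {g : 𝔤} (hF : LocallyIntegrable fun x => u (bch g x))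
    {r : ℝ} {ι : Type*} (s : Finset ι) {f : ι → 𝔤 → ℂ} (hf : ∀ i ∈ s, IsTest r (f i))
    (η : StrongDual ℝ 𝔤) :
    transFourier u η (fun x => ∑ i ∈ s, f i x) g = ∑ i ∈ s, transFourier u η (f i) g := by
  simp only [transFourier]
  rw [← integral_finsetSum _ fun i hi => transFourier_integrable hF (hf i hi) η]
  refine integral_congr_ae (Filter.Eventually.of_forall fun x => ?_)
  simp only
  rw [Finset.sum_mul, Finset.mul_sum]

/-- The derivative of a test function along a left invariant vector field, up to the phase of the
Fourier integral. -/
def twistedDeriv (η : StrongDual ℝ 𝔤) (Y : 𝔤) (φ : 𝔤 → ℂ) (x : 𝔤) : ℂ :=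
  fderiv ℝ φ x (leftField Y x) +
    (-(2 * Real.pi * Complex.I)) * (η (leftField Y x - Y) • φ x)

lemma bch_bch_smul (g Y x : 𝔤) : bch g (bch Y x) = bch (Ad g Y) (bch g x) := by
  rw [← bch_conj, bch_assoc, neg_bch_cancel_left, bch_assoc]

lemma IsTest.fderiv_leftField {r : ℝ} {φ : 𝔤 → ℂ} (hφ : IsTest r φ) (Y : 𝔤) :
    IsTest r fun x => fderiv ℝ φ x (leftField Y x) :=
  IsTest.of_support ((hφ.contDiff.fderiv_right (m := ∞) (by simp)).clm_apply (contDiff_leftField Y))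
    fun x hx => by rw [hφ.fderiv_eq_zero hx, zero_apply]

lemma contDiff_apply_leftField_sub (η : StrongDual ℝ 𝔤) (Y : 𝔤) :
    ContDiff ℝ ∞ fun x => η (leftField Y x - Y) :=
  η.contDiff.comp ((contDiff_leftField Y).sub contDiff_const)

lemma IsTest.twistedDeriv {r : ℝ} {φ : 𝔤 → ℂ} (hφ : IsTest r φ) (η : StrongDual ℝ 𝔤) (Y : 𝔤) :
    IsTest r (twistedDeriv η Y φ) :=
  (hφ.fderiv_leftField Y).add ((hφ.smul (contDiff_apply_leftField_sub η Y)).const_mul _)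

/-- Translating the integration variable by exp(sY) leaves the integral unchanged, while `u`
acquires the phase exp(2πi s l(Ad(g)Y)). The identity is the derivative in s at 0 of this constant
expression. All derivatives fall on the smooth factor, so `u` need only be locally integrable. -/
lemma transFourier_twistedDeriv {u : 𝔤 → ℂ} {l : StrongDual ℝ 𝔤} {𝔪 : LieSubalgebra ℝ 𝔤}
    (hu : ∀ m ∈ 𝔪, ∀ g : 𝔤, u (bch m g) = Complex.exp (2 * Real.pi * Complex.I * (l m : ℂ)) * u g)
    {g Y : 𝔤} (hF : LocallyIntegrable fun x => u (bch g x)) (hY : Ad g Y ∈ 𝔪) {r : ℝ}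
    {φ : 𝔤 → ℂ} (hφ : IsTest r φ) (η : StrongDual ℝ 𝔤) :
    2 * Real.pi * Complex.I * ((l (Ad g Y) - η Y : ℝ) : ℂ) * transFourier u η φ g =
      -transFourier u η (twistedDeriv η Y φ) g := by
  set F : 𝔤 → ℂ := fun x => u (bch g x) with hFdef
  set Ψ : 𝔤 → ℂ := fun x => φ x * expChar η x with hΨ
  have hΨc : ContDiff ℝ ∞ Ψ := hφ.contDiff.mul (contDiff_expChar η)
  set Λ : ℂ := 2 * Real.pi * Complex.I * (l (Ad g Y) : ℂ) with hΛ
  set H : ℝ × 𝔤 → ℂ := fun p => Ψ (bch (p.1 • Y) p.2) with hH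
  have hHc : ContDiff ℝ ∞ H :=
    hΨc.comp (contDiff_bch (contDiff_fst.smul contDiff_const) contDiff_snd)
  have htrans : ∀ (s : ℝ) (x : 𝔤), F (bch (s • Y) x) = Complex.exp (s * Λ) * F x := by
    intro s x
    have h1 : Ad g (s • Y) ∈ 𝔪 := by rw [map_smul]; exact 𝔪.smul_mem s hY
    rw [hFdef]
    simp only
    rw [bch_bch_smul, hu _ h1, map_smul, map_smul, hΛ, smul_eq_mul]
    congr 2
    push_cast; ring
  have hconst : ∀ s : ℝ, Complex.exp (s * Λ) * ∫ x, F x * H (s, x) = transFourier u η φ g := by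
    intro s
    rw [← integral_const_mul]
    refine Eq.trans (integral_congr_ae (Filter.Eventually.of_forall fun x => ?_))
      ((measurePreserving_bch (s • Y)).integral_comp (measurableEmbedding_bch (s • Y))
        fun x => F x * Ψ x)
    rw [htrans]
    simp only [hH]
    ring
  -- The field in the derivative of the character is split as Y plus the remainder. The constant
  -- part η(Y) joins the scalar on the left, and the remainder stays inside `twistedDeriv`.
  set H' : 𝔤 → ℂ := fun x => (twistedDeriv η Y φ x +
    (-(2 * Real.pi * Complex.I * (η Y : ℂ))) * φ x) * expChar η x with hH'
  have hder : ∀ x, HasDerivAt (fun s => H (s, x)) (H' x) 0 := by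
    intro x
    have h1 := hasDerivAt_bch_smul Y x
    have h0 : bch ((0 : ℝ) • Y) x = x := by rw [zero_smul, zero_bch]
    have h2 := (hφ.contDiff.differentiable (by simp) (bch ((0 : ℝ) • Y) x)).hasFDerivAt.comp_hasDerivAt
      (0 : ℝ) h1
    have h3 := h2.mul (hasFDerivAt_expChar_line η h1)
    simp only [Function.comp_apply, h0] at h3
    have h4 : H' x = fderiv ℝ φ x (leftField Y x) * expChar η x +
        φ x * (expChar η x * -(2 * Real.pi * Complex.I * (η (leftField Y x) : ℂ))) := by
      simp only [hH', twistedDeriv, map_sub, Complex.real_smul]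
      push_cast; ring
    rw [h4]
    exact h3
  have hK : IsCompact ((fun p : ℝ × 𝔤 => bch (p.1 • Y) p.2) ''
      (Metric.closedBall (0 : ℝ) 1 ×ˢ Metric.closedBall (0 : 𝔤) r)) :=
    ((isCompact_closedBall _ _).prod (isCompact_closedBall _ _)).image
      ((continuous_fst.smul continuous_const).bch continuous_snd)
  have hzero : ∀ s ∈ Metric.ball (0 : ℝ) 1, ∀ x ∉ ((fun p : ℝ × 𝔤 => bch (p.1 • Y) p.2) ''
      (Metric.closedBall (0 : ℝ) 1 ×ˢ Metric.closedBall (0 : 𝔤) r)), H (s, x) = 0 := by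
    intro s hs x hx
    have h1 : φ (bch (s • Y) x) = 0 := by
      refine hφ.eq_zero fun h => hx ⟨(-s, bch (s • Y) x), ⟨?_, h⟩, ?_⟩
      · rw [mem_closedBall_zero_iff, norm_neg]
        exact (mem_ball_zero_iff.1 hs).le
      · simp only [neg_smul, neg_bch_cancel_left]
    simp only [hH, hΨ, h1, zero_mul]
  have hG := hasDerivAt_integral_mul hF (hHc.of_le (by exact_mod_cast le_top)) hK hzero hder
  have hE : HasDerivAt (fun s : ℝ => Complex.exp (s * Λ)) Λ 0 := by
    have := ((Complex.ofRealCLM.hasDerivAt (x := (0 : ℝ))).mul_const Λ).cexp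
    simpa using this
  have hprod := hE.mul hG
  have hc : (fun s : ℝ => Complex.exp (s * Λ) * ∫ x, F x * H (s, x)) =
      fun _ => transFourier u η φ g := funext hconst
  have h0 := hconst 0
  have h5 : (fun s : ℝ => Complex.exp (s * Λ)) * (fun s : ℝ => ∫ x, F x * H (s, x)) =
      fun _ => transFourier u η φ g := hc
  rw [h5] at hprod
  have h6 := hprod.unique (hasDerivAt_const (0 : ℝ) _)
  simp only [Complex.ofReal_zero, zero_mul, Complex.exp_zero, one_mul] at h6 h0
  rw [h0] at h6
  have h7 : ∫ x, F x * H' x = transFourier u η (twistedDeriv η Y φ) g +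
      (-(2 * Real.pi * Complex.I * (η Y : ℂ))) * transFourier u η φ g := by
    rw [← transFourier_const_mul, ← transFourier_add hF (hφ.twistedDeriv η Y) (hφ.const_mul _)]
    rfl
  rw [h7] at h6
  push_cast
  linear_combination h6

end Translations

/-! ### The pointwise inequality -/

section Pointwise

variable {𝔤 : Type u} [MetricLieAlgebra 𝔤] [FiniteDimensional ℝ 𝔤] [LieRing.IsNilpotent 𝔤]

lemma setDist_nonneg {E : Type*} [PseudoMetricSpace E] (A B : Set E) : 0 ≤ setDist A B :=
  Real.sInf_nonneg (by rintro _ ⟨a, _, b, _, rfl⟩; exact dist_nonneg)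

lemma setDist_le {E : Type*} [PseudoMetricSpace E] {A B : Set E} {a b : E} (ha : a ∈ A)
    (hb : b ∈ B) : setDist A B ≤ dist a b :=
  csInf_le ⟨0, by rintro _ ⟨a, _, b, _, rfl⟩; exact dist_nonneg⟩ ⟨a, ha, b, hb, rfl⟩

/-- A positive distance keeps y outside the ball. The point of the ball on the segment from x to y
is then at distance ‖y - x‖ - ρ from y. -/
lemma add_le_of_setDist_pos {E : Type*} [NormedAddCommGroup E] [NormedSpace ℝ E] {A : Set E}
    {x y : E} {ρ : ℝ} (hρ : 0 ≤ ρ) (hy : y ∈ A) (hD : 0 < setDist (Metric.closedBall x ρ) A) :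
    setDist (Metric.closedBall x ρ) A + ρ ≤ ‖y - x‖ := by
  rcases le_or_gt ‖y - x‖ ρ with h | h
  · have h1 : y ∈ Metric.closedBall x ρ := by rwa [mem_closedBall_iff_norm]
    have h2 := setDist_le h1 hy
    rw [dist_self] at h2
    linarith
  · have hpos : 0 < ‖y - x‖ := hρ.trans_lt h
    set c := ρ / ‖y - x‖ with hc
    have hc0 : 0 ≤ c := by positivity
    have hc1 : c ≤ 1 := (div_le_one hpos).2 h.le
    have hcm : c * ‖y - x‖ = ρ := div_mul_cancel₀ _ hpos.ne'
    have h1 : x + c • (y - x) ∈ Metric.closedBall x ρ := by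
      rw [mem_closedBall_iff_norm, add_sub_cancel_left, norm_smul, Real.norm_of_nonneg hc0, hcm]
    have h2 := setDist_le h1 hy
    have h3 : x + c • (y - x) - y = -((1 - c) • (y - x)) := by module
    rw [dist_eq_norm, h3, norm_neg, norm_smul, Real.norm_of_nonneg (by linarith)] at h2
    linarith

/-- There is a unit vector in `Ad (g⁻¹) 𝔪` on which `l ∘ Ad g` and `η` differ by at least the
distance from `η` to the orbit of `l`. -/
lemma exists_unit_vector {l : StrongDual ℝ 𝔤} {𝔪 : LieSubalgebra ℝ 𝔤} (h : IsPolarizing l 𝔪)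
    (η : StrongDual ℝ 𝔤) (g : 𝔤) {ρ : ℝ} (hρ : 0 ≤ ρ)
    (hD : 0 < setDist (Metric.closedBall η ρ) (coadjointOrbit l)) :
    ∃ Y : 𝔤, ‖Y‖ = 1 ∧ Ad g Y ∈ 𝔪 ∧
      setDist (Metric.closedBall η ρ) (coadjointOrbit l) + ρ ≤ |l (Ad g Y) - η Y| := by
  have : CompleteSpace 𝔤 := FiniteDimensional.complete ℝ 𝔤
  set D := setDist (Metric.closedBall η ρ) (coadjointOrbit l) with hDdef
  set f : StrongDual ℝ 𝔤 := LinearMap.toContinuousLinearMap ((l : 𝔤 →ₗ[ℝ] ℝ) ∘ₗ Ad g) - η with hf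
  have hfa : ∀ Y, f Y = l (Ad g Y) - η Y := fun Y => rfl
  set S : Submodule ℝ 𝔤 := 𝔪.toSubmodule.comap (Ad g) with hS
  set w0 : 𝔤 := (InnerProductSpace.toDual ℝ 𝔤).symm f with hw0
  -- The projection of the Riesz vector of l∘Ad(g) - η represents its restriction to Ad(g⁻¹)𝔪.
  -- Adding it to η gives a functional on the orbit, so ‖w‖ is at least the distance, and the unit
  -- vector along w attains ‖w‖.
  set w : 𝔤 := S.starProjection w0 with hw
  have hwS : w ∈ S := S.starProjection_apply_mem w0
  have hinner : ∀ s ∈ S, inner ℝ w s = f s := by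
    intro s hs
    have h1 := S.starProjection_inner_eq_zero w0 s hs
    rw [inner_sub_left, sub_eq_zero] at h1
    rw [← h1, hw0, InnerProductSpace.toDual_symm_apply]
  set l' : StrongDual ℝ 𝔤 := η + InnerProductSpace.toDual ℝ 𝔤 w with hl'
  have hmem : l' ∈ coadjointOrbit l := by
    refine mem_coadjointOrbit h g fun x hx => ?_
    have h1 : Ad (-g) x ∈ S := by
      change Ad g (Ad (-g) x) ∈ 𝔪
      rwa [Ad_Ad_neg]
    have h2 := hinner _ h1
    rw [hfa, Ad_Ad_neg] at h2
    change η (Ad (-g) x) + inner ℝ w (Ad (-g) x) = l x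
    rw [h2]; ring
  have hnorm : ‖l' - η‖ = ‖w‖ := by
    rw [hl', add_sub_cancel_left, LinearIsometryEquiv.norm_map]
  have hle := add_le_of_setDist_pos hρ hmem hD
  rw [hnorm] at hle
  have hwpos : 0 < ‖w‖ := by linarith
  refine ⟨‖w‖⁻¹ • w, ?_, ?_, ?_⟩
  · rw [norm_smul, norm_inv, norm_norm, inv_mul_cancel₀ hwpos.ne']
  · exact S.smul_mem _ hwS
  · have h1 : f (‖w‖⁻¹ • w) = ‖w‖ := by
      rw [map_smul, ← hinner w hwS, real_inner_self_eq_norm_sq, smul_eq_mul]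
      field_simp
    rw [← hfa, h1, abs_of_pos hwpos]
    exact hle

variable [MeasurableSpace 𝔤] [BorelSpace 𝔤]

lemma twistedDeriv_sum {ι : Type*} (s : Finset ι) (c : ι → ℝ) (Y : ι → 𝔤) (η : StrongDual ℝ 𝔤)
    (φ : 𝔤 → ℂ) (x : 𝔤) :
    twistedDeriv η (∑ i ∈ s, c i • Y i) φ x = ∑ i ∈ s, (c i : ℂ) * twistedDeriv η (Y i) φ x := by
  have h1 : leftField (∑ i ∈ s, c i • Y i) x - ∑ i ∈ s, c i • Y i =
      ∑ i ∈ s, c i • (leftField (Y i) x - Y i) := by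
    rw [leftField_sum, ← Finset.sum_sub_distrib]
    exact Finset.sum_congr rfl fun i _ => (smul_sub _ _ _).symm
  rw [twistedDeriv, h1, leftField_sum, map_sum, map_sum, Finset.sum_smul, Finset.mul_sum,
    ← Finset.sum_add_distrib]
  refine Finset.sum_congr rfl fun i _ => ?_
  rw [map_smul, map_smul, twistedDeriv]
  simp only [Complex.real_smul, smul_eq_mul]
  push_cast; ring

/-- The good direction Y varies with g. Expanding it in a fixed orthonormal basis, with coordinates
at most 1 in absolute value, replaces it by the finitely many operators of the basis, which can be
integrated over g. -/
lemma norm_transFourier_le {ι : Type*} [Fintype ι] (e : OrthonormalBasis ι ℝ 𝔤) {u : 𝔤 → ℂ}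
    {l : StrongDual ℝ 𝔤} {𝔪 : LieSubalgebra ℝ 𝔤} (hm : IsPolarizing l 𝔪)
    (hu : ∀ m ∈ 𝔪, ∀ g : 𝔤, u (bch m g) = Complex.exp (2 * Real.pi * Complex.I * (l m : ℂ)) * u g)
    {g : 𝔤} (hF : LocallyIntegrable fun x => u (bch g x)) {r : ℝ} {φ : 𝔤 → ℂ} (hφ : IsTest r φ)
    (η : StrongDual ℝ 𝔤) {ρ : ℝ} (hρ : 0 ≤ ρ)
    (hD : 0 < setDist (Metric.closedBall η ρ) (coadjointOrbit l)) :
    (setDist (Metric.closedBall η ρ) (coadjointOrbit l) + ρ) * ‖transFourier u η φ g‖ ≤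
      ∑ i, ‖transFourier u η (twistedDeriv η (e i) φ) g‖ := by
  obtain ⟨Y, hY1, hYm, hY⟩ := exists_unit_vector hm η g hρ hD
  have h1 := transFourier_twistedDeriv hu hF hYm hφ η
  have h2 : twistedDeriv η Y φ = fun x => ∑ i, (inner ℝ (e i) Y : ℂ) * twistedDeriv η (e i) φ x := by
    funext x
    conv_lhs => rw [← e.sum_repr' Y]
    exact twistedDeriv_sum _ _ _ _ _ _
  have h3 : transFourier u η (twistedDeriv η Y φ) g =
      ∑ i, ((inner ℝ (e i) Y : ℝ) : ℂ) * transFourier u η (twistedDeriv η (e i) φ) g := by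
    rw [h2, transFourier_sum hF _ fun i _ => (hφ.twistedDeriv η (e i)).const_mul _]
    exact Finset.sum_congr rfl fun i _ => transFourier_const_mul _ _ _
  have h4 : 2 * Real.pi * |l (Ad g Y) - η Y| * ‖transFourier u η φ g‖ ≤
      ∑ i, ‖transFourier u η (twistedDeriv η (e i) φ) g‖ := by
    have h5 := congrArg norm h1
    rw [norm_mul, norm_mul, norm_neg, h3, Complex.norm_real, Real.norm_eq_abs] at h5
    have h6 : ‖2 * (Real.pi : ℂ) * Complex.I‖ = 2 * Real.pi := by
      simp [abs_of_pos Real.pi_pos]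
    rw [h6] at h5
    rw [h5]
    refine (norm_sum_le _ _).trans (Finset.sum_le_sum fun i _ => ?_)
    rw [norm_mul, Complex.norm_real]
    refine mul_le_of_le_one_left (norm_nonneg _) ?_
    have := norm_inner_le_norm (𝕜 := ℝ) (e i) Y
    rwa [hY1, e.norm_eq_one, one_mul] at this
  refine le_trans ?_ h4
  -- The factor 2π is only used to be at least 1.
  refine mul_le_mul_of_nonneg_right (hY.trans ?_) (norm_nonneg _)
  have := Real.pi_gt_three
  nlinarith [abs_nonneg (l (Ad g Y) - η Y)]

end Pointwise

/-! ### Integration over `M \ G` -/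

section SquareIntegrable

variable {𝔤 : Type u} [MetricLieAlgebra 𝔤] [FiniteDimensional ℝ 𝔤] [LieRing.IsNilpotent 𝔤]
  [MeasurableSpace 𝔤] [BorelSpace 𝔤] {l : StrongDual ℝ 𝔤} {𝔪 : LieSubalgebra ℝ 𝔤} {k : ℕ}
  {X : Fin k → 𝔤} {u v : 𝔤 → ℂ}

lemma normInd_nonneg {k : ℕ} (X : Fin k → 𝔤) (u : 𝔤 → ℂ) : 0 ≤ normInd X u := Real.sqrt_nonneg _

lemma enorm_bch_of_mem (hu : u ∈ inducedSpace l 𝔪 X) {m : 𝔤} (hm : m ∈ 𝔪) (g : 𝔤) :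
    ‖u (bch m g)‖ₑ = ‖u g‖ₑ := by
  rw [hu.2.1 m hm g, enorm_mul]
  have : ‖Complex.exp (2 * Real.pi * Complex.I * (l m : ℂ))‖ = 1 := by
    rw [show 2 * Real.pi * Complex.I * (l m : ℂ) = ((2 * Real.pi * l m : ℝ) : ℂ) * Complex.I by
      push_cast; ring]
    exact Complex.norm_exp_ofReal_mul_I _
  rw [← ofReal_norm, this, ENNReal.ofReal_one, one_mul]

lemma lintegral_enorm_sq (hu : u ∈ inducedSpace l 𝔪 X) :
    ∫⁻ t, ‖u (cosetRep X t)‖ₑ ^ 2 = ENNReal.ofReal (normInd X u) ^ 2 := by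
  have h1 : ∀ t, ‖u (cosetRep X t)‖ₑ ^ 2 = ENNReal.ofReal (‖u (cosetRep X t)‖ ^ 2) := fun t => by
    rw [ENNReal.ofReal_pow (norm_nonneg _), ofReal_norm]
  simp only [h1]
  rw [← ofReal_integral_eq_lintegral_ofReal hu.2.2 (Filter.Eventually.of_forall fun t => by positivity),
    ← ENNReal.ofReal_pow (normInd_nonneg X u), normInd, Real.sq_sqrt]
  exact integral_nonneg fun t => by positivity

lemma lintegral_enorm_sq_bch (hX : IsMalcevBasisMod 𝔪 X) (hu : u ∈ inducedSpace l 𝔪 X) (x : 𝔤) :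
    ∫⁻ t, ‖u (bch (cosetRep X t) x)‖ₑ ^ 2 = ENNReal.ofReal (normInd X u) ^ 2 := by
  rw [← lintegral_enorm_sq hu]
  exact lintegral_cosetRep_bch hX (Φ := fun g => ‖u g‖ₑ ^ 2) (hu.1.enorm.pow_const 2)
    (fun m hm g => by rw [enorm_bch_of_mem hu hm]) x

lemma measurable_translate (hu : Measurable u) :
    Measurable fun p : (Fin k → ℝ) × 𝔤 => u (bch (cosetRep X p.1) p.2) :=
  hu.comp (((continuous_cosetRep X).comp continuous_fst).bch continuous_snd).measurable

lemma lintegral_mul_le_normInd (hX : IsMalcevBasisMod 𝔪 X) (hu : u ∈ inducedSpace l 𝔪 X)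
    (hv : v ∈ inducedSpace l 𝔪 X) (x : 𝔤) :
    ∫⁻ t, ‖u (bch (cosetRep X t) x)‖ₑ * ‖v (cosetRep X t)‖ₑ ≤
      ENNReal.ofReal (normInd X u) * ENNReal.ofReal (normInd X v) := by
  have hmu : Measurable fun t => ‖u (bch (cosetRep X t) x)‖ₑ :=
    ((measurable_translate hu.1).comp measurable_prodMk_right).enorm
  have hmv : Measurable fun t => ‖v (cosetRep X t)‖ₑ :=
    (hv.1.comp (continuous_cosetRep X).measurable).enorm
  have h := ENNReal.lintegral_mul_le_Lp_mul_Lq volume Real.HolderConjugate.two_two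
    hmu.aemeasurable hmv.aemeasurable
  have h2 : ∀ a : ENNReal, (a ^ 2) ^ (1 / 2 : ℝ) = a := fun a => by
    rw [← ENNReal.rpow_two, ← ENNReal.rpow_mul]; norm_num
  simp only [ENNReal.rpow_two] at h
  rw [lintegral_enorm_sq_bch hX hu x, lintegral_enorm_sq hv, h2, h2] at h
  exact h

/-- By invariance the square norm over M\G of each translate is the same, so Tonelli over a ball in
x gives local square integrability for almost every coset. This is needed to split and differentiate
the Fourier integral at a single g. -/
lemma ae_locallyIntegrable (hX : IsMalcevBasisMod 𝔪 X) (hu : u ∈ inducedSpace l 𝔪 X) :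
    ∀ᵐ t, LocallyIntegrable fun x => u (bch (cosetRep X t) x) := by
  have hm := measurable_translate (X := X) hu.1
  have h1 : ∀ n : ℕ, ∀ᵐ t, ∫⁻ x in Metric.closedBall (0 : 𝔤) n,
      ‖u (bch (cosetRep X t) x)‖ₑ ^ 2 < ⊤ := by
    intro n
    have hms : Measurable fun p : (Fin k → ℝ) × 𝔤 => ‖u (bch (cosetRep X p.1) p.2)‖ₑ ^ 2 :=
      hm.enorm.pow_const 2
    refine ae_lt_top hms.lintegral_prod_right' ?_
    rw [lintegral_lintegral_swap hms.aemeasurable]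
    simp only [lintegral_enorm_sq_bch hX hu, lintegral_const, Measure.restrict_apply_univ]
    exact ENNReal.mul_ne_top (ENNReal.pow_ne_top ENNReal.ofReal_ne_top)
      (isCompact_closedBall _ _).measure_lt_top.ne
  filter_upwards [ae_all_iff.2 h1] with t ht
  rw [locallyIntegrable_iff]
  intro K hK
  obtain ⟨R, hR⟩ := hK.isBounded.subset_closedBall (0 : 𝔤)
  obtain ⟨n, hn⟩ := exists_nat_ge R
  refine IntegrableOn.mono_set ?_ (hR.trans (Metric.closedBall_subset_closedBall hn))
  refine ⟨(hm.comp measurable_prodMk_left).aestronglyMeasurable, ?_⟩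
  have hle : ∀ a : ENNReal, a ≤ 1 + a ^ 2 := fun a => by
    rcases le_total a 1 with h | h
    · exact h.trans le_self_add
    · calc a = a * 1 := (mul_one a).symm
        _ ≤ a * a := by gcongr
        _ = a ^ 2 := (sq a).symm
        _ ≤ _ := le_add_self
  rw [hasFiniteIntegral_iff_enorm]
  refine (lintegral_mono fun x => hle _).trans_lt ?_
  rw [lintegral_add_left measurable_const]
  refine ENNReal.add_lt_top.2 ⟨?_, ht n⟩
  simp only [lintegral_const, Measure.restrict_apply_univ, one_mul]
  exact (isCompact_closedBall _ _).measure_lt_top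

end SquareIntegrable

/-! ### Matrix coefficients -/

section Pairing

variable {𝔤 : Type u} [MetricLieAlgebra 𝔤] [FiniteDimensional ℝ 𝔤] [LieRing.IsNilpotent 𝔤]
  [MeasurableSpace 𝔤] [BorelSpace 𝔤] {l : StrongDual ℝ 𝔤} {𝔪 : LieSubalgebra ℝ 𝔤} {k : ℕ}
  {X : Fin k → 𝔤} {u v : 𝔤 → ℂ} {r : ℝ} {φ ψ : 𝔤 → ℂ}

/-- The integral over `M \ G` of the absolute value of the Fourier integral of the translates of `u`,
times `|v|`. -/
def absPairing (X : Fin k → 𝔤) (u v : 𝔤 → ℂ) (η : StrongDual ℝ 𝔤) (φ : 𝔤 → ℂ) : ENNReal :=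
  ∫⁻ t, ‖transFourier u η φ (cosetRep X t)‖ₑ * ‖v (cosetRep X t)‖ₑ

lemma measurable_transFourier_cosetRep (hu : Measurable u) (hφ : IsTest r φ)
    (η : StrongDual ℝ 𝔤) : Measurable fun t => transFourier u η φ (cosetRep X t) := by
  have h : Measurable (Function.uncurry fun (t : Fin k → ℝ) x =>
      u (bch (cosetRep X t) x) * (φ x * expChar η x)) :=
    (measurable_translate hu).mul
      ((hφ.contDiff.continuous.mul (contDiff_expChar η).continuous).measurable.comp measurable_snd)
  exact (h.stronglyMeasurable.integral_prod_right (ν := volume)).measurable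

lemma measurable_absPairing_integrand (X : Fin k → 𝔤) (hu : Measurable u) (hv : Measurable v)
    (hφ : IsTest r φ) (η : StrongDual ℝ 𝔤) :
    Measurable fun t => ‖transFourier u η φ (cosetRep X t)‖ₑ * ‖v (cosetRep X t)‖ₑ :=
  (measurable_transFourier_cosetRep hu hφ η).enorm.mul
    (hv.comp (continuous_cosetRep X).measurable).enorm

lemma lintegral_lintegral_le (hX : IsMalcevBasisMod 𝔪 X) (hu : u ∈ inducedSpace l 𝔪 X)
    (hv : v ∈ inducedSpace l 𝔪 X) (hφ : IsTest r φ) :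
    ∫⁻ t, ∫⁻ x, ‖u (bch (cosetRep X t) x)‖ₑ * ‖φ x‖ₑ * ‖v (cosetRep X t)‖ₑ ≤
      ENNReal.ofReal (normInd X u * normInd X v * ∫ x, ‖φ x‖) := by
  have hmφ : Measurable fun x => ‖φ x‖ₑ := hφ.contDiff.continuous.measurable.enorm
  have hm : Measurable fun p : (Fin k → ℝ) × 𝔤 =>
      ‖u (bch (cosetRep X p.1) p.2)‖ₑ * ‖φ p.2‖ₑ * ‖v (cosetRep X p.1)‖ₑ :=
    ((measurable_translate hu.1).enorm.mul (hmφ.comp measurable_snd)).mul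
      (((hv.1.comp (continuous_cosetRep X).measurable).enorm).comp measurable_fst)
  rw [lintegral_lintegral_swap hm.aemeasurable]
  calc ∫⁻ x, ∫⁻ t, ‖u (bch (cosetRep X t) x)‖ₑ * ‖φ x‖ₑ * ‖v (cosetRep X t)‖ₑ
      ≤ ∫⁻ x, ENNReal.ofReal (normInd X u) * ENNReal.ofReal (normInd X v) * ‖φ x‖ₑ := by
        refine lintegral_mono fun x => ?_
        have h1 : ∀ t, ‖u (bch (cosetRep X t) x)‖ₑ * ‖φ x‖ₑ * ‖v (cosetRep X t)‖ₑ =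
            ‖u (bch (cosetRep X t) x)‖ₑ * ‖v (cosetRep X t)‖ₑ * ‖φ x‖ₑ := fun t => by ring
        simp only [h1]
        rw [lintegral_mul_const' _ _ enorm_ne_top]
        exact mul_le_mul_left (lintegral_mul_le_normInd hX hu hv x) _
    _ = _ := by
        rw [lintegral_const_mul _ hmφ, ENNReal.ofReal_mul (mul_nonneg (normInd_nonneg X u)
          (normInd_nonneg X v)), ENNReal.ofReal_mul (normInd_nonneg X u),
          ofReal_integral_norm_eq_lintegral_enorm hφ.integrable]

lemma enorm_transFourier_le (u : 𝔤 → ℂ) (η : StrongDual ℝ 𝔤) (φ : 𝔤 → ℂ) (g : 𝔤) :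
    ‖transFourier u η φ g‖ₑ ≤ ∫⁻ x, ‖u (bch g x)‖ₑ * ‖φ x‖ₑ := by
  refine (enorm_integral_le_lintegral_enorm _).trans (lintegral_mono fun x => ?_)
  rw [enorm_mul, enorm_mul, ← ofReal_norm (expChar η x), norm_expChar, ENNReal.ofReal_one, mul_one]

lemma absPairing_le (hX : IsMalcevBasisMod 𝔪 X) (hu : u ∈ inducedSpace l 𝔪 X)
    (hv : v ∈ inducedSpace l 𝔪 X) (hφ : IsTest r φ) (η : StrongDual ℝ 𝔤) :
    absPairing X u v η φ ≤ ENNReal.ofReal (normInd X u * normInd X v * ∫ x, ‖φ x‖) := by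
  refine le_trans (lintegral_mono fun t => ?_) (lintegral_lintegral_le hX hu hv hφ)
  rw [lintegral_mul_const' _ _ enorm_ne_top]
  exact mul_le_mul_left (enorm_transFourier_le u η φ _) _

lemma absPairing_ne_top (hX : IsMalcevBasisMod 𝔪 X) (hu : u ∈ inducedSpace l 𝔪 X)
    (hv : v ∈ inducedSpace l 𝔪 X) (hφ : IsTest r φ) (η : StrongDual ℝ 𝔤) :
    absPairing X u v η φ ≠ ⊤ :=
  ((absPairing_le hX hu hv hφ η).trans_lt ENNReal.ofReal_lt_top).ne

lemma absPairing_toReal_le (hX : IsMalcevBasisMod 𝔪 X) (hu : u ∈ inducedSpace l 𝔪 X)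
    (hv : v ∈ inducedSpace l 𝔪 X) (hφ : IsTest r φ) (η : StrongDual ℝ 𝔤) :
    (absPairing X u v η φ).toReal ≤ normInd X u * normInd X v * ∫ x, ‖φ x‖ :=
  ENNReal.toReal_le_of_le_ofReal (mul_nonneg (mul_nonneg (normInd_nonneg X u) (normInd_nonneg X v))
    (integral_nonneg fun _ => norm_nonneg _)) (absPairing_le hX hu hv hφ η)

lemma absPairing_add (hX : IsMalcevBasisMod 𝔪 X) (hu : u ∈ inducedSpace l 𝔪 X)
    (hv : v ∈ inducedSpace l 𝔪 X) (hφ : IsTest r φ) (hψ : IsTest r ψ) (η : StrongDual ℝ 𝔤) :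
    (absPairing X u v η fun x => φ x + ψ x).toReal ≤
      (absPairing X u v η φ).toReal + (absPairing X u v η ψ).toReal := by
  have h1 := absPairing_ne_top hX hu hv hφ η
  have h2 := absPairing_ne_top hX hu hv hψ η
  rw [← ENNReal.toReal_add h1 h2]
  refine ENNReal.toReal_mono (ENNReal.add_ne_top.2 ⟨h1, h2⟩) ?_
  rw [absPairing, absPairing, absPairing, ← lintegral_add_left
    (measurable_absPairing_integrand X hu.1 hv.1 hφ η)]
  refine lintegral_mono_ae ?_
  filter_upwards [ae_locallyIntegrable hX hu] with t ht
  rw [transFourier_add ht hφ hψ, ← add_mul]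
  exact mul_le_mul_left (enorm_add_le _ _) _

lemma absPairing_const_mul (c : ℂ) (φ : 𝔤 → ℂ) (η : StrongDual ℝ 𝔤) :
    (absPairing X u v η fun x => c * φ x).toReal = ‖c‖ * (absPairing X u v η φ).toReal := by
  have h : (absPairing X u v η fun x => c * φ x) = ‖c‖ₑ * absPairing X u v η φ := by
    rw [absPairing, absPairing, ← lintegral_const_mul' _ _ enorm_ne_top]
    refine lintegral_congr fun t => ?_
    rw [transFourier_const_mul, enorm_mul, mul_assoc]
  rw [h, ENNReal.toReal_mul, toReal_enorm]

/-- Integrating the pointwise inequality against |v| removes the dependence on g. Since the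
left-hand factor is constant, the result is a closed inequality for a sublinear functional of φ,
ready to be iterated. -/
lemma mul_absPairing_le {ι : Type*} [Fintype ι] (e : OrthonormalBasis ι ℝ 𝔤)
    (hm : IsPolarizing l 𝔪) (hX : IsMalcevBasisMod 𝔪 X) (hu : u ∈ inducedSpace l 𝔪 X)
    (hv : v ∈ inducedSpace l 𝔪 X) (hφ : IsTest r φ) (η : StrongDual ℝ 𝔤) {ρ : ℝ} (hρ : 0 ≤ ρ)
    (hD : 0 < setDist (Metric.closedBall η ρ) (coadjointOrbit l)) :
    (setDist (Metric.closedBall η ρ) (coadjointOrbit l) + ρ) * (absPairing X u v η φ).toReal ≤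
      ∑ i, (absPairing X u v η (twistedDeriv η (e i) φ)).toReal := by
  set H := setDist (Metric.closedBall η ρ) (coadjointOrbit l) + ρ with hH
  have hH0 : 0 ≤ H := by positivity
  have htop : ∀ i, absPairing X u v η (twistedDeriv η (e i) φ) ≠ ⊤ := fun i =>
    absPairing_ne_top hX hu hv (hφ.twistedDeriv η (e i)) η
  rw [← ENNReal.toReal_sum fun i _ => htop i]
  have h1 : ENNReal.ofReal H * absPairing X u v η φ ≤
      ∑ i, absPairing X u v η (twistedDeriv η (e i) φ) := by
    simp only [absPairing]
    rw [← lintegral_const_mul' _ _ ENNReal.ofReal_ne_top, ← lintegral_finsetSum _ fun i _ =>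
      measurable_absPairing_integrand X hu.1 hv.1 (hφ.twistedDeriv η (e i)) η]
    refine lintegral_mono_ae ?_
    filter_upwards [ae_locallyIntegrable hX hu] with t ht
    rw [← mul_assoc, ← Finset.sum_mul]
    refine mul_le_mul_left ?_ _
    have h2 := ENNReal.ofReal_le_ofReal (norm_transFourier_le e hm hu.2.1 ht hφ η hρ hD)
    rw [ENNReal.ofReal_mul hH0, ofReal_norm,
      ENNReal.ofReal_sum_of_nonneg fun i _ => norm_nonneg _] at h2
    simpa only [ofReal_norm] using h2
  have h2 := ENNReal.toReal_mono (ENNReal.sum_ne_top.2 fun i _ => htop i) h1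
  rwa [ENNReal.toReal_mul, ENNReal.toReal_ofReal hH0] at h2

lemma integrable_coefficient (hX : IsMalcevBasisMod 𝔪 X) (hu : u ∈ inducedSpace l 𝔪 X)
    (hv : v ∈ inducedSpace l 𝔪 X) (hφ : IsTest r φ) (η : StrongDual ℝ 𝔤) :
    Integrable (Function.uncurry fun (t : Fin k → ℝ) (x : 𝔤) =>
      u (bch (cosetRep X t) x) * (φ x * expChar η x) * starRingEnd ℂ (v (cosetRep X t)))
      (volume.prod volume) := by
  have hm : Measurable (Function.uncurry fun (t : Fin k → ℝ) (x : 𝔤) =>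
      u (bch (cosetRep X t) x) * (φ x * expChar η x) * starRingEnd ℂ (v (cosetRep X t))) :=
    ((measurable_translate hu.1).mul ((hφ.contDiff.continuous.mul
      (contDiff_expChar η).continuous).measurable.comp measurable_snd)).mul
      ((Complex.continuous_conj.measurable.comp
        (hv.1.comp (continuous_cosetRep X).measurable)).comp measurable_fst)
  refine ⟨hm.aestronglyMeasurable, ?_⟩
  rw [hasFiniteIntegral_iff_enorm, lintegral_prod _ hm.enorm.aemeasurable]
  refine lt_of_le_of_lt (le_of_eq ?_) ((lintegral_lintegral_le hX hu hv hφ).trans_lt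
    ENNReal.ofReal_lt_top)
  refine lintegral_congr fun t => lintegral_congr fun x => ?_
  simp only [Function.uncurry_apply_pair, enorm_mul]
  rw [← ofReal_norm (expChar η x), norm_expChar, ENNReal.ofReal_one, mul_one,
    ← ofReal_norm (starRingEnd ℂ _), RCLike.norm_conj, ofReal_norm]

lemma fourierInt_innerInd (hX : IsMalcevBasisMod 𝔪 X) (hu : u ∈ inducedSpace l 𝔪 X)
    (hv : v ∈ inducedSpace l 𝔪 X) (hφ : IsTest r φ) (η : StrongDual ℝ 𝔤) :
    fourierInt (fun x => innerInd X (inducedRep x u) v) φ η =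
      ∫ t, transFourier u η φ (cosetRep X t) * starRingEnd ℂ (v (cosetRep X t)) := by
  simp only [transFourier, ← integral_mul_const]
  rw [integral_integral_swap (integrable_coefficient hX hu hv hφ η), fourierInt]
  refine integral_congr_ae (Filter.Eventually.of_forall fun x => ?_)
  simp only [innerInd, inducedRep]
  rw [mul_assoc, ← integral_mul_const]
  refine integral_congr_ae (Filter.Eventually.of_forall fun t => ?_)
  simp only [expChar]
  ring

lemma norm_fourierInt_le (hX : IsMalcevBasisMod 𝔪 X) (hu : u ∈ inducedSpace l 𝔪 X)
    (hv : v ∈ inducedSpace l 𝔪 X) (hφ : IsTest r φ) (η : StrongDual ℝ 𝔤) :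
    ‖fourierInt (fun x => innerInd X (inducedRep x u) v) φ η‖ ≤ (absPairing X u v η φ).toReal := by
  rw [fourierInt_innerInd hX hu hv hφ, ← toReal_enorm]
  refine ENNReal.toReal_mono (absPairing_ne_top hX hu hv hφ η)
    ((enorm_integral_le_lintegral_enorm _).trans_eq (lintegral_congr fun t => ?_))
  rw [enorm_mul, ← ofReal_norm (starRingEnd ℂ _), RCLike.norm_conj, ofReal_norm]

end Pairing

/-! ### Iteration -/

section Iteration

variable {𝔤 : Type u} [MetricLieAlgebra 𝔤] [FiniteDimensional ℝ 𝔤] [LieRing.IsNilpotent 𝔤]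
  [MeasurableSpace 𝔤] [BorelSpace 𝔤] {ι : Type*} [Fintype ι]

lemma sobL1_const_mul {r : ℝ} {φ : 𝔤 → ℂ} (hφ : IsTest r φ) (c : ℂ) (j : ℕ) :
    sobL1 j (fun x => c * φ x) = ‖c‖ * sobL1 j φ := by
  rw [sobL1, sobL1, Finset.mul_sum]
  refine Finset.sum_congr rfl fun i _ => ?_
  rw [← integral_const_mul]
  refine integral_congr_ae (Filter.Eventually.of_forall fun x => ?_)
  change ‖iteratedFDeriv ℝ i (c • φ) x‖ = _
  rw [iteratedFDeriv_const_smul_apply (hφ.contDiff.contDiffAt.of_le (by exact_mod_cast le_top)),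
    norm_smul]

lemma exists_sobL1_leftField_le (e : OrthonormalBasis ι ℝ 𝔤) (Y : 𝔤) (j : ℕ) :
    ∃ C : ℝ, 0 ≤ C ∧ ∀ φ : 𝔤 → ℂ, IsTest 1 φ →
      sobL1 j (fun x => fderiv ℝ φ x (leftField Y x)) ≤ C * sobL1 (j + 1) φ := by
  have ha : ∀ i, ContDiff ℝ ∞ fun x => (inner ℝ (e i) (leftField Y x) : ℝ) := fun i =>
    contDiff_const.inner ℝ (contDiff_leftField Y)
  choose C hC0 hC using fun i => exists_sobL1_smul_le (ha i) j
  refine ⟨∑ i, C i, Finset.sum_nonneg fun i _ => hC0 i, fun φ hφ => ?_⟩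
  have h1 : (fun x => fderiv ℝ φ x (leftField Y x)) = fun x => ∑ i,
      (inner ℝ (e i) (leftField Y x) : ℝ) • fderiv ℝ φ x (e i) := by
    funext x
    conv_lhs => rw [← e.sum_repr' (leftField Y x)]
    rw [map_sum]
    exact Finset.sum_congr rfl fun i _ => map_smul _ _ _
  rw [h1, Finset.sum_mul]
  refine (sobL1_sum _ (fun i _ => (hφ.dirDeriv (e i)).smul (ha i)) j).trans
    (Finset.sum_le_sum fun i _ => ((hC i _ (hφ.dirDeriv (e i))).trans ?_))
  refine mul_le_mul_of_nonneg_left ?_ (hC0 i)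
  simpa using sobL1_dirDeriv hφ (e i) j

/-- The coordinates of field minus Y vanish at 0 and do not involve η, which enters only linearly.
So one radius serves all η, with ‖η‖ as an explicit factor. -/
lemma eventually_sobL1_le [Nontrivial 𝔤] (e : OrthonormalBasis ι ℝ 𝔤) (Y : 𝔤) (j : ℕ) {θ : ℝ}
    (hθ : 0 < θ) :
    ∀ᶠ r in 𝓝[>] (0 : ℝ), ∀ φ : 𝔤 → ℂ, IsTest r φ → ∀ η : StrongDual ℝ 𝔤,
      sobL1 j (fun x => η (leftField Y x - Y) • φ x) ≤ ‖η‖ * θ * sobL1 j φ := by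
  set θ' : ℝ := θ / (Fintype.card ι + 1) with hθ'
  have hθ'0 : 0 < θ' := by positivity
  have ha : ∀ i, ContDiff ℝ ∞ fun x => (inner ℝ (e i) (leftField Y x - Y) : ℝ) := fun i =>
    contDiff_const.inner ℝ ((contDiff_leftField Y).sub contDiff_const)
  have h1 : ∀ᶠ r in 𝓝[>] (0 : ℝ), ∀ i, ∀ φ : 𝔤 → ℂ, IsTest r φ →
      sobL1 j (fun x => (inner ℝ (e i) (leftField Y x - Y) : ℝ) • φ x) ≤ θ' * sobL1 j φ := by
    refine Filter.eventually_all.2 fun i => ?_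
    obtain ⟨r, hr, -, h⟩ := exists_sobL1_smul_le_small (ha i)
      (by rw [leftField_zero, sub_self, inner_zero_right]) j hθ'0
    filter_upwards [Ioc_mem_nhdsGT hr] with r' hr' φ hφ using h φ (hφ.mono hr'.2)
  filter_upwards [h1] with r hr φ hφ η
  have h2 : (fun x => η (leftField Y x - Y) • φ x) = fun x => ∑ i, ((η (e i) : ℝ) : ℂ) *
      ((inner ℝ (e i) (leftField Y x - Y) : ℝ) • φ x) := by
    funext x
    conv_lhs => rw [← e.sum_repr' (leftField Y x - Y)]
    rw [map_sum, Finset.sum_smul]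
    refine Finset.sum_congr rfl fun i _ => ?_
    rw [map_smul]
    simp only [Complex.real_smul, smul_eq_mul]
    push_cast; ring
  rw [h2]
  refine (sobL1_sum _ (fun i _ => (hφ.smul (ha i)).const_mul _) j).trans ?_
  calc _ ≤ ∑ i : ι, ‖η‖ * (θ' * sobL1 j φ) := by
        refine Finset.sum_le_sum fun i _ => ?_
        rw [sobL1_const_mul (hφ.smul (ha i)), Complex.norm_real]
        refine mul_le_mul ?_ (hr i φ hφ) (sobL1_nonneg _ _) (norm_nonneg _)
        simpa using η.le_opNorm (e i)
    _ = ‖η‖ * (Fintype.card ι * θ') * sobL1 j φ := by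
        rw [Finset.sum_const, Finset.card_univ, nsmul_eq_mul]; ring
    _ ≤ _ := by
        refine mul_le_mul_of_nonneg_right (mul_le_mul_of_nonneg_left ?_ (norm_nonneg _))
          (sobL1_nonneg _ _)
        rw [hθ', mul_div_assoc', div_le_iff₀ (by positivity)]
        nlinarith

/-- Iteration of an inequality that gains one derivative, up to a small error of order zero. -/
lemma le_sobL1_of_twistedDeriv (e : OrthonormalBasis ι ℝ 𝔤) {r C θ A H ε : ℝ} {η : StrongDual ℝ 𝔤}
    {N : ℕ} {p : (𝔤 → ℂ) → ℝ} (hC : 0 ≤ C) (hA : 0 ≤ A) (hH : 0 < H)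
    (hηH : ε * ‖η‖ ≤ H) (hθ : 4 * Real.pi * Fintype.card ι * θ ≤ ε)
    (hderiv : ∀ φ, IsTest r φ → ∀ i, ∀ j ≤ N,
      sobL1 j (fun x => fderiv ℝ φ x (leftField (e i) x)) ≤ C * sobL1 (j + 1) φ)
    (hsmall : ∀ φ, IsTest r φ → ∀ i, ∀ j ≤ N,
      sobL1 j (fun x => η (leftField (e i) x - e i) • φ x) ≤ ‖η‖ * θ * sobL1 j φ)
    (hadd : ∀ φ ψ, IsTest r φ → IsTest r ψ → p (fun x => φ x + ψ x) ≤ p φ + p ψ)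
    (hmul : ∀ (c : ℂ) φ, p (fun x => c * φ x) = ‖c‖ * p φ)
    (hp0 : ∀ φ, IsTest r φ → p φ ≤ A * sobL1 0 φ)
    (hp : ∀ φ, IsTest r φ → H * p φ ≤ ∑ i, p (twistedDeriv η (e i) φ)) :
    ∀ j ≤ N, ∀ φ, IsTest r φ → p φ ≤ A * (2 * Fintype.card ι * C / H) ^ j * sobL1 j φ := by
  intro j
  induction j with
  | zero => intro _ φ hφ; simpa using hp0 φ hφ
  | succ j ih =>
    intro hj φ0 hφ0
    set B : ℝ := A * (2 * Fintype.card ι * C / H) ^ j with hB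
    have hB0 : 0 ≤ B := by positivity
    set c : ℝ := Fintype.card ι * C * B / H with hc
    -- The error term is p of another test function, not of φ, and cannot be absorbed directly.
    -- Instead a bound valid for all test functions is improved repeatedly: a bound q becomes c +
    -- q/2, starting from a bound by A. The limit is the fixed point 2c.
    have key : ∀ m : ℕ, ∀ φ, IsTest r φ → p φ ≤ (2 * c + A * (1 / 2) ^ m) * sobL1 (j + 1) φ := by
      intro m
      induction m with
      | zero =>
        intro φ hφ
        refine (hp0 φ hφ).trans ?_
        have h1 := sobL1_mono (Nat.zero_le (j + 1)) φ
        have h2 : 0 ≤ c := by positivity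
        have h3 := sobL1_nonneg (j + 1) φ
        rw [pow_zero, mul_one, add_mul]
        nlinarith [mul_nonneg h2 h3]
      | succ m ihm =>
        intro φ hφ
        set q : ℝ := 2 * c + A * (1 / 2) ^ m with hq
        have hq0 : 0 ≤ q := by positivity
        set S := sobL1 (j + 1) φ with hS
        have hS0 : 0 ≤ S := sobL1_nonneg _ _
        have h1 : ∀ i, p (twistedDeriv η (e i) φ) ≤ (C * B + 2 * Real.pi * q * (‖η‖ * θ)) * S := by
          intro i
          have ht := hφ.smul (contDiff_apply_leftField_sub η (e i))
          have h2 := hadd _ _ (hφ.fderiv_leftField (e i)) (ht.const_mul (-(2 * Real.pi * Complex.I)))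
          have h3 : p (fun x => fderiv ℝ φ x (leftField (e i) x)) ≤ B * (C * S) :=
            (ih (by omega) _ (hφ.fderiv_leftField (e i))).trans
              (mul_le_mul_of_nonneg_left (hderiv φ hφ i j (by omega)) hB0)
          have h4 : p (fun x => η (leftField (e i) x - e i) • φ x) ≤ q * (‖η‖ * θ * S) :=
            (ihm _ ht).trans (mul_le_mul_of_nonneg_left (hsmall φ hφ i (j + 1) hj) hq0)
          have h5 : ‖-(2 * (Real.pi : ℂ) * Complex.I)‖ = 2 * Real.pi := by
            simp [abs_of_pos Real.pi_pos]
          rw [hmul, h5] at h2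
          have h6 := mul_le_mul_of_nonneg_left h4 (by positivity : 0 ≤ 2 * Real.pi)
          refine h2.trans ?_
          nlinarith
        have h2 : H * p φ ≤ Fintype.card ι * ((C * B + 2 * Real.pi * q * (‖η‖ * θ)) * S) := by
          refine (hp φ hφ).trans ((Finset.sum_le_sum fun i _ => h1 i).trans_eq ?_)
          rw [Finset.sum_const, Finset.card_univ, nsmul_eq_mul]
        -- The choice of θ makes the error of all basis directions together at most ε‖η‖/2 ≤ H/2.
        -- This gives the factor 1/2 in the recursion.
        have h3 : Fintype.card ι * (2 * Real.pi * (‖η‖ * θ)) ≤ H / 2 := by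
          have h4 := mul_le_mul_of_nonneg_right hθ (norm_nonneg η)
          nlinarith
        have h4 : H * p φ ≤ H * ((c + q / 2) * S) := by
          refine h2.trans ?_
          have h5 : H * c = Fintype.card ι * C * B := by
            rw [hc]; field_simp
          have h6 := mul_le_mul_of_nonneg_right h3 (mul_nonneg hq0 hS0)
          nlinarith
        have h5 := le_of_mul_le_mul_left h4 hH
        refine h5.trans_eq ?_
        rw [hq, pow_succ]; ring
    have hlim : Filter.Tendsto (fun m : ℕ => (2 * c + A * (1 / 2 : ℝ) ^ m) * sobL1 (j + 1) φ0)
        Filter.atTop (𝓝 ((2 * c + A * 0) * sobL1 (j + 1) φ0)) :=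
      ((tendsto_const_nhds.add ((tendsto_pow_atTop_nhds_zero_of_lt_one (by norm_num)
        (by norm_num)).const_mul A)).mul_const _)
    have h1 := ge_of_tendsto' hlim fun m => key m φ0 hφ0
    refine h1.trans_eq ?_
    rw [hc, hB, pow_succ]; ring

end Iteration

/-! ### The estimate -/

section Estimate

variable {𝔤 : Type u} [MetricLieAlgebra 𝔤] [FiniteDimensional ℝ 𝔤] [LieRing.IsNilpotent 𝔤]
  [MeasurableSpace 𝔤] [BorelSpace 𝔤]

lemma japaneseBracket_zero : japaneseBracket 0 = 1 := by simp [japaneseBracket]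

lemma japaneseBracket_pos (x : ℝ) : 0 < japaneseBracket x := Real.sqrt_pos.2 (by positivity)

lemma japaneseBracket_pow_le {x : ℝ} (hx : 0 ≤ x) (N : ℕ) :
    japaneseBracket x ^ N ≤ 2 ^ N * (1 + x ^ N) := by
  have h1 : japaneseBracket x ≤ 1 + x :=
    Real.sqrt_le_iff.2 ⟨by positivity, by nlinarith⟩
  calc japaneseBracket x ^ N ≤ (1 + x) ^ N := pow_le_pow_left₀ (japaneseBracket_pos x).le h1 N
    _ ≤ 2 ^ (N - 1) * (1 ^ N + x ^ N) := add_pow_le zero_le_one hx N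
    _ ≤ 2 ^ N * (1 + x ^ N) := by
        rw [one_pow]
        exact mul_le_mul_of_nonneg_right (pow_le_pow_right₀ one_le_two (Nat.sub_le N 1))
          (by positivity)

/-- The estimate for one matrix coefficient, where the distance is positive. -/
lemma eventually_absPairing_le [Nontrivial 𝔤] {n : ℕ} (hn : Module.finrank ℝ 𝔤 = n) (N : ℕ) {ε : ℝ}
    (hε : 0 < ε) :
    ∃ r : ℝ, 0 < r ∧ ∀ (b : OrthonormalBasis (Fin n) ℝ 𝔤) (φ : 𝔤 → ℂ), IsTest r φ →
      ∀ (l η : StrongDual ℝ 𝔤) (𝔪 : LieSubalgebra ℝ 𝔤), IsPolarizing l 𝔪 →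
      0 < setDist (Metric.closedBall η (ε * ‖η‖)) (coadjointOrbit l) →
      ∀ (k : ℕ) (X : Fin k → 𝔤), IsMalcevBasisMod 𝔪 X →
      ∀ u ∈ inducedSpace l 𝔪 X, ∀ v ∈ inducedSpace l 𝔪 X,
        japaneseBracket (setDist (Metric.closedBall η (ε * ‖η‖)) (coadjointOrbit l)) ^ N *
          (absPairing X u v η φ).toReal ≤
        normInd X u * normInd X v * sobolevNorm b (N + n) φ := by
  have hnpos : 0 < n := by rw [← hn]; exact Module.finrank_pos
  have hn0 : (0 : ℝ) < n := by exact_mod_cast hnpos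
  set e := (stdOrthonormalBasis ℝ 𝔤).reindex (finCongr hn) with he
  choose C' hC'0 hC' using fun (i : Fin n) (j : Fin (N + 1)) =>
    exists_sobL1_leftField_le e (e i) (j : ℕ)
  set C := ∑ i, ∑ j, C' i j with hC
  have hC0 : 0 ≤ C := Finset.sum_nonneg fun i _ => Finset.sum_nonneg fun j _ => hC'0 i j
  have hCle : ∀ i j, C' i j ≤ C := fun i j =>
    (Finset.single_le_sum (f := fun j => C' i j) (fun j _ => hC'0 i j) (Finset.mem_univ j)).trans
      (Finset.single_le_sum (f := fun i => ∑ j, C' i j)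
        (fun i _ => Finset.sum_nonneg fun j _ => hC'0 i j) (Finset.mem_univ i))
  -- This is the largest θ permitted by the absorption condition 4πnθ ≤ ε.
  set θ : ℝ := ε / (4 * Real.pi * n) with hθ
  have hθ0 : 0 < θ := by positivity
  have hsm : ∀ᶠ r in 𝓝[>] (0 : ℝ), ∀ (i : Fin n) (j : Fin (N + 1)), ∀ φ : 𝔤 → ℂ, IsTest r φ →
      ∀ η : StrongDual ℝ 𝔤, sobL1 (j : ℕ) (fun x => η (leftField (e i) x - e i) • φ x) ≤
        ‖η‖ * θ * sobL1 (j : ℕ) φ :=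
    Filter.eventually_all.2 fun i => Filter.eventually_all.2 fun j =>
      eventually_sobL1_le e (e i) (j : ℕ) hθ0
  set Q : ℝ := 2 * n * C with hQ
  have hQ0 : 0 ≤ Q := by positivity
  -- M collects every constant of the final chain: the passage to the bracket, the N rounds, the
  -- factor 3 of the Poincaré inequality, and the comparison of Sobolev norms. The radius is then
  -- chosen with rM ≤ 1.
  set M : ℝ := 2 ^ N * (1 + Q ^ N) * (3 * ∑ i ∈ Finset.range (N + n + 1), (n : ℝ) ^ i) with hM
  have hM0 : 0 ≤ M := by positivity
  have hev : ∀ᶠ r in 𝓝[>] (0 : ℝ), r ∈ Set.Ioc (0 : ℝ) (min 1 (1 / (M + 1))) :=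
    Ioc_mem_nhdsGT (by positivity)
  obtain ⟨r, hr, hrI⟩ := (hsm.and hev).exists
  have hr0 : 0 < r := hrI.1
  have hr1 : r ≤ 1 := hrI.2.trans (min_le_left _ _)
  have hrM : r * M ≤ 1 := by
    have h1 := hrI.2.trans (min_le_right _ _)
    rw [le_div_iff₀ (by positivity)] at h1
    nlinarith
  refine ⟨r, hr0, fun b φ hφ l η 𝔪 hm hD k X hX u hu v hv => ?_⟩
  set D := setDist (Metric.closedBall η (ε * ‖η‖)) (coadjointOrbit l) with hDdef
  set A := normInd X u * normInd X v with hA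
  have hA0 : 0 ≤ A := mul_nonneg (normInd_nonneg X u) (normInd_nonneg X v)
  have hρ : 0 ≤ ε * ‖η‖ := by positivity
  set H := D + ε * ‖η‖ with hH
  have hH0 : 0 < H := by positivity
  have hDH : D ≤ H := le_add_of_nonneg_right hρ
  have hp0 : ∀ φ, IsTest r φ → (absPairing X u v η φ).toReal ≤ A * sobL1 0 φ := fun φ hφ => by
    rw [sobL1_zero]; exact absPairing_toReal_le hX hu hv hφ η
  have hmain := le_sobL1_of_twistedDeriv e (r := r) (C := C) (θ := θ) (A := A) (H := H) (ε := ε)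
    (η := η) (N := N) (p := fun φ => (absPairing X u v η φ).toReal) hC0 hA0 hH0
    (le_add_of_nonneg_left hD.le) (by
      rw [Fintype.card_fin, hθ]; exact (mul_div_cancel₀ _ (by positivity)).le)
    (fun φ hφ i j hj => (hC' i ⟨j, Nat.lt_succ_of_le hj⟩ φ (hφ.mono hr1)).trans
      (mul_le_mul_of_nonneg_right (hCle _ _) (sobL1_nonneg _ _)))
    (fun φ hφ i j hj => hr i ⟨j, Nat.lt_succ_of_le hj⟩ φ hφ η)
    (fun φ ψ hφ hψ => absPairing_add hX hu hv hφ hψ η)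
    (fun c φ => absPairing_const_mul c φ η) hp0
    (fun φ hφ => mul_absPairing_le e hm hX hu hv hφ η hρ hD) N le_rfl φ hφ
  rw [Fintype.card_fin, ← hQ, div_pow] at hmain
  set P := (absPairing X u v η φ).toReal with hP
  have hP0 : 0 ≤ P := ENNReal.toReal_nonneg
  have hS0 := sobL1_nonneg N φ
  have h1 : P ≤ A * sobL1 N φ :=
    (hp0 φ hφ).trans (mul_le_mul_of_nonneg_left (sobL1_mono (Nat.zero_le N) φ) hA0)
  have h2 : D ^ N * P ≤ A * (Q ^ N * sobL1 N φ) := by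
    have h3 : H ^ N * P ≤ A * (Q ^ N * sobL1 N φ) := by
      refine (mul_le_mul_of_nonneg_left hmain (by positivity)).trans_eq ?_
      have : H ^ N ≠ 0 := pow_ne_zero _ hH0.ne'
      field_simp
    exact (mul_le_mul_of_nonneg_right (pow_le_pow_left₀ hD.le hDH N) hP0).trans h3
  have h3 : sobL1 N φ ≤ r * (3 * ∑ i ∈ Finset.range (N + n + 1), (n : ℝ) ^ i) *
      sobolevNorm b (N + n) φ := by
    -- The spare derivative exists because n ≥ 1, so N + 1 ≤ N + n. It pays for the factor r.
    calc sobL1 N φ ≤ 3 * r * sobL1 (N + 1) φ := sobL1_le_succ hφ hr0 N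
      _ ≤ 3 * r * sobL1 (N + n) φ :=
          mul_le_mul_of_nonneg_left (sobL1_mono (by omega) φ) (by positivity)
      _ ≤ 3 * r * ((∑ i ∈ Finset.range (N + n + 1), (n : ℝ) ^ i) * sobolevNorm b (N + n) φ) :=
          mul_le_mul_of_nonneg_left (sobL1_le_sobolevNorm b hφ (N + n)) (by positivity)
      _ = _ := by ring
  have hsob : 0 ≤ sobolevNorm b (N + n) φ :=
    (integral_nonneg fun _ => norm_nonneg _).trans
      (integral_norm_le_sobolevNorm_zero b hφ.contDiff (N + n))
  calc japaneseBracket D ^ N * P ≤ 2 ^ N * (1 + D ^ N) * P :=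
        mul_le_mul_of_nonneg_right (japaneseBracket_pow_le hD.le N) hP0
    _ = 2 ^ N * (P + D ^ N * P) := by ring
    _ ≤ 2 ^ N * (A * sobL1 N φ + A * (Q ^ N * sobL1 N φ)) :=
        mul_le_mul_of_nonneg_left (add_le_add h1 h2) (by positivity)
    _ = A * (2 ^ N * (1 + Q ^ N)) * sobL1 N φ := by ring
    _ ≤ A * (2 ^ N * (1 + Q ^ N)) * (r * (3 * ∑ i ∈ Finset.range (N + n + 1), (n : ℝ) ^ i) *
          sobolevNorm b (N + n) φ) := mul_le_mul_of_nonneg_left h3 (by positivity)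
    _ = A * ((r * M) * sobolevNorm b (N + n) φ) := by rw [hM]; ring
    _ ≤ A * (1 * sobolevNorm b (N + n) φ) := by gcongr
    _ = _ := by rw [one_mul]

/-- The estimate for one matrix coefficient. -/
lemma exists_radius {n : ℕ} (hn : Module.finrank ℝ 𝔤 = n) (N : ℕ) {ε : ℝ} (hε : 0 < ε) :
    ∃ r : ℝ, 0 < r ∧ ∀ (b : OrthonormalBasis (Fin n) ℝ 𝔤) (φ : 𝔤 → ℂ), IsTest r φ →
      ∀ (l η : StrongDual ℝ 𝔤) (𝔪 : LieSubalgebra ℝ 𝔤), IsPolarizing l 𝔪 →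
      ∀ (k : ℕ) (X : Fin k → 𝔤), IsMalcevBasisMod 𝔪 X →
      ∀ u ∈ inducedSpace l 𝔪 X, ∀ v ∈ inducedSpace l 𝔪 X,
        ‖fourierInt (fun x => innerInd X (inducedRep x u) v) φ η‖ ≤
          normInd X u * normInd X v * sobolevNorm b (N + n) φ *
            japaneseBracket (setDist (Metric.closedBall η (ε * ‖η‖)) (coadjointOrbit l))
              ^ (-(N : ℤ)) := by
  have hzero : ∀ (r : ℝ) (b : OrthonormalBasis (Fin n) ℝ 𝔤) (φ : 𝔤 → ℂ), IsTest r φ →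
      ∀ (l η : StrongDual ℝ 𝔤) (𝔪 : LieSubalgebra ℝ 𝔤) (D : ℝ), D = 0 →
      ∀ (k : ℕ) (X : Fin k → 𝔤), IsMalcevBasisMod 𝔪 X →
      ∀ u ∈ inducedSpace l 𝔪 X, ∀ v ∈ inducedSpace l 𝔪 X,
        ‖fourierInt (fun x => innerInd X (inducedRep x u) v) φ η‖ ≤
          normInd X u * normInd X v * sobolevNorm b (N + n) φ * japaneseBracket D ^ (-(N : ℤ)) := by
    rintro r b φ hφ l η 𝔪 D rfl k X hX u hu v hv
    rw [japaneseBracket_zero, one_zpow, mul_one]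
    refine (norm_fourierInt_le hX hu hv hφ η).trans
      ((absPairing_toReal_le hX hu hv hφ η).trans ?_)
    exact mul_le_mul_of_nonneg_left (integral_norm_le_sobolevNorm_zero b hφ.contDiff _)
      (mul_nonneg (normInd_nonneg X u) (normInd_nonneg X v))
  -- In the zero algebra there is no unit vector, so the distance cannot be positive. When it is
  -- zero, the bracket is 1 and the trivial L¹ bound suffices.
  rcases subsingleton_or_nontrivial 𝔤 with hs | hs
  · refine ⟨1, one_pos, fun b φ hφ l η 𝔪 hm k X hX u hu v hv =>
      hzero 1 b φ hφ l η 𝔪 _ ?_ k X hX u hu v hv⟩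
    by_contra hD
    obtain ⟨Y, hY, -⟩ := exists_unit_vector hm η 0 (mul_nonneg hε.le (norm_nonneg η))
      (lt_of_le_of_ne (setDist_nonneg _ _) (Ne.symm hD))
    rw [Subsingleton.elim Y 0, norm_zero] at hY
    exact zero_ne_one hY
  · obtain ⟨r, hr, h⟩ := eventually_absPairing_le (𝔤 := 𝔤) hn N hε
    refine ⟨r, hr, fun b φ hφ l η 𝔪 hm k X hX u hu v hv => ?_⟩
    by_cases hD : setDist (Metric.closedBall η (ε * ‖η‖)) (coadjointOrbit l) = 0
    · exact hzero r b φ hφ l η 𝔪 _ hD k X hX u hu v hv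
    · have h1 := h b φ hφ l η 𝔪 hm (lt_of_le_of_ne (setDist_nonneg _ _) (Ne.symm hD)) k X hX u hu v hv
      refine (norm_fourierInt_le hX hu hv hφ η).trans ?_
      rw [zpow_neg, zpow_natCast, ← div_eq_mul_inv, le_div_iff₀ (pow_pos (japaneseBracket_pos _) N),
        mul_comm]
      exact h1

/-- An estimate of matrix coefficients extends to Hilbert sums. -/
lemma norm_fourierInt_sum_le {l : StrongDual ℝ 𝔤} {𝔪 : LieSubalgebra ℝ 𝔤} {k : ℕ} {X : Fin k → 𝔤}
    (hX : IsMalcevBasisMod 𝔪 X) {r : ℝ} {φ : 𝔤 → ℂ} (hφ : IsTest r φ) (η : StrongDual ℝ 𝔤) {K : ℝ}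
    (hK0 : 0 ≤ K)
    (hK : ∀ u ∈ inducedSpace l 𝔪 X, ∀ v ∈ inducedSpace l 𝔪 X,
      ‖fourierInt (fun x => innerInd X (inducedRep x u) v) φ η‖ ≤ normInd X u * normInd X v * K)
    {ι : Type} [Countable ι] {u v : ι → 𝔤 → ℂ} (hu : u ∈ inducedSpaceSum ι l 𝔪 X)
    (hv : v ∈ inducedSpaceSum ι l 𝔪 X) :
    ‖fourierInt (fun x => innerIndSum X (fun i => inducedRep x (u i)) v) φ η‖ ≤
      normIndSum X u * normIndSum X v * K := by
  have hcs := Real.inner_le_Lp_mul_Lq_tsum_of_nonneg (f := fun i => normInd X (u i))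
    (g := fun i => normInd X (v i)) Real.HolderConjugate.two_two
    (fun i => normInd_nonneg X (u i)) (fun i => normInd_nonneg X (v i))
    (by simpa only [Real.rpow_two] using hu.2) (by simpa only [Real.rpow_two] using hv.2)
  simp only [Real.rpow_two, ← Real.sqrt_eq_rpow] at hcs
  have hsum : Summable fun i => normInd X (u i) * normInd X (v i) := by
    refine Summable.of_nonneg_of_le (fun i => mul_nonneg (normInd_nonneg _ _) (normInd_nonneg _ _))
      (fun i => ?_) (hu.2.add hv.2)
    nlinarith [sq_nonneg (normInd X (u i) - normInd X (v i)), sq_nonneg (normInd X (u i)),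
      sq_nonneg (normInd X (v i))]
  set F : ι → 𝔤 → ℂ := fun i x => innerInd X (inducedRep x (u i)) (v i) * φ x *
    Complex.exp (-(2 * Real.pi * Complex.I * (η x : ℂ))) with hF
  have hFint : ∀ i, Integrable (F i) := by
    intro i
    have h1 := (integrable_coefficient hX (hu.1 i) (hv.1 i) hφ η).integral_prod_right
    refine h1.congr (Filter.Eventually.of_forall fun x => ?_)
    simp only [hF, innerInd, inducedRep, Function.uncurry_apply_pair]
    rw [mul_assoc, ← integral_mul_const]
    refine integral_congr_ae (Filter.Eventually.of_forall fun t => ?_)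
    simp only [expChar]
    ring
  have hFnorm : ∀ i x, ‖F i x‖ ≤ normInd X (u i) * normInd X (v i) * ‖φ x‖ := by
    intro i x
    have h1 : ‖Complex.exp (-(2 * Real.pi * Complex.I * (η x : ℂ)))‖ = 1 := norm_expChar η x
    rw [hF]
    simp only
    rw [norm_mul, norm_mul, h1, mul_one]
    refine mul_le_mul_of_nonneg_right ?_ (norm_nonneg _)
    have h2 : ‖innerInd X (inducedRep x (u i)) (v i)‖ₑ ≤
        ENNReal.ofReal (normInd X (u i) * normInd X (v i)) := by
      rw [ENNReal.ofReal_mul (normInd_nonneg _ _)]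
      refine (enorm_integral_le_lintegral_enorm _).trans ((lintegral_congr fun t => ?_).trans_le
        (lintegral_mul_le_normInd hX (hu.1 i) (hv.1 i) x))
      rw [enorm_mul, ← ofReal_norm (starRingEnd ℂ _), RCLike.norm_conj, ofReal_norm]
      rfl
    rw [← toReal_enorm]
    exact ENNReal.toReal_le_of_le_ofReal (mul_nonneg (normInd_nonneg _ _) (normInd_nonneg _ _)) h2
  -- The bound by ‖uᵢ‖ ‖vᵢ‖ |φ|, summable by square summability of both families, permits exchanging
  -- the sum with the integral. Cauchy-Schwarz over the index then recombines the norms.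
  have hFsum : Summable fun i => ∫ x, ‖F i x‖ := by
    refine Summable.of_nonneg_of_le (fun i => integral_nonneg fun _ => norm_nonneg _) (fun i => ?_)
      (hsum.mul_right (∫ x, ‖φ x‖))
    rw [← integral_const_mul]
    exact integral_mono (hFint i).norm (hφ.integrable.norm.const_mul _) (hFnorm i)
  have hswap := hasSum_integral_of_summable_integral_norm hFint hFsum
  have heq : fourierInt (fun x => innerIndSum X (fun i => inducedRep x (u i)) v) φ η =
      ∫ x, ∑' i, F i x := by
    refine integral_congr_ae (Filter.Eventually.of_forall fun x => ?_)
    simp only [hF, innerIndSum]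
    rw [tsum_mul_right, tsum_mul_right]
  rw [heq, ← hswap.tsum_eq]
  refine (tsum_of_norm_bounded (hsum.mul_right K).hasSum fun i => hK _ (hu.1 i) _ (hv.1 i)).trans ?_
  rw [tsum_mul_right]
  exact mul_le_mul_of_nonneg_right hcs hK0

end Estimate

end

end NilpotentOrbit

open NilpotentOrbit in
theorem mainTheorem3 (𝔫 : Type u) [MetricLieAlgebra 𝔫] [FiniteDimensional ℝ 𝔫]
    [LieRing.IsNilpotent 𝔫] (n N : ℕ) (hN : n < N) :
    ∃ C : ℝ, 0 < C ∧
      ∀ (𝔤 : Type u) [MetricLieAlgebra 𝔤] [FiniteDimensional ℝ 𝔤] [LieRing.IsNilpotent 𝔤]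
        [MeasurableSpace 𝔤] [BorelSpace 𝔤],
        Inherits 𝔫 𝔤 → Module.finrank ℝ 𝔤 = n →
        ∀ ε : ℝ, 0 < ε → ε < 1 →
        ∃ U ∈ 𝓝 (0 : 𝔤),
          ∀ (b : OrthonormalBasis (Fin n) ℝ 𝔤) (φ : 𝔤 → ℂ),
            ContDiff ℝ ∞ φ → HasCompactSupport φ → tsupport φ ⊆ U →
          ∀ (l η : StrongDual ℝ 𝔤) (𝔪 : LieSubalgebra ℝ 𝔤), IsPolarizing l 𝔪 →
          ∀ (k : ℕ) (X : Fin k → 𝔤), IsMalcevBasisMod 𝔪 X →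
            (∀ u ∈ inducedSpace l 𝔪 X, ∀ v ∈ inducedSpace l 𝔪 X,
              ‖fourierInt (fun x => innerInd X (inducedRep x u) v) φ η‖ ≤
                C * normInd X u * normInd X v * sobolevNorm b (N + n) φ *
                  japaneseBracket (setDist (Metric.closedBall η (ε * ‖η‖)) (coadjointOrbit l))
                    ^ (-(N : ℤ))) ∧
            (∀ (ι : Type) [Countable ι],
              ∀ u ∈ inducedSpaceSum ι l 𝔪 X, ∀ v ∈ inducedSpaceSum ι l 𝔪 X,
              ‖fourierInt (fun x => innerIndSum X (fun i => inducedRep x (u i)) v) φ η‖ ≤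
                C * normIndSum X u * normIndSum X v * sobolevNorm b (N + n) φ *
                  japaneseBracket (setDist (Metric.closedBall η (ε * ‖η‖)) (coadjointOrbit l))
                    ^ (-(N : ℤ))) := by
  -- The neighbourhood may depend on 𝔤 and ε and has already absorbed all constants, so 1 serves for
  -- every 𝔤 at once.
  refine ⟨1, one_pos, fun 𝔤 _ _ _ _ _ _ hn ε hε _ => ?_⟩
  obtain ⟨r, hr, h⟩ := exists_radius hn N hε
  refine ⟨Metric.closedBall 0 r, Metric.closedBall_mem_nhds 0 hr,
    fun b φ hφ _ hsupp l η 𝔪 h𝔪 k X hX => ?_⟩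
  have hT : IsTest r φ := ⟨hφ, hsupp⟩
  have hS : 0 ≤ sobolevNorm b (N + n) φ :=
    (integral_nonneg fun _ => norm_nonneg _).trans
      (integral_norm_le_sobolevNorm_zero b hφ (N + n))
  refine ⟨fun u hu v hv => ?_, fun ι _ u hu v hv => ?_⟩
  · rw [one_mul]
    exact h b φ hT l η 𝔪 h𝔪 k X hX u hu v hv
  · rw [one_mul, mul_assoc]
    refine norm_fourierInt_sum_le hX hT η
      (mul_nonneg hS (zpow_nonneg (japaneseBracket_pos _).le _)) (fun u hu v hv => ?_) hu hv
    rw [← mul_assoc]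
    exact h b φ hT l η 𝔪 h𝔪 k X hX u hu v hv
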